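/- **Conventions.** A self-similar group $(G,\mathfrak B)$ is a group $G$ with a set $\mathfrak B$ carrying commuting left and right $G$-actions such that the right action is free and has finitely many orbits. A basis is a subset $\mathsf X\subset\mathfrak B$ meeting every right orbit exactly once. For a right $G$-space $\mathcal X$, $\mathcal X\otimes\mathfrak B$ is the quotient of $\mathcal X\times\mathfrak B$ ($\mathfrak B$ discrete) by $(\xi\cdot g^{-1},g\cdot x)\sim(\xi,x)$; $\mathfrak B^{\otimes n}$ is the $n$-th tensor power, $\mathfrak B^{\otimes 0}=G$. The group is contracting if for some basis $\mathsf X$ there is a finite set $\mathcal N\subset G$ such that for every $g\in G$ there is $n$ with $g|_v\in\mathcal N$ for all $v\in\mathsf X^k$, $k\ge n$, where $g\cdot v=w\cdot g|_v$ with $w\in\mathsf X^k$. The limit $G$-space $\mathcal X_G$ is the quotient of $\mathsf X^{-\omega}\times G$ (product topology, $\mathsf X$ and $G$ discrete) identifying $\ldots x_2x_1\cdot g$ with $\ldots y_2y_1\cdot h$ if there are $g_n$ in a finite subset of $G$ with $g_n\cdot x_n\cdots x_1\cdot g=y_n\cdots y_1\cdot h$ in $\mathfrak B^{\otimes n}$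 for all $n$. A space has covering dimension $\dim\le d$ if every open cover has an open refinement such that every point lies in at most $d+1$ of its elements; $\dim$ is the least such $d\ge0$ (or $\infty$). A *$d$-dimensional contracting affine model* of $(G,\mathfrak B)$ consists of an integer $m\ge1$, a simplicial complex $\Gamma$ of dimension exactly $d$ with a right action of $G$ by automorphisms that is proper and co-compact on the geometric realization (also denoted $\Gamma$), a finite-valued $G$-invariant metric $\delta$ on $\Gamma$ inducing its standard topology, and a continuous $G$-equivariant map $I:\Gamma\otimes\mathfrak B^{\otimes m}\to\Gamma$ that is piecewise affine (for every $v$, each closed simplex is a finite union of convex polytopes on each of which $\xi\mapsto I(\xi\otimes v)$ is affine) and contracting: there are $L>1$ and $n\ge1$ with $\delta(I^n(\xi_1\otimes v),I^n(\xi_2\otimes v))\le L^{-1}\delta(\xi_1,\xi_2)$ for all $\xi_1,\xi_2\in\Gamma$ and $v\in(\mathfrak B^{\otimes m})^{\otimes n}$. Here $I^n(\xi\otimes v_1\otimes\cdots\otimes v_n)=I(\cdots I(I(\xi\otimes v_1)\otimes v_2)\cdots\otimes v_n)$. **Theorem.** Let $(G,\mathfrak B)$ be a contracting self-similar group, let $\mathsf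 X$ be any basis of $\mathfrak B$, and let $\mathcal X_G$ be its limit $G$-space. 1. For every integer $d\ge 0$, $\dim\mathcal X_G\le d$ if and only if $(G,\mathfrak B)$ has a $d$-dimensional contracting affine model. In this case the model can be chosen so that $\delta$ restricts on every simplex to the $\ell^1$-distance of barycentric coordinates. 2. $\dim\mathcal X_G$ is equal to the minimal dimension $d\ge 0$ of a contracting affine model of $(G,\mathfrak B)$ (both are $\infty$ if there is none). 3. If $G$ is finitely generated, $d\ge1$, and $\dim\mathcal X_G\le d$, then there is a $d$-dimensional contracting affine model with $\Gamma$ connected, and with $\delta$ equal to the length metric on $\Gamma$ defined by the $\ell^1$-metrics on the simplices. -/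

import Mathlib

open scoped RightActions
open MulOpposite (op)

universe u

noncomputable section

namespace SelfSimilar

/-! ### Bisets, tensor products, self-similar groups

Right actions of `G` are actions of `Gᵐᵒᵖ`, written `x <• g`. -/

/-- A `G`-biset: a set with commuting left and right actions of `G`. -/
structure Biset (G : Type u) [Group G] where
  carrier : Type u
  [left : MulAction G carrier]
  [right : MulAction Gᵐᵒᵖ carrier]
  [comm : SMulCommClass G Gᵐᵒᵖ carrier]

attribute [instance] Biset.left Biset.right Biset.comm

section Tensor

variable {G : Type u} [Group G]

/-- The orbit relation on `X × B` of the action `g : (ξ, b) ↦ (ξ · g⁻¹, g · b)`. -/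
def tensorSetoid (X : Type u) [MulAction Gᵐᵒᵖ X] (B : Biset G) : Setoid (X × B.carrier) where
  r p q := ∃ g : G, q.1 = p.1 <• g⁻¹ ∧ q.2 = g • p.2
  iseqv :=
    { refl := fun p => ⟨1, by simp, by simp⟩
      symm := by
        rintro p q ⟨g, h1, h2⟩
        refine ⟨g⁻¹, ?_, ?_⟩
        · rw [h1, smul_smul, ← MulOpposite.op_mul]; simp
        · rw [h2]; simp
      trans := by
        rintro p q r ⟨g, h1, h2⟩ ⟨k, h3, h4⟩
        refine ⟨k * g, ?_, ?_⟩
        · rw [h3, h1, smul_smul, ← MulOpposite.op_mul, mul_inv_rev]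
        · rw [h4, h2, mul_smul] }

/-- The tensor product `X ⊗ B` of a right `G`-set with a `G`-biset. -/
def Tensor (X : Type u) [MulAction Gᵐᵒᵖ X] (B : Biset G) : Type u :=
  Quotient (tensorSetoid X B)

namespace Tensor

variable {X Y : Type u} [MulAction Gᵐᵒᵖ X] [MulAction Gᵐᵒᵖ Y] {B C : Biset G}

/-- The class `ξ ⊗ b`. -/
def tmul (ξ : X) (b : B.carrier) : Tensor X B := Quotient.mk (tensorSetoid X B) (ξ, b)

theorem tmul_smul (ξ : X) (g : G) (b : B.carrier) :
    (tmul (ξ <• g) b : Tensor X B) = tmul ξ (g • b) :=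
  Quotient.sound (s := tensorSetoid X B) ⟨g, by
    show ξ = (ξ <• g) <• g⁻¹
    rw [smul_smul, ← MulOpposite.op_mul]; simp, rfl⟩

theorem tmul_eq_of_rel {ξ η : X} {b c : B.carrier} (g : G) (h1 : η = ξ <• g⁻¹)
    (h2 : c = g • b) : (tmul ξ b : Tensor X B) = tmul η c :=
  Quotient.sound (s := tensorSetoid X B) ⟨g, h1, h2⟩

/-- Functions out of a tensor product. -/
def lift {α : Type u} (f : X → B.carrier → α)
    (hf : ∀ ξ (g : G) b, f (ξ <• g) b = f ξ (g • b)) : Tensor X B → α :=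
  Quotient.lift (s := tensorSetoid X B) (fun p => f p.1 p.2) (by
    rintro ⟨ξ, b⟩ ⟨η, c⟩ ⟨g, h1, h2⟩
    simp only at h1 h2
    subst h1 h2
    show f ξ b = f (ξ <• g⁻¹) (g • b)
    rw [hf]; simp)

theorem ind {p : Tensor X B → Prop} (h : ∀ ξ b, p (tmul ξ b)) (t : Tensor X B) : p t :=
  Quotient.ind (fun x => h x.1 x.2) t

/-- The right action `(ξ ⊗ b) · g = ξ ⊗ (b · g)`. -/
instance : MulAction Gᵐᵒᵖ (Tensor X B) where
  smul g := lift (fun ξ b => tmul ξ (g • b)) (fun ξ k b => by rw [tmul_smul, smul_comm])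
  one_smul := ind fun ξ b => congrArg (tmul ξ) (one_smul _ b)
  mul_smul g h := ind fun ξ b => congrArg (tmul ξ) (mul_smul g h b)

/-- The left action `g · (a ⊗ b) = (g · a) ⊗ b`. -/
instance : MulAction G (Tensor B.carrier C) where
  smul g := lift (fun a c => tmul (g • a) c) (fun a k c => by rw [smul_comm, tmul_smul])
  one_smul := ind fun a c => congrArg (fun a => tmul a c) (one_smul _ a)
  mul_smul g h := ind fun a c => congrArg (fun a => tmul a c) (mul_smul g h a)

instance : SMulCommClass G Gᵐᵒᵖ (Tensor B.carrier C) where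
  smul_comm _ _ := ind fun _ _ => rfl

/-- `ξ ⊗ (b ⊗ c) ↦ (ξ ⊗ b) ⊗ c`. -/
def assoc (X : Type u) [MulAction Gᵐᵒᵖ X] (B C : Biset G) :
    Tensor X (⟨Tensor B.carrier C⟩ : Biset G) → Tensor (Tensor X B) C :=
  lift (fun ξ t => lift (fun b c => tmul (tmul ξ b) c) (fun b g c => tmul_smul (tmul ξ b) g c) t)
    (fun ξ g => ind fun b c => congrArg (fun s => tmul s c) (tmul_smul ξ g b))

/-- `f ⊗ id` for an equivariant map `f`. -/
def map (f : X →[Gᵐᵒᵖ] Y) (C : Biset G) : Tensor X C → Tensor Y C :=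
  lift (fun ξ c => tmul (f ξ) c) (fun ξ g c => by rw [map_smul, tmul_smul])

/-- The canonical map `X ⊗ G → X`, `ξ ⊗ g ↦ ξ · g`. -/
def act (X : Type u) [MulAction Gᵐᵒᵖ X] : Tensor X (⟨G⟩ : Biset G) → X :=
  lift (fun ξ (g : G) => ξ <• g)
    (fun ξ g (h : G) => by rw [smul_smul, ← MulOpposite.op_mul]; rfl)

/-- The quotient topology, where the biset is discrete. -/
instance [TopologicalSpace X] : TopologicalSpace (Tensor X B) :=
  letI : TopologicalSpace B.carrier := ⊥
  TopologicalSpace.coinduced (fun p : X × B.carrier => tmul p.1 p.2) inferInstance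

end Tensor

namespace Biset

/-- `B ⊗ C` as a biset. -/
def tensor (B C : Biset G) : Biset G := ⟨Tensor B.carrier C⟩

/-- The powers `B^{⊗ n}`, with `B^{⊗ 0} = G`. -/
def pow (B : Biset G) : ℕ → Biset G
  | 0 => ⟨G⟩
  | n + 1 => B.tensor (B.pow n)

/-- `(G, B)` is a self-similar group: the right action is free and has finitely many orbits. -/
structure IsSelfSimilar (B : Biset G) : Prop where
  free : ∀ (x : B.carrier) (g : G), x <• g = x → g = 1
  finite_orbits : Finite (MulAction.orbitRel.Quotient Gᵐᵒᵖ B.carrier)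

/-- A basis: a set meeting every right orbit exactly once. -/
def IsBasis (B : Biset G) (X : Set B.carrier) : Prop :=
  ∀ b : B.carrier, ∃! x : B.carrier, x ∈ X ∧ ∃ g : G, x <• g = b

/-- The set `X^n = {x₁ ⊗ ⋯ ⊗ xₙ : xᵢ ∈ X}`. -/
def basisPow (B : Biset G) (X : Set B.carrier) : (n : ℕ) → Set (B.pow n).carrier
  | 0 => {(1 : G)}
  | n + 1 => {w | ∃ x ∈ X, ∃ v ∈ B.basisPow X n, w = Tensor.tmul x v}

/-- `(G, B)` is contracting: for some basis `X` and some finite `N ⊆ G`, for every `g` all the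
sections `g|_v` along sufficiently long words `v` belong to `N`. For `v ∈ X^k` the section
`g|_v = h` is given by `g · v = w · h` with `w ∈ X^k`. -/
def IsContracting (B : Biset G) : Prop :=
  ∃ X : Set B.carrier, B.IsBasis X ∧ ∃ N : Set G, N.Finite ∧
    ∀ g : G, ∃ n : ℕ, ∀ k ≥ n, ∀ v ∈ B.basisPow X k, ∀ w ∈ B.basisPow X k,
      ∀ h : G, g • v = w <• h → h ∈ N

/-! ### The limit `G`-space -/

/-- For a left-infinite sequence `… x₂ x₁` (with `x₁` stored at index `0`), the element
`xₙ ⊗ ⋯ ⊗ x₂ ⊗ x₁` of `B^{⊗ n}`. -/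
def word (B : Biset G) {X : Set B.carrier} (x : ℕ → X) : (n : ℕ) → (B.pow n).carrier
  | 0 => (1 : G)
  | n + 1 => Tensor.tmul (x n : B.carrier) (B.word x n)

/-- Asymptotic equivalence of `… x₂ x₁ · g` and `… y₂ y₁ · h`: there are `gₙ` in a finite
subset of `G` with `gₙ · xₙ … x₁ · g = yₙ … y₁ · h` for all `n`. -/
def asymptoticSetoid (B : Biset G) (X : Set B.carrier) : Setoid ((ℕ → X) × G) where
  r p q := ∃ s : ℕ → G, (Set.range s).Finite ∧
    ∀ n, s n • (B.word p.1 n <• p.2) = B.word q.1 n <• q.2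
  iseqv :=
    { refl := fun p => ⟨fun _ => 1, Set.finite_range_const, fun n => one_smul _ _⟩
      symm := by
        rintro p q ⟨s, hs, h⟩
        refine ⟨fun n => (s n)⁻¹, ?_, fun n => by rw [← h n, inv_smul_smul]⟩
        refine (hs.image (fun g => g⁻¹)).subset ?_
        rintro _ ⟨n, rfl⟩
        exact ⟨s n, ⟨n, rfl⟩, rfl⟩
      trans := by
        rintro p q r ⟨s, hs, h⟩ ⟨t, ht, k⟩
        refine ⟨fun n => t n * s n, ?_, fun n => by rw [mul_smul, h n, k n]⟩
        refine (ht.image2 (fun a b => a * b) hs).subset ?_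
        rintro _ ⟨n, rfl⟩
        exact ⟨t n, ⟨n, rfl⟩, s n, ⟨n, rfl⟩, rfl⟩ }

/-- The limit `G`-space, constructed from a basis `X`. -/
def LimitGSpace (B : Biset G) (X : Set B.carrier) : Type u :=
  Quotient (B.asymptoticSetoid X)

/-- The quotient of the product topology on `X^{-ω} × G`, where `X` and `G` are discrete. -/
instance (B : Biset G) (X : Set B.carrier) : TopologicalSpace (B.LimitGSpace X) :=
  letI : TopologicalSpace X := ⊥
  letI : TopologicalSpace G := ⊥
  TopologicalSpace.coinduced (Quotient.mk (B.asymptoticSetoid X)) inferInstance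

end Biset

/-! ### Iterations of equivariant maps and contraction -/

/-- The iterations `Iⁿ : X ⊗ B^{⊗ n} → X`,
`Iⁿ(ξ ⊗ x₁ ⊗ ⋯ ⊗ xₙ) = I(⋯ I(I(ξ ⊗ x₁) ⊗ x₂) ⋯ ⊗ xₙ)`. -/
def iter {X : Type u} [MulAction Gᵐᵒᵖ X] {B : Biset G} (I : Tensor X B →[Gᵐᵒᵖ] X) :
    (n : ℕ) → Tensor X (B.pow n) → X
  | 0 => Tensor.act X
  | n + 1 => fun t => iter I n (Tensor.map I (B.pow n) (Tensor.assoc X B (B.pow n) t))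

/-- `I : X ⊗ B → X` is contracting with respect to the distance function `δ` on `X`. -/
def IsContractingMap {X : Type u} [MulAction Gᵐᵒᵖ X] {B : Biset G} (δ : X → X → ℝ)
    (I : Tensor X B →[Gᵐᵒᵖ] X) : Prop :=
  ∃ L : ℝ, 1 < L ∧ ∃ n : ℕ, 1 ≤ n ∧ ∀ (v : (B.pow n).carrier) (ξ η : X),
    δ (iter I n (Tensor.tmul ξ v)) (iter I n (Tensor.tmul η v)) ≤ L⁻¹ * δ ξ η

/-- `δ` is a (finite-valued) metric on `X` inducing the given topology. -/
structure IsMetric {X : Type u} [TopologicalSpace X] (δ : X → X → ℝ) : Prop where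
  eq_zero_iff : ∀ x y, δ x y = 0 ↔ x = y
  symm : ∀ x y, δ x y = δ y x
  triangle : ∀ x y z, δ x z ≤ δ x y + δ y z
  isOpen_iff : ∀ U : Set X, IsOpen U ↔ ∀ x ∈ U, ∃ ε > 0, ∀ y, δ x y < ε → y ∈ U

end Tensor

/-! ### Covering dimension -/

/-- `T` has (Lebesgue) covering dimension at most `d`: every open cover is refined by an open
cover such that every point belongs to at most `d + 1` of its elements. -/
def CoveringDimLE (T : Type u) [TopologicalSpace T] (d : ℕ) : Prop :=
  ∀ 𝒰 : Set (Set T), (∀ U ∈ 𝒰, IsOpen U) → ⋃₀ 𝒰 = Set.univ →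
    ∃ 𝒱 : Set (Set T), (∀ V ∈ 𝒱, IsOpen V) ∧ ⋃₀ 𝒱 = Set.univ ∧
      (∀ V ∈ 𝒱, ∃ U ∈ 𝒰, V ⊆ U) ∧ ∀ x : T, {V ∈ 𝒱 | x ∈ V}.encard ≤ d + 1

/-- The covering dimension: the least `d ≥ 0` with `CoveringDimLE T d`, or `⊤`. -/
def coveringDim (T : Type u) [TopologicalSpace T] : ℕ∞ :=
  ⨅ (d : ℕ) (_ : CoveringDimLE T d), (d : ℕ∞)

/-! ### Simplicial complexes with an action of `G`, and their realizations -/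

/-- A simplicial complex with a right action of `G` by automorphisms. -/
structure GComplex (G : Type u) [Group G] where
  V : Type u
  [action : MulAction Gᵐᵒᵖ V]
  complex : AbstractSimplicialComplex V
  map_mem : ∀ (g : G), ∀ σ ∈ complex.faces,
    σ.map (MulAction.toPerm (op g)).toEmbedding ∈ complex.faces

attribute [instance] GComplex.action

namespace GComplex

variable {G : Type u} [Group G] (Γ : GComplex G)

/-- The dimension of the complex is exactly `d`. -/
def HasDim (d : ℕ) : Prop :=
  (∃ σ ∈ Γ.complex.faces, σ.card = d + 1) ∧ ∀ σ ∈ Γ.complex.faces, σ.card ≤ d + 1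

/-- The geometric realization: points are given by their barycentric coordinates. -/
def Realization : Type u :=
  {x : Γ.V →₀ ℝ // (∀ v, 0 ≤ x v) ∧ (x.sum fun _ a => a) = 1 ∧ x.support ∈ Γ.complex.faces}

/-- The closed simplex of the realization spanned by `σ`. -/
def cell (σ : Finset Γ.V) : Set Γ.Realization := {x | x.1.support ⊆ σ}

/-- The `ℓ¹`-distance of the vectors of barycentric coordinates. -/
def l1 (x y : Γ.Realization) : ℝ := (x.1 - y.1).sum fun _ a => |a|

/-- The standard (coherent) topology: a set is open if and only if its intersection with every
closed simplex is relatively open in the standard topology of the simplex. -/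
instance : TopologicalSpace Γ.Realization where
  IsOpen U := ∀ σ ∈ Γ.complex.faces, ∀ x ∈ Γ.cell σ, x ∈ U →
    ∃ ε > 0, ∀ y ∈ Γ.cell σ, Γ.l1 x y < ε → y ∈ U
  isOpen_univ := fun _ _ _ _ _ => ⟨1, one_pos, fun _ _ _ => trivial⟩
  isOpen_inter := by
    rintro U W hU hW σ hσ x hx ⟨hxU, hxW⟩
    obtain ⟨ε, hε, h1⟩ := hU σ hσ x hx hxU
    obtain ⟨ε', hε', h2⟩ := hW σ hσ x hx hxW
    exact ⟨min ε ε', lt_min hε hε', fun y hy h =>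
      ⟨h1 y hy (h.trans_le (min_le_left _ _)), h2 y hy (h.trans_le (min_le_right _ _))⟩⟩
  isOpen_sUnion := by
    rintro S hS σ hσ x hx ⟨U, hU, hxU⟩
    obtain ⟨ε, hε, h⟩ := hS U hU σ hσ x hx hxU
    exact ⟨ε, hε, fun y hy hxy => ⟨U, hU, h y hy hxy⟩⟩

/-- The action on the realization: `(x · g)(v) = x(v · g⁻¹)`. -/
instance : MulAction Gᵐᵒᵖ Γ.Realization where
  smul g x := ⟨x.1.equivMapDomain (MulAction.toPerm g),
    fun v => by
      rw [Finsupp.equivMapDomain_apply]; exact x.2.1 _,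
    by
      rw [Finsupp.equivMapDomain_eq_mapDomain, Finsupp.sum_mapDomain_index] <;> simp [x.2.2.1],
    Γ.map_mem g.unop _ x.2.2.2⟩
  one_smul x := Subtype.ext (Finsupp.ext fun v => by
    show x.1.equivMapDomain (MulAction.toPerm (1 : Gᵐᵒᵖ)) v = x.1 v
    rw [Finsupp.equivMapDomain_apply]; simp)
  mul_smul g h x := Subtype.ext (Finsupp.ext fun v => by
    show x.1.equivMapDomain (MulAction.toPerm (g * h)) v =
      (x.1.equivMapDomain (MulAction.toPerm h)).equivMapDomain (MulAction.toPerm g) v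
    simp only [Finsupp.equivMapDomain_apply, MulAction.toPerm_symm_apply, mul_inv_rev, mul_smul])

/-- The action on the realization is co-compact. -/
def IsCocompact : Prop :=
  ∃ C : Set Γ.Realization, IsCompact C ∧ ∀ x, ∃ g : G, x <• g ∈ C

/-- A self-map of the realization is piecewise affine if every closed simplex is a finite union
of convex polytopes on each of which the map is the restriction of an affine map. -/
def IsPiecewiseAffine (f : Γ.Realization → Γ.Realization) : Prop :=
  ∀ σ ∈ Γ.complex.faces, ∃ (n : ℕ) (F : Fin n → Finset (Γ.V →₀ ℝ))
    (A : Fin n → (Γ.V →₀ ℝ) →ᵃ[ℝ] (Γ.V →₀ ℝ)), ∀ x ∈ Γ.cell σ,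
      (∃ i, x.1 ∈ convexHull ℝ (F i : Set (Γ.V →₀ ℝ))) ∧
      ∀ i, x.1 ∈ convexHull ℝ (F i : Set (Γ.V →₀ ℝ)) → (f x).1 = A i x.1

/-- `Γ.IsChain x y r`: there are points `x = x₀, …, xₙ = y` such that every `xᵢ, xᵢ₊₁` lie in a
common closed simplex, and the sum of their `ℓ¹`-distances is `r`. -/
inductive IsChain : Γ.Realization → Γ.Realization → ℝ → Prop
  | refl (x : Γ.Realization) : IsChain x x 0
  | step {x y z : Γ.Realization} {r : ℝ} (σ : Finset Γ.V) (hσ : σ ∈ Γ.complex.faces)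
      (hx : x ∈ Γ.cell σ) (hy : y ∈ Γ.cell σ) (h : IsChain y z r) : IsChain x z (Γ.l1 x y + r)

end GComplex

/-! ### Contracting affine models -/

/-- A contracting affine model of dimension `d` of `(G, B)`: a `d`-dimensional simplicial complex
`Γ` with a proper co-compact action of `G`, and, for some `m ≥ 1`, a continuous `G`-equivariant
piecewise affine map `I : Γ ⊗ B^{⊗ m} → Γ` which is contracting with respect to a `G`-invariant
metric on `Γ`. -/
structure AffineModel {G : Type u} [Group G] (B : Biset G) (d : ℕ) where
  m : ℕ
  one_le_m : 1 ≤ m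
  Γ : GComplex G
  hasDim : Γ.HasDim d
  proper : ProperlyDiscontinuousSMul Gᵐᵒᵖ Γ.Realization
  cocompact : Γ.IsCocompact
  δ : Γ.Realization → Γ.Realization → ℝ
  isMetric : IsMetric δ
  isometric : ∀ (g : G) x y, δ (x <• g) (y <• g) = δ x y
  I : Tensor Γ.Realization (B.pow m) →[Gᵐᵒᵖ] Γ.Realization
  continuous : Continuous I
  piecewiseAffine : ∀ v : (B.pow m).carrier, Γ.IsPiecewiseAffine fun ξ => I (Tensor.tmul ξ v)
  contracting : IsContractingMap δ I

namespace AffineModel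

variable {G : Type u} [Group G] {B : Biset G} {d : ℕ} (M : AffineModel B d)

/-- The metric of the model is the `ℓ¹`-distance of barycentric coordinates on every simplex. -/
def IsPiecewiseL1 : Prop :=
  ∀ σ ∈ M.Γ.complex.faces, ∀ x ∈ M.Γ.cell σ, ∀ y ∈ M.Γ.cell σ, M.δ x y = M.Γ.l1 x y

/-- The metric of the model is the length metric defined by the `ℓ¹`-metrics on the simplices. -/
def IsL1Length : Prop :=
  ∀ x y, IsGLB {r | M.Γ.IsChain x y r} (M.δ x y)

end AffineModel

end SelfSimilar

end

/-! The limit space carries a self-similarity `limitMap`, written `J : X_G ⊗ B → X_G`, which appends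
a letter. Contraction gives a finite nucleus. It makes the tiles compact and locally finite and the
action proper, it makes `J` injective with open partial maps (`limitMap_injective`,
`isOpen_limitMap_image`), and it makes the images of tiles under high iterates of `J` uniformly
small (`exists_level_subordinate`).

From a model to dimension: the contracting map of the model induces a transfer operator on maps from
sequences to `Γ`. By Banach's theorem it has a fixed point, and this fixed point descends to a
continuous equivariant map `φ : X_G → Γ` (`AffineModel.exists_map`). The preimages under `φ` of open
vertex stars form a cover of order at most `d + 1`. Iterates of `J` carry it to arbitrarily fine
covers of a tile without raising the order, because `J` is injective on the tensor product. The
locally finite sum theorem passes from tiles to the whole space (`coveringDimLE_of_map`).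

From dimension to a model: the quotient of `X_G` by `G` also has dimension at most `d` for finite
covers, as one sees by stratifying orbits by the order of the stabilizer. Pulling back a cover of
the quotient gives a `G`-invariant cover of order at most `d + 1` by relatively compact sets, finite
modulo `G` (`exists_invariant_cover`). Let `Γ` be its nerve, enlarged by `d`-simplices so that the
dimension is exactly `d`. For large `m`, the iterate `J^m` maps the zone of all vertices of a
simplex into one element of the cover. Sending a vertex to the barycenter of the simplex of all
cover elements containing the image of its zone, and extending affinely, defines `I`. Barycenters of
simplices with a common vertex are at `ℓ¹`-distance bounded away from `2`, so `I` contracts each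
simplex by a definite factor.

It remains to find a global metric. If `Γ` is connected, the length metric works. In general `Γ` is
disconnected, and the supremum of rescaled `ℓ¹`-distances between iterated images is used
(`stretchDist`). It is finite because any two points are eventually mapped to points joined by a
short chain. -/

noncomputable section

namespace SelfSimilar

open scoped Pointwise

/-! ### Bases, sections and contraction. -/

section Algebra

variable {G : Type u} [Group G] {B : Biset G}

theorem Tensor.tmul_eq_iff {T : Type u} [MulAction Gᵐᵒᵖ T] {ξ η : T} {b c : B.carrier} :
    (tmul ξ b : Tensor T B) = tmul η c ↔ ∃ g : G, η = ξ <• g⁻¹ ∧ c = g • b :=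
  ⟨fun h => Quotient.exact (s := tensorSetoid T B) h,
    fun ⟨g, h1, h2⟩ => tmul_eq_of_rel g h1 h2⟩

theorem rsmul_rsmul {T : Type u} [MulAction Gᵐᵒᵖ T] (x : T) (g h : G) :
    (x <• g) <• h = x <• (g * h) := by
  rw [smul_smul, ← MulOpposite.op_mul]

theorem rsmul_one {T : Type u} [MulAction Gᵐᵒᵖ T] (x : T) : x <• (1 : G) = x := by simp

namespace Biset

variable {X : Set B.carrier}

/-- The representative in the basis `X` of the right orbit of `b`. -/
def letter (hX : B.IsBasis X) (b : B.carrier) : X :=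
  ⟨(hX b).choose, (hX b).choose_spec.1.1⟩

/-- The element of `G` with `b = letter b · coef b`. -/
def coef (hX : B.IsBasis X) (b : B.carrier) : G := (hX b).choose_spec.1.2.choose

theorem letter_coef (hX : B.IsBasis X) (b : B.carrier) :
    (letter hX b : B.carrier) <• coef hX b = b := (hX b).choose_spec.1.2.choose_spec

theorem basis_unique (hB : B.IsSelfSimilar) (hX : B.IsBasis X) {x y : X} {g h : G}
    (e : (x : B.carrier) <• g = (y : B.carrier) <• h) : x = y ∧ g = h := by
  have hxy : x = y := Subtype.ext <|
    (hX ((y : B.carrier) <• h)).unique ⟨x.2, g, e⟩ ⟨y.2, h, rfl⟩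
  subst hxy
  refine ⟨rfl, ?_⟩
  have : (x : B.carrier) <• (g * h⁻¹) = x := by
    rw [← rsmul_rsmul, e, rsmul_rsmul, mul_inv_cancel, rsmul_one]
  exact mul_inv_eq_one.mp (hB.free _ _ this)

theorem letter_eq (hB : B.IsSelfSimilar) (hX : B.IsBasis X) {x : X} {g : G} {b : B.carrier}
    (e : (x : B.carrier) <• g = b) : letter hX b = x ∧ coef hX b = g :=
  basis_unique hB hX ((letter_coef hX b).trans e.symm)

theorem letter_basis (hB : B.IsSelfSimilar) (hX : B.IsBasis X) (x : X) :
    letter hX (x : B.carrier) = x ∧ coef hX (x : B.carrier) = 1 :=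
  letter_eq hB hX (rsmul_one _)

theorem letter_rsmul (hB : B.IsSelfSimilar) (hX : B.IsBasis X) (b : B.carrier) (g : G) :
    letter hX (b <• g) = letter hX b ∧ coef hX (b <• g) = coef hX b * g :=
  letter_eq hB hX (by rw [← rsmul_rsmul, letter_coef])

theorem smul_letter (hX : B.IsBasis X) (g : G) (b : B.carrier) :
    g • b = (g • (letter hX b : B.carrier)) <• coef hX b := by
  conv_lhs => rw [← letter_coef hX b, smul_comm]

theorem letter_smul (hB : B.IsSelfSimilar) (hX : B.IsBasis X) (g : G) (b : B.carrier) :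
    letter hX (g • b) = letter hX (g • (letter hX b : B.carrier)) ∧
    coef hX (g • b) = coef hX (g • (letter hX b : B.carrier)) * coef hX b := by
  have := letter_rsmul hB hX (g • (letter hX b : B.carrier)) (coef hX b)
  rwa [← smul_letter] at this

theorem finite_basis (hB : B.IsSelfSimilar) (hX : B.IsBasis X) : Finite X := by
  have := hB.finite_orbits
  refine Finite.of_injective
    (fun x : X => (Quotient.mk _ (x : B.carrier) :
      MulAction.orbitRel.Quotient Gᵐᵒᵖ B.carrier)) fun x y e => ?_
  obtain ⟨g, hg⟩ := MulAction.orbitRel_apply.mp (Quotient.exact e)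
  refine (basis_unique hB hX (g := 1) (h := g.unop) ?_).1
  rw [rsmul_one]; exact hg.symm

/-- The set of sections of `g` along words of length `k`. -/
def Sec (hX : B.IsBasis X) : ℕ → G → Set G
  | 0, g => {g}
  | k + 1, g => {h | ∃ x : X, h ∈ Sec hX k (coef hX (g • (x : B.carrier)))}

theorem finite_sec (hB : B.IsSelfSimilar) (hX : B.IsBasis X) (k : ℕ) (g : G) :
    (Sec hX k g).Finite := by
  have := finite_basis hB hX
  induction k generalizing g with
  | zero => exact Set.finite_singleton g
  | succ k ih =>
    have : Sec hX (k + 1) g = ⋃ x : X, Sec hX k (coef hX (g • (x : B.carrier))) := by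
      ext h; simp [Sec]
    rw [this]
    exact Set.finite_iUnion fun x => ih _

theorem mem_sec_add (hX : B.IsBasis X) {j k : ℕ} {g h : G} :
    h ∈ Sec hX (j + k) g ↔ ∃ t ∈ Sec hX j g, h ∈ Sec hX k t := by
  induction j generalizing g with
  | zero => simp [Sec]
  | succ j ih =>
    rw [Nat.succ_add]
    constructor
    · rintro ⟨x, hx⟩
      obtain ⟨t, ht, h'⟩ := ih.mp hx
      exact ⟨t, ⟨x, ht⟩, h'⟩
    · rintro ⟨t, ⟨x, hx⟩, h'⟩
      exact ⟨x, ih.mpr ⟨t, hx, h'⟩⟩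

theorem sec_one (hB : B.IsSelfSimilar) (hX : B.IsBasis X) (k : ℕ) :
    Sec hX k (1 : G) ⊆ {1} := by
  induction k with
  | zero => exact subset_rfl
  | succ k ih =>
    rintro h ⟨x, hx⟩
    rw [one_smul, (letter_basis hB hX x).2] at hx
    exact ih hx

theorem sec_mul (hB : B.IsSelfSimilar) (hX : B.IsBasis X) (k : ℕ) (g g' : G) :
    Sec hX k (g * g') ⊆ Sec hX k g * Sec hX k g' := by
  induction k generalizing g g' with
  | zero => simp [Sec]
  | succ k ih =>
    rintro h ⟨x, hx⟩
    rw [mul_smul, (letter_smul hB hX g (g' • (x : B.carrier))).2] at hx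
    obtain ⟨a, ha, b, hb, rfl⟩ := ih _ _ hx
    exact ⟨a, ⟨_, ha⟩, b, ⟨x, hb⟩, rfl⟩

theorem sec_mem_pow (hB : B.IsSelfSimilar) (hX : B.IsBasis X) {k : ℕ} {C D : Set G}
    (h : ∀ g ∈ C, Sec hX k g ⊆ D) (r : ℕ) : ∀ g ∈ C ^ r, Sec hX k g ⊆ D ^ r := by
  induction r with
  | zero =>
    intro g hg
    obtain rfl : g = 1 := by simpa using hg
    rw [pow_zero]
    exact sec_one hB hX k
  | succ r ih =>
    rintro g hg
    rw [pow_succ] at hg ⊢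
    obtain ⟨a, ha, b, hb, rfl⟩ := hg
    exact (sec_mul hB hX k a b).trans (Set.mul_subset_mul (ih a ha) (h b hb))

theorem exists_basisPow_of_mem_sec (hX : B.IsBasis X) {k : ℕ} {g h : G} (hh : h ∈ Sec hX k g) :
    ∃ v ∈ B.basisPow X k, ∃ w ∈ B.basisPow X k, g • v = w <• h := by
  induction k generalizing g with
  | zero =>
    obtain rfl : h = g := hh
    refine ⟨(1 : G), rfl, (1 : G), rfl, ?_⟩
    show h * 1 = 1 * h
    simp
  | succ k ih =>
    obtain ⟨x, hx⟩ := hh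
    obtain ⟨v, hv, w, hw, e⟩ := ih hx
    refine ⟨Tensor.tmul (x : B.carrier) v, ⟨x, x.2, v, hv, rfl⟩,
      Tensor.tmul (letter hX (g • (x : B.carrier)) : B.carrier) w,
      ⟨_, (letter hX _).2, w, hw, rfl⟩, ?_⟩
    show Tensor.tmul (g • (x : B.carrier)) v =
      Tensor.tmul (letter hX (g • (x : B.carrier)) : B.carrier) (w <• h)
    rw [← e, ← Tensor.tmul_smul, letter_coef]

theorem tmul_basis_inj (hB : B.IsSelfSimilar) (hX : B.IsBasis X) {C : Biset G} {x y : X}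
    {v w : C.carrier} (e : (Tensor.tmul (x : B.carrier) v : Tensor B.carrier C) =
      Tensor.tmul (y : B.carrier) w) : x = y ∧ v = w := by
  obtain ⟨g, h1, rfl⟩ := Tensor.tmul_eq_iff.mp e
  obtain ⟨rfl, h⟩ := basis_unique hB hX (h := 1) (h1.symm.trans (rsmul_one _).symm)
  rw [inv_eq_one] at h
  exact ⟨rfl, by rw [h, one_smul]⟩

/-- The set `N` eventually contains all sections of every element. -/
def Absorbing (hX : B.IsBasis X) (N : Set G) : Prop :=
  ∀ g : G, ∃ n : ℕ, ∀ k ≥ n, Sec hX k g ⊆ N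

theorem Absorbing.of_finite {hX : B.IsBasis X} {N : Set G} (hN : Absorbing hX N) {A : Set G}
    (hA : A.Finite) : ∃ n : ℕ, ∀ k ≥ n, ∀ g ∈ A, Sec hX k g ⊆ N := by
  choose n hn using hN
  obtain ⟨M, hM⟩ := (hA.image n).bddAbove
  exact ⟨M, fun k hk g hg => hn g k ((hM ⟨g, hg, rfl⟩).trans hk)⟩

/-- All sections of the finite set `A ∪ N` at levels at least `n` lie in `N`, so the set of its
sections of all levels is `N` together with those of finitely many levels. A section of a section is
a section, whence invariance. -/
theorem Absorbing.exists_closure {hX : B.IsBasis X} (hB : B.IsSelfSimilar) {N : Set G}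
    (hN : Absorbing hX N) (hfin : N.Finite) {A : Set G} (hA : A.Finite) :
    ∃ D : Set G, D.Finite ∧ A ⊆ D ∧ N ⊆ D ∧ ∀ k, ∀ g ∈ D, Sec hX k g ⊆ D := by
  have hAN : (A ∪ N).Finite := hA.union hfin
  obtain ⟨n, hn⟩ := hN.of_finite hAN
  refine ⟨{h | ∃ k, ∃ g ∈ A ∪ N, h ∈ Sec hX k g}, ?_, fun g hg => ⟨0, g, Or.inl hg, rfl⟩,
    fun g hg => ⟨0, g, Or.inr hg, rfl⟩, ?_⟩
  · refine (hfin.union ((Finset.range n).finite_toSet.biUnion fun k _ =>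
      hAN.biUnion fun g _ => finite_sec hB hX k g)).subset ?_
    rintro h ⟨k, g, hg, hh⟩
    by_cases hk : n ≤ k
    · exact Or.inl (hn k hk g hg hh)
    · refine Or.inr (Set.mem_biUnion (x := k) (by simpa using hk) (Set.mem_biUnion hg hh))
  · rintro k g ⟨j, a, ha, hg⟩ h hh
    exact ⟨j + k, a, ha, (mem_sec_add hX).mpr ⟨g, hg, hh⟩⟩

/-! ### Change of basis. -/

/-- The elements `e` with `c · v = v' · e`, where `v ∈ X^k` and `v' ∈ Y^k`. -/
def Reach (Xs : Set B.carrier) {Y : Set B.carrier} (hY : B.IsBasis Y) : ℕ → G → Set G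
  | 0, c => {c}
  | k + 1, c => {e | ∃ x : Xs, ∃ y : Y,
      e ∈ Reach Xs hY k (coef hY (c • (y : B.carrier)) * coef hY (x : B.carrier))}

/-- If `x = y · a` and `c · y = y' · c'` with `y, y'` in `Y`, then `c · x = y' · (c' a)`, and `c' a`
acts on the rest of the word. `Reach` lets `x` and `y` vary independently, so it may be larger than
necessary. -/
theorem exists_reach {Y : Set B.carrier} (hY : B.IsBasis Y) {k : ℕ} (c : G)
    {v : (B.pow k).carrier} (hv : v ∈ B.basisPow X k) :
    ∃ v' ∈ B.basisPow Y k, ∃ e ∈ Reach X hY k c, c • v = v' <• e := by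
  induction k generalizing c with
  | zero =>
    obtain rfl : v = (1 : G) := hv
    refine ⟨(1 : G), rfl, c, rfl, ?_⟩
    show c * 1 = 1 * c
    simp
  | succ k ih =>
    obtain ⟨x, hx, v', hv', rfl⟩ := hv
    obtain ⟨w, hw, e, he, h⟩ :=
      ih (coef hY (c • (letter hY x : B.carrier)) * coef hY x) hv'
    refine ⟨Tensor.tmul (letter hY (c • (letter hY x : B.carrier)) : B.carrier) w,
      ⟨_, (letter hY _).2, w, hw, rfl⟩, e, ⟨⟨x, hx⟩, letter hY x, he⟩, ?_⟩
    show Tensor.tmul (c • x) v' =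
      Tensor.tmul (letter hY (c • (letter hY x : B.carrier)) : B.carrier) (w <• e)
    rw [← h, ← Tensor.tmul_smul, ← rsmul_rsmul, letter_coef, ← smul_letter]

theorem mem_reach_add {Y : Set B.carrier} (hY : B.IsBasis Y) {j k : ℕ} {g h : G} :
    h ∈ Reach X hY (j + k) g ↔ ∃ t ∈ Reach X hY j g, h ∈ Reach X hY k t := by
  induction j generalizing g with
  | zero => simp [Reach]
  | succ j ih =>
    rw [Nat.succ_add]
    constructor
    · rintro ⟨x, y, hx⟩
      obtain ⟨t, ht, h'⟩ := ih.mp hx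
      exact ⟨t, ⟨x, y, ht⟩, h'⟩
    · rintro ⟨t, ⟨x, y, hx⟩, h'⟩
      exact ⟨x, y, ih.mpr ⟨t, hx, h'⟩⟩

theorem reach_mul (hB : B.IsSelfSimilar) {Y : Set B.carrier} (hY : B.IsBasis Y) (k : ℕ)
    (g c : G) : Reach X hY k (g * c) ⊆ Sec hY k g * Reach X hY k c := by
  induction k generalizing g c with
  | zero => simp [Reach, Sec]
  | succ k ih =>
    rintro e ⟨x, y, he⟩
    rw [mul_smul, (letter_smul hB hY g (c • (y : B.carrier))).2, mul_assoc] at he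
    obtain ⟨a, ha, b, hb, rfl⟩ := ih _ _ he
    exact ⟨a, ⟨_, ha⟩, b, ⟨x, y, hb⟩, rfl⟩

/-- Sections do not increase the length of a product of elements of `D`, and every letter of `X`
contributes one new factor `coef hY x`. -/
theorem reach_pow (hB : B.IsSelfSimilar) {Y : Set B.carrier} (hY : B.IsBasis Y) {D : Set G}
    (hD : ∀ k, ∀ g ∈ D, Sec hY k g ⊆ D) (hA : ∀ x ∈ X, coef hY x ∈ D) (k r : ℕ) :
    ∀ c ∈ D ^ r, Reach X hY k c ⊆ D ^ (r + k) := by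
  induction k generalizing r with
  | zero => rintro c hc _ rfl; exact hc
  | succ k ih =>
    rintro c hc e ⟨x, y, he⟩
    have h1 : coef hY (c • (y : B.carrier)) ∈ D ^ r :=
      sec_mem_pow hB hY (hD 1) r c hc ⟨y, rfl⟩
    have := ih (r + 1) _ (by rw [pow_succ]; exact Set.mul_mem_mul h1 (hA x x.2)) he
    rwa [add_assoc, add_comm 1 k] at this

theorem finite_set_pow {D : Set G} (hD : D.Finite) (r : ℕ) : (D ^ r).Finite := by
  induction r with
  | zero => simp
  | succ r ih => rw [pow_succ]; exact ih.mul hD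

/-- Growth against contraction: `k` steps add at most `k` factors from `D`, while sections at level
`k` halve the length of a product. Hence `D ^ (2 * k)` is mapped to itself by `k` steps, and the
remaining fewer than `k` steps lead at most to `D ^ (2 * k + k)`. -/
theorem finite_reach (hB : B.IsSelfSimilar) (hX : B.IsBasis X) {Y : Set B.carrier}
    (hY : B.IsBasis Y) {N : Set G} (hN : Absorbing hY N) (hfin : N.Finite) :
    ∃ P : Set G, P.Finite ∧ ∀ k, Reach X hY k 1 ⊆ P := by
  have := finite_basis hB hX
  have hA : ({1} ∪ Set.range fun x : X => coef hY (x : B.carrier)).Finite :=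
    (Set.finite_singleton _).union (Set.finite_range _)
  obtain ⟨D, hDfin, hAD, hND, hD⟩ := hN.exists_closure hB hfin hA
  have h1 : (1 : G) ∈ D := hAD (Or.inl rfl)
  have hcD : ∀ x ∈ X, coef hY x ∈ D := fun x hx => hAD (Or.inr ⟨⟨x, hx⟩, rfl⟩)
  obtain ⟨K, hK⟩ := hN.of_finite (hDfin.mul hDfin)
  -- The successor makes `k` positive, as needed for dividing levels by `k` with remainder.
  set k := K + 1
  have hk : ∀ g ∈ D ^ 2, Sec hY k g ⊆ D := fun g hg => by
    rw [pow_two] at hg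
    exact (hK k (Nat.le_succ K) g hg).trans hND
  have hstep : ∀ c ∈ D ^ (2 * k), Reach X hY k c ⊆ D ^ (2 * k) := by
    intro c hc
    have h2 : Sec hY k c ⊆ D ^ k := by
      rw [pow_mul] at hc
      exact sec_mem_pow hB hY hk k c hc
    have h3 : Reach X hY k (1 : G) ⊆ D ^ k := by
      simpa using reach_pow hB hY hD hcD k 0 1 (by simp)
    have := reach_mul (X := X) hB hY k c 1
    rw [mul_one] at this
    refine this.trans ((Set.mul_subset_mul h2 h3).trans ?_)
    rw [← pow_add, two_mul]
  have hq : ∀ q, ∀ c ∈ D ^ (2 * k), Reach X hY (k * q) c ⊆ D ^ (2 * k) := by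
    intro q
    induction q with
    | zero => rintro c hc _ rfl; exact hc
    | succ q ih =>
      rintro c hc e he
      rw [mul_add, mul_one] at he
      obtain ⟨t, ht, he⟩ := (mem_reach_add hY).mp he
      exact hstep t (ih c hc ht) he
  refine ⟨D ^ (2 * k + k), finite_set_pow hDfin _, fun j e he => ?_⟩
  rw [← Nat.div_add_mod j k] at he
  obtain ⟨t, ht, he⟩ := (mem_reach_add hY).mp he
  have h4 := reach_pow hB hY hD hcD (j % k) (2 * k) t
    (hq _ 1 (Set.one_mem_pow h1) ht) he
  exact Set.pow_subset_pow_right h1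
    (Nat.add_le_add_left (Nat.mod_lt _ (Nat.succ_pos K)).le _) h4

/-- Contraction does not depend on the choice of a basis. -/
theorem IsContracting.exists_absorbing (hB : B.IsSelfSimilar) (hc : B.IsContracting)
    (hX : B.IsBasis X) : ∃ N : Set G, N.Finite ∧ Absorbing hX N := by
  obtain ⟨Y, hY, N, hfin, hN⟩ := hc
  have hNabs : Absorbing hY N := fun g => by
    obtain ⟨n, hn⟩ := hN g
    refine ⟨n, fun k hk h hh => ?_⟩
    obtain ⟨v, hv, w, hw, e⟩ := exists_basisPow_of_mem_sec hY hh
    exact hn k hk v hv w hw h e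
  obtain ⟨P, hP, hR⟩ := finite_reach hB hX hY hNabs hfin
  refine ⟨P⁻¹ * N * P, (hP.inv.mul hfin).mul hP, fun g => ?_⟩
  obtain ⟨n, hn⟩ := hN g
  refine ⟨n, fun k hk h hh => ?_⟩
  obtain ⟨v, hv, w, hw, e⟩ := exists_basisPow_of_mem_sec hX hh
  obtain ⟨v', hv', c, hc, e1⟩ := exists_reach hY 1 hv
  obtain ⟨w', hw', c', hc', e2⟩ := exists_reach hY 1 hw
  rw [one_smul] at e1 e2
  -- With `v = v' · c` and `w = w' · c'`, the section `h` in the basis `X` becomes `c' h c⁻¹` in the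
  -- basis `Y`.
  have h3 : g • v' = w' <• (c' * h * c⁻¹) := by
    have : g • v' = (g • v) <• c⁻¹ := by
      rw [e1, smul_comm g (op c) v', rsmul_rsmul, mul_inv_cancel, rsmul_one]
    rw [this, e, e2, rsmul_rsmul, rsmul_rsmul, mul_assoc]
  have h4 := hn k hk v' hv' w' hw' _ h3
  refine ⟨c'⁻¹ * (c' * h * c⁻¹), ⟨c'⁻¹, Set.inv_mem_inv.mpr (hR k hc'), _, h4, rfl⟩, c,
    hR k hc, ?_⟩
  show c'⁻¹ * (c' * h * c⁻¹) * c = h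
  group

/-! ### The nucleus and the asymptotic equivalence. -/

/-- A finite set containing `1`, closed under sections and absorbing all sections. -/
structure IsNucleus (hX : B.IsBasis X) (N : Set G) : Prop where
  finite : N.Finite
  sec_subset : ∀ k, ∀ g ∈ N, Sec hX k g ⊆ N
  absorbing : Absorbing hX N

theorem IsContracting.exists_nucleus (hB : B.IsSelfSimilar) (hc : B.IsContracting)
    (hX : B.IsBasis X) : ∃ N : Set G, IsNucleus hX N := by
  obtain ⟨N, hfin, hN⟩ := hc.exists_absorbing hB hX
  obtain ⟨D, hD, -, h2, h3⟩ := hN.exists_closure hB hfin Set.finite_empty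
  refine ⟨D, hD, h3, fun g => ?_⟩
  obtain ⟨n, hn⟩ := hN g
  exact ⟨n, fun k hk => (hn k hk).trans h2⟩

/-- The relation `s · xₙ … x₁ · g = yₙ … y₁ · h` on pairs `… x₂ x₁ · g` and `… y₂ y₁ · h`. -/
def Rel (hX : B.IsBasis X) : ℕ → G → (ℕ → X) × G → (ℕ → X) × G → Prop
  | 0, s, p, q => s * p.2 = q.2
  | n + 1, s, p, q => letter hX (s • (p.1 n : B.carrier)) = q.1 n ∧
      Rel hX n (coef hX (s • (p.1 n : B.carrier))) p q

theorem rel_iff (hB : B.IsSelfSimilar) (hX : B.IsBasis X) {n : ℕ} {s : G}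
    {p q : (ℕ → X) × G} :
    Rel hX n s p q ↔ s • (B.word p.1 n <• p.2) = B.word q.1 n <• q.2 := by
  induction n generalizing s with
  | zero =>
    show s * p.2 = q.2 ↔ s * (1 * p.2) = 1 * q.2
    simp
  | succ n ih =>
    have e : s • (B.word p.1 (n + 1) <• p.2) =
        (Tensor.tmul (letter hX (s • (p.1 n : B.carrier)) : B.carrier)
          (coef hX (s • (p.1 n : B.carrier)) • (B.word p.1 n <• p.2)) :
          Tensor B.carrier (B.pow n)) := by
      show (Tensor.tmul (s • (p.1 n : B.carrier)) (B.word p.1 n <• p.2) :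
        Tensor B.carrier (B.pow n)) = _
      rw [← Tensor.tmul_smul, letter_coef]
    rw [e]
    show _ ∧ _ ↔ _ = (Tensor.tmul (q.1 n : B.carrier) (B.word q.1 n <• q.2) :
        Tensor B.carrier (B.pow n))
    rw [ih]
    constructor
    · rintro ⟨h1, h2⟩
      rw [h1, h2]
    · exact fun h => tmul_basis_inj hB hX h

/-- Letting `s` pass through the `j` leftmost letters leaves a section of `s` in front of the
remaining `n` letters. -/
theorem Rel.sec {hX : B.IsBasis X} {n j : ℕ} {s : G} {p q : (ℕ → X) × G}
    (h : Rel hX (n + j) s p q) : ∃ t ∈ Sec hX j s, Rel hX n t p q := by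
  induction j generalizing s with
  | zero => exact ⟨s, rfl, h⟩
  | succ j ih =>
    obtain ⟨t, ht, h'⟩ := ih h.2
    exact ⟨t, ⟨p.1 (n + j), ht⟩, h'⟩

/-- The relation only depends on finitely many letters. -/
theorem Rel.congr {hX : B.IsBasis X} {n : ℕ} {s : G} {p q p' q' : (ℕ → X) × G}
    (hp : ∀ i < n, p.1 i = p'.1 i) (hp2 : p.2 = p'.2) (hq : ∀ i < n, q.1 i = q'.1 i)
    (hq2 : q.2 = q'.2) (h : Rel hX n s p q) : Rel hX n s p' q' := by
  induction n generalizing s with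
  | zero => show s * p'.2 = q'.2; rw [← hp2, ← hq2]; exact h
  | succ n ih =>
    refine ⟨?_, ?_⟩
    · rw [← hp n n.lt_succ_self, ← hq n n.lt_succ_self]; exact h.1
    · rw [← hp n n.lt_succ_self]
      exact ih (fun i hi => hp i (hi.trans n.lt_succ_self))
        (fun i hi => hq i (hi.trans n.lt_succ_self)) h.2

/-- A finite set has all its sections of some level `j` in `N`, so the relation at level `n + j`
restricts to one at level `n` witnessed by an element of `N`. The converse uses that `N` is finite.
-/
theorem asymptotic_iff (hB : B.IsSelfSimilar) {hX : B.IsBasis X} {N : Set G}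
    (hN : IsNucleus hX N) {p q : (ℕ → X) × G} :
    (B.asymptoticSetoid X) p q ↔ ∀ n, ∃ s ∈ N, Rel hX n s p q := by
  constructor
  · rintro ⟨s, hs, h⟩ n
    obtain ⟨j, hj⟩ := hN.absorbing.of_finite hs
    obtain ⟨t, ht, h'⟩ := Rel.sec (n := n) (j := j) ((rel_iff hB hX).mpr (h (n + j)))
    exact ⟨t, hj j le_rfl _ ⟨_, rfl⟩ ht, h'⟩
  · intro h
    choose s hs h using h
    refine ⟨s, hN.finite.subset ?_, fun n => (rel_iff hB hX).mp (h n)⟩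
    rintro _ ⟨n, rfl⟩
    exact hs n

end Biset

end Algebra

end SelfSimilar

end

noncomputable section

namespace SelfSimilar

open scoped Pointwise

/-! ### The topology of the limit space and its self-similarity. -/

section LimitSpace

variable {G : Type u} [Group G] {B : Biset G}

open Topology

theorem Tensor.exists_tmul {T : Type u} [MulAction Gᵐᵒᵖ T] (t : Tensor T B) :
    ∃ ξ b, t = Tensor.tmul ξ b :=
  Tensor.ind (p := fun t => ∃ ξ b, t = Tensor.tmul ξ b) (fun ξ b => ⟨ξ, b, rfl⟩) t

namespace Biset

variable {X : Set B.carrier}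

/-- The product topology on `X^{-ω} × G`. -/
instance seqTopology : TopologicalSpace ((ℕ → X) × G) :=
  letI : TopologicalSpace X := ⊥
  letI : TopologicalSpace G := ⊥
  instTopologicalSpaceProd

theorem isOpen_seq_iff {U : Set ((ℕ → X) × G)} :
    IsOpen U ↔ ∀ p ∈ U, ∃ n : ℕ, ∀ q : (ℕ → X) × G,
      (∀ i < n, q.1 i = p.1 i) → q.2 = p.2 → q ∈ U := by
  let : TopologicalSpace X := ⊥
  let : TopologicalSpace G := ⊥
  have : DiscreteTopology X := ⟨rfl⟩
  have : DiscreteTopology G := ⟨rfl⟩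
  constructor
  · rintro hU ⟨y, g⟩ hp
    obtain ⟨V, W, hV, -, hy, hg, hVW⟩ := isOpen_prod_iff.mp hU y g hp
    obtain ⟨I, u, hu, hIV⟩ := isOpen_pi_iff.mp hV y hy
    refine ⟨I.sup id + 1, fun q h1 h2 => hVW ⟨hIV fun i hi => ?_, h2 ▸ hg⟩⟩
    rw [h1 i (Nat.lt_succ_of_le (Finset.le_sup (f := id) hi))]
    exact (hu i hi).2
  · intro h
    choose! n hn using h
    have : U = ⋃ p ∈ U, ((⋂ i ∈ Finset.range (n p),
        (fun q : (ℕ → X) × G => q.1 i) ⁻¹' {p.1 i}) ∩ Prod.snd ⁻¹' {p.2}) := by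
      ext q
      simp only [Set.mem_iUnion, Set.mem_inter_iff, Set.mem_iInter, Finset.mem_range,
        Set.mem_preimage, Set.mem_singleton_iff, exists_prop]
      exact ⟨fun hq => ⟨q, hq, fun _ _ => rfl, rfl⟩,
        fun ⟨p, hp, h1, h2⟩ => hn p hp q h1 h2⟩
    rw [this]
    refine isOpen_biUnion fun p _ => IsOpen.inter ?_ ((isOpen_discrete _).preimage continuous_snd)
    refine isOpen_biInter_finset fun i _ => (isOpen_discrete _).preimage ?_
    exact (continuous_apply i).comp continuous_fst

instance : T2Space ((ℕ → X) × G) := by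
  let : TopologicalSpace X := ⊥
  let : TopologicalSpace G := ⊥
  have : DiscreteTopology X := ⟨rfl⟩
  have : DiscreteTopology G := ⟨rfl⟩
  exact Prod.t2Space

theorem isCompact_seq (hB : B.IsSelfSimilar) (hX : B.IsBasis X) {A : Set G} (hA : A.Finite) :
    IsCompact {p : (ℕ → X) × G | p.2 ∈ A} := by
  let : TopologicalSpace X := ⊥
  let : TopologicalSpace G := ⊥
  have : DiscreteTopology X := ⟨rfl⟩
  have := finite_basis hB hX
  have h : IsCompact ((Set.univ : Set (ℕ → X)) ×ˢ A) := isCompact_univ.prod hA.isCompact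
  convert! h using 1
  ext p; simp

/-- The point of the limit `G`-space represented by `… x₂ x₁ · g`. -/
def point (B : Biset G) {X : Set B.carrier} (p : (ℕ → X) × G) : B.LimitGSpace X :=
  Quotient.mk (B.asymptoticSetoid X) p

theorem point_surjective : Function.Surjective (B.point (X := X)) := Quotient.mk_surjective

theorem isQuotientMap_point : IsQuotientMap (B.point (X := X)) := ⟨⟨rfl⟩, point_surjective⟩

theorem point_eq_iff (hB : B.IsSelfSimilar) {hX : B.IsBasis X} {N : Set G}
    (hN : IsNucleus hX N) {p q : (ℕ → X) × G} :
    B.point p = B.point q ↔ ∀ n, ∃ s ∈ N, Rel hX n s p q :=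
  Quotient.eq.trans (asymptotic_iff hB hN)

instance : MulAction Gᵐᵒᵖ (B.LimitGSpace X) where
  smul g := Quotient.map (sa := B.asymptoticSetoid X) (sb := B.asymptoticSetoid X)
    (fun p => (p.1, p.2 * g.unop)) (by
      rintro p q ⟨s, hs, h⟩
      refine ⟨s, hs, fun n => ?_⟩
      simp only
      rw [← rsmul_rsmul, ← rsmul_rsmul, ← h n, smul_comm (s n)])
  one_smul := by
    rintro ⟨p⟩
    exact congrArg (Quotient.mk _) (by simp)
  mul_smul g h := by
    rintro ⟨p⟩
    exact congrArg (Quotient.mk _) (by simp [mul_assoc])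

theorem point_rsmul (p : (ℕ → X) × G) (g : G) :
    B.point p <• g = B.point (p.1, p.2 * g) := rfl

/-- The sequence `… y₂ y₁ z`. -/
def snoc (z : X) (y : ℕ → X) : ℕ → X
  | 0 => z
  | n + 1 => y n

/-- The sequence representing `… x₂ x₁ · g ⊗ b`. -/
def append (hX : B.IsBasis X) (p : (ℕ → X) × G) (b : B.carrier) : (ℕ → X) × G :=
  (snoc (letter hX (p.2 • b)) p.1, coef hX (p.2 • b))

theorem rel_append (hB : B.IsSelfSimilar) {hX : B.IsBasis X} {n : ℕ} {s : G}
    {p q : (ℕ → X) × G} (h : Rel hX n s p q) (b : B.carrier) :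
    Rel hX (n + 1) s (append hX p b) (append hX q b) := by
  induction n generalizing s with
  | zero =>
    have h0 : s * p.2 = q.2 := h
    obtain ⟨h1, h2⟩ := letter_smul hB hX s (p.2 • b)
    rw [← mul_smul, h0] at h1 h2
    exact ⟨h1.symm, h2.symm⟩
  | succ n ih => exact ⟨h.1, ih h.2⟩

/-- The self-similarity `X_G ⊗ B → X_G` of the limit `G`-space. -/
def limitMap (hB : B.IsSelfSimilar) {hX : B.IsBasis X} {N : Set G} (hN : IsNucleus hX N) :
    Tensor (B.LimitGSpace X) B →[Gᵐᵒᵖ] B.LimitGSpace X where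
  toFun := Tensor.lift
    (fun ξ b => Quotient.liftOn ξ (fun p => B.point (append hX p b)) (by
      rintro p q h
      refine (point_eq_iff hB hN).mpr fun n => ?_
      obtain ⟨s, hs, h⟩ := (asymptotic_iff hB hN).mp h n
      obtain ⟨t, ht, h'⟩ := (rel_append hB h b).sec (j := 1)
      exact ⟨t, hN.sec_subset 1 s hs ht, h'⟩))
    (by
      rintro ⟨p⟩ g b
      show B.point (append hX (p.1, p.2 * g) b) = B.point (append hX p (g • b))
      simp only [append, mul_smul])
  map_smul' g := Tensor.ind (by
    rintro ⟨p⟩ b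
    show B.point (append hX p (g • b)) = B.point ((append hX p b).1, (append hX p b).2 * g.unop)
    have h : letter hX (g • p.2 • b) = letter hX (p.2 • b) ∧
      coef hX (g • p.2 • b) = coef hX (p.2 • b) * g.unop := letter_rsmul hB hX (p.2 • b) g.unop
    simp only [append]
    rw [smul_comm p.2 g b, h.1, h.2])

section Nucleus

variable (hB : B.IsSelfSimilar) {hX : B.IsBasis X} {N : Set G} (hN : IsNucleus hX N)

theorem limitMap_tmul (p : (ℕ → X) × G) (b : B.carrier) :
    limitMap hB hN (Tensor.tmul (B.point p) b) = B.point (append hX p b) := rfl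

/-- Iterating pushes the coefficient `g` through the word: the `m` new letters and the new
coefficient are those of `g · x_m … x_1 · h`, which is what `Rel hX m g p q` records, and the old
sequence `y` is moved `m` places to the left. -/
theorem exists_iter_limitMap (m : ℕ) (g : G) (y : ℕ → X) (p : (ℕ → X) × G) :
    ∃ q : (ℕ → X) × G,
      iter (limitMap hB hN) m (Tensor.tmul (B.point (y, g)) (B.word p.1 m <• p.2)) = B.point q ∧
      Rel hX m g p q ∧ ∀ i, q.1 (m + i) = y i := by
  induction m generalizing g y with
  | zero =>
    refine ⟨(y, g * p.2), ?_, rfl, fun i => by rw [zero_add]⟩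
    show B.point (y, g * (1 * p.2)) = _
    rw [one_mul]
  | succ m ih =>
    obtain ⟨q, h1, h2, h3⟩ := ih (coef hX (g • (p.1 m : B.carrier)))
      (snoc (letter hX (g • (p.1 m : B.carrier))) y)
    refine ⟨q, h1, ⟨?_, h2⟩, fun i => ?_⟩
    · exact (h3 0).symm
    · rw [Nat.add_right_comm]; exact h3 (i + 1)

theorem Rel.eq_of_one (hB : B.IsSelfSimilar) {m : ℕ} {p q : (ℕ → X) × G} (h : Rel hX m 1 p q) :
    (∀ i < m, p.1 i = q.1 i) ∧ p.2 = q.2 := by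
  induction m with
  | zero => exact ⟨fun i hi => absurd hi (Nat.not_lt_zero i), by rw [← show 1 * p.2 = q.2 from h,
      one_mul]⟩
  | succ m ih =>
    obtain ⟨h1, h2⟩ := h
    rw [one_smul] at h1 h2
    rw [(letter_basis hB hX _).1] at h1
    rw [(letter_basis hB hX _).2] at h2
    refine ⟨fun i hi => ?_, (ih h2).2⟩
    rcases Nat.lt_succ_iff_lt_or_eq.mp hi with h | rfl
    · exact (ih h2).1 i h
    · exact h1

/-- Cutting a sequence after `m` letters exhibits the point as the image of a point of the tile of
`1`. -/
theorem point_eq_iter (m : ℕ) (p : (ℕ → X) × G) :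
    B.point p = iter (limitMap hB hN) m
      (Tensor.tmul (B.point (fun i => p.1 (m + i), 1)) (B.word p.1 m <• p.2)) := by
  obtain ⟨q, h1, h2, h3⟩ := exists_iter_limitMap hB hN m 1 (fun i => p.1 (m + i)) p
  rw [h1]
  obtain ⟨h4, h5⟩ := h2.eq_of_one hB
  congr 1
  refine Prod.ext (funext fun i => ?_) h5
  by_cases hi : i < m
  · exact h4 i hi
  · obtain ⟨j, rfl⟩ := Nat.exists_eq_add_of_le (not_lt.mp hi)
    exact (h3 j).symm

/-- The clopen set of the sequences that are related to `p` at level `n`. -/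
def levelNhd (hX : B.IsBasis X) (N : Set G) (n : ℕ) (p : (ℕ → X) × G) : Set ((ℕ → X) × G) :=
  {q | ∃ s ∈ N, Rel hX n s p q}

theorem isOpen_levelNhd (n : ℕ) (p : (ℕ → X) × G) : IsOpen (levelNhd hX N n p) :=
  isOpen_seq_iff.mpr fun _ ⟨s, hs, h⟩ => ⟨n, fun _ h1 h2 =>
    ⟨s, hs, h.congr (fun _ _ => rfl) rfl (fun i hi => (h1 i hi).symm) h2.symm⟩⟩

theorem isClosed_levelNhd (n : ℕ) (p : (ℕ → X) × G) : IsClosed (levelNhd hX N n p) :=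
  ⟨isOpen_seq_iff.mpr fun _ hq => ⟨n, fun _ h1 h2 ⟨s, hs, h⟩ => hq
    ⟨s, hs, h.congr (fun _ _ => rfl) rfl h1 h2⟩⟩⟩

include hN in
theorem levelNhd_succ (n : ℕ) (p : (ℕ → X) × G) :
    levelNhd hX N (n + 1) p ⊆ levelNhd hX N n p := by
  rintro q ⟨s, hs, h⟩
  obtain ⟨t, ht, h'⟩ := h.sec (j := 1)
  exact ⟨t, hN.sec_subset 1 s hs ht, h'⟩

theorem levelNhd_congr {n : ℕ} {p q : (ℕ → X) × G} (h1 : ∀ i < n, q.1 i = p.1 i)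
    (h2 : q.2 = p.2) : levelNhd hX N n q ⊆ levelNhd hX N n p :=
  fun _ ⟨s, hs, h⟩ => ⟨s, hs, h.congr h1 h2 (fun _ _ => rfl) rfl⟩

include hN in
theorem levelNhd_zero_subset (p : (ℕ → X) × G) :
    ∃ A : Set G, A.Finite ∧ levelNhd hX N 0 p ⊆ {q | q.2 ∈ A} :=
  ⟨(fun s => s * p.2) '' N, hN.finite.image _, fun _ ⟨s, hs, h⟩ => ⟨s, hs, h⟩⟩

include hB hN in
theorem isCompact_levelNhd (n : ℕ) (p : (ℕ → X) × G) : IsCompact (levelNhd hX N n p) := by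
  obtain ⟨A, hA, h⟩ := levelNhd_zero_subset hN p
  refine (isCompact_seq hB hX hA).of_isClosed_subset (isClosed_levelNhd n p) (Set.Subset.trans ?_ h)
  exact antitone_nat_of_succ_le (f := fun n => levelNhd hX N n p) (fun n => levelNhd_succ hN n p)
    (Nat.zero_le n)

include hB hN in
-- The sets `levelNhd hX N n p` are compact, decreasing, and intersect in the fibre of `point`
-- through `p`. If all of them left `U`, compactness would give a point of the fibre outside `U`.
theorem exists_levelNhd_subset {p : (ℕ → X) × G} {U : Set ((ℕ → X) × G)} (hU : IsOpen U)
    (h : ∀ q, B.point p = B.point q → q ∈ U) : ∃ n, levelNhd hX N n p ⊆ U := by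
  by_contra hcon
  push Not at hcon
  obtain ⟨q, hq⟩ := IsCompact.nonempty_iInter_of_sequence_nonempty_isCompact_isClosed
    (fun n => levelNhd hX N n p \ U) (fun n => Set.sdiff_subset_sdiff_left (levelNhd_succ hN n p))
    (fun n => by
      obtain ⟨q, h1, h2⟩ := Set.not_subset.mp (hcon n)
      exact ⟨q, h1, h2⟩) ((isCompact_levelNhd hB hN 0 p).diff hU)
    (fun n => (isClosed_levelNhd n p).sdiff hU)
  rw [Set.mem_iInter] at hq
  exact (hq 0).2 (h q ((point_eq_iff hB hN).mpr fun n => (hq n).1))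

include hB hN in
-- A fibre missing the closed set `C` has a level neighbourhood missing `C`, and level
-- neighbourhoods depend on finitely many letters only.
theorem isClosedMap_point : IsClosedMap (B.point (X := X)) := by
  intro C hC
  rw [← isQuotientMap_point.isClosed_preimage, ← isOpen_compl_iff, isOpen_seq_iff]
  intro p hp
  obtain ⟨n, hn⟩ := exists_levelNhd_subset hB hN (p := p) hC.isOpen_compl
    fun q hq hqC => hp ⟨q, hqC, hq.symm⟩
  refine ⟨n, fun q h1 h2 => ?_⟩
  rintro ⟨r, hr, e⟩
  exact hn (levelNhd_congr h1 h2 ((point_eq_iff hB hN).mp e.symm n)) hr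

include hB hN in
-- Fibres of `point` are compact, so two of them have disjoint open neighbourhoods; these descend
-- because `point` is a closed map.
theorem t2Space_limit : T2Space (B.LimitGSpace X) := by
  refine ⟨fun a b hab => ?_⟩
  obtain ⟨p, rfl⟩ := point_surjective a
  obtain ⟨q, rfl⟩ := point_surjective b
  have hcl : ∀ r : (ℕ → X) × G, IsCompact (B.point ⁻¹' {B.point r}) := fun r => by
    have : B.point ⁻¹' {B.point r} = ⋂ n, levelNhd hX N n r := by
      ext t
      rw [Set.mem_iInter]
      exact eq_comm.trans ((point_eq_iff hB hN (p := r) (q := t)))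
    rw [this]
    exact (isCompact_levelNhd hB hN 0 r).of_isClosed_subset
      (isClosed_iInter fun n => isClosed_levelNhd n r) (Set.iInter_subset _ 0)
  obtain ⟨U, V, hU, hV, hpU, hqV, hUV⟩ := SeparatedNhds.of_isCompact_isCompact (hcl p) (hcl q)
    (Set.disjoint_left.mpr fun r h1 h2 => hab (h1.symm.trans h2))
  refine ⟨(B.point '' Uᶜ)ᶜ, (B.point '' Vᶜ)ᶜ,
    (isClosedMap_point hB hN _ hU.isClosed_compl).isOpen_compl,
    (isClosedMap_point hB hN _ hV.isClosed_compl).isOpen_compl, ?_, ?_, ?_⟩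
  · rintro ⟨r, hr, e⟩; exact hr (hpU e)
  · rintro ⟨r, hr, e⟩; exact hr (hqV e)
  · refine Set.disjoint_left.mpr fun z h1 h2 => ?_
    obtain ⟨r, rfl⟩ := point_surjective z
    exact Set.disjoint_left.mp hUV (by_contra fun h => h1 ⟨r, h, rfl⟩)
      (by_contra fun h => h2 ⟨r, h, rfl⟩)

/-! ### Tiles and properness of the action. -/

/-- The tile of the limit `G`-space consisting of the points `… x₂ x₁ · g`. -/
def tile (B : Biset G) (X : Set B.carrier) (g : G) : Set (B.LimitGSpace X) :=
  B.point '' {p | p.2 = g}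

theorem point_mem_tile (p : (ℕ → X) × G) : B.point p ∈ B.tile X p.2 := ⟨p, rfl, rfl⟩

theorem exists_mem_tile (z : B.LimitGSpace X) : ∃ g, z ∈ B.tile X g := by
  obtain ⟨p, rfl⟩ := point_surjective z
  exact ⟨_, point_mem_tile p⟩

theorem rsmul_mem_tile {z : B.LimitGSpace X} {a : G} (h : z ∈ B.tile X a) (g : G) :
    z <• g ∈ B.tile X (a * g) := by
  obtain ⟨p, rfl, rfl⟩ := h
  exact ⟨(p.1, p.2 * g), rfl, rfl⟩

include hB hX in
theorem isCompact_tile (g : G) : IsCompact (B.tile X g) :=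
  ((isCompact_seq hB hX (Set.finite_singleton g)).image isQuotientMap_point.continuous)

include hB hN in
-- This is level `0` of the asymptotic equivalence. All finiteness statements about tiles rest on
-- it.
theorem exists_mul_of_mem_tile {z : B.LimitGSpace X} {g h : G} (hg : z ∈ B.tile X g)
    (hh : z ∈ B.tile X h) : ∃ s ∈ N, s * g = h := by
  obtain ⟨p, rfl, rfl⟩ := hg
  obtain ⟨q, rfl, e⟩ := hh
  exact (point_eq_iff hB hN).mp e.symm 0

include hB hN in
theorem exists_isOpen_subset_tiles (z : B.LimitGSpace X) :
    ∃ U, IsOpen U ∧ z ∈ U ∧ ∃ A : Set G, A.Finite ∧ U ⊆ ⋃ a ∈ A, B.tile X a := by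
  obtain ⟨p, rfl⟩ := point_surjective z
  obtain ⟨A, hA, h⟩ := levelNhd_zero_subset hN p
  refine ⟨(B.point '' (levelNhd hX N 0 p)ᶜ)ᶜ,
    (isClosedMap_point hB hN _ (isOpen_levelNhd 0 p).isClosed_compl).isOpen_compl, ?_, A, hA, ?_⟩
  · rintro ⟨r, hr, e⟩
    exact hr ((point_eq_iff hB hN).mp e.symm 0)
  · intro z hz
    obtain ⟨r, rfl⟩ := point_surjective z
    have : r ∈ levelNhd hX N 0 p := by
      by_contra h'; exact hz ⟨r, h', rfl⟩
    exact Set.mem_biUnion (h this) (point_mem_tile r)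

include hB hX in
theorem isCompact_tiles {A : Set G} (hA : A.Finite) : IsCompact (⋃ a ∈ A, B.tile X a) :=
  hA.isCompact_biUnion fun a _ => isCompact_tile hB (hX := hX) a

include hB hN in
theorem exists_tiles_of_isCompact {K : Set (B.LimitGSpace X)} (hK : IsCompact K) :
    ∃ A : Set G, A.Finite ∧ K ⊆ ⋃ a ∈ A, B.tile X a := by
  choose U hU hzU A hA hUA using exists_isOpen_subset_tiles hB hN
  obtain ⟨t, -, ht⟩ := hK.elim_nhds_subcover U fun z _ => (hU z).mem_nhds (hzU z)
  refine ⟨⋃ z ∈ t, A z, t.finite_toSet.biUnion fun z _ => hA z, fun x hx => ?_⟩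
  obtain ⟨z, hz, hxz⟩ := Set.mem_iUnion₂.mp (ht hx)
  obtain ⟨a, ha, hxa⟩ := Set.mem_iUnion₂.mp (hUA z hxz)
  exact Set.mem_biUnion (Set.mem_biUnion hz ha) hxa

include hB hN in
theorem weaklyLocallyCompactSpace_limit : WeaklyLocallyCompactSpace (B.LimitGSpace X) := by
  refine ⟨fun z => ?_⟩
  obtain ⟨U, hU, hz, A, hA, h⟩ := exists_isOpen_subset_tiles hB hN z
  exact ⟨_, isCompact_tiles hB (hX := hX) hA, Filter.mem_of_superset (hU.mem_nhds hz) h⟩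

instance : ContinuousConstSMul Gᵐᵒᵖ (B.LimitGSpace X) where
  continuous_const_smul g := by
    refine isQuotientMap_point.continuous_iff.mpr (isQuotientMap_point.continuous.comp
      (f := fun p : (ℕ → X) × G => ((p.1, p.2 * g.unop) : (ℕ → X) × G)) ⟨fun U hU => ?_⟩)
    refine isOpen_seq_iff.mpr fun p hp => ?_
    obtain ⟨n, hn⟩ := isOpen_seq_iff.mp hU _ hp
    exact ⟨n, fun q h1 h2 => hn _ h1 (congrArg (· * g.unop) h2)⟩

include hB hN in
theorem finite_rsmul_tiles {A A' : Set G} (hA : A.Finite) (hA' : A'.Finite) :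
    {g : G | ∃ z, z ∈ (⋃ a ∈ A, B.tile X a) ∧ z <• g ∈ ⋃ a ∈ A', B.tile X a}.Finite := by
  refine ((hA.inv.mul hN.finite.inv).mul hA').subset ?_
  rintro g ⟨z, hz, hz'⟩
  obtain ⟨a, ha, hza⟩ := Set.mem_iUnion₂.mp hz
  obtain ⟨b, hb, hzb⟩ := Set.mem_iUnion₂.mp hz'
  obtain ⟨s, hs, e⟩ := exists_mul_of_mem_tile hB hN (rsmul_mem_tile hza g) hzb
  refine ⟨a⁻¹ * s⁻¹, ⟨_, Set.inv_mem_inv.mpr ha, _, Set.inv_mem_inv.mpr hs, rfl⟩, b, hb, ?_⟩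
  show a⁻¹ * s⁻¹ * b = g
  rw [← e]; group

include hB hN in
theorem properlyDiscontinuous_limit : ProperlyDiscontinuousSMul Gᵐᵒᵖ (B.LimitGSpace X) := by
  refine ⟨fun {K L} hK hL => ?_⟩
  obtain ⟨A, hA, hKA⟩ := exists_tiles_of_isCompact hB hN hK
  obtain ⟨A', hA', hLA⟩ := exists_tiles_of_isCompact hB hN hL
  refine ((finite_rsmul_tiles hB hN hA hA').image op).subset ?_
  rintro g ⟨_, ⟨z, hz, rfl⟩, hz'⟩
  exact ⟨g.unop, ⟨z, hKA hz, hLA hz'⟩, rfl⟩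

include hB hN in
-- At level `0`, an element fixing the point of `p` is the conjugate by `p.2` of the inverse of an
-- element of `N`. The bound is uniform in the point, as the induction on stabilizer orders
-- requires.
theorem ncard_stabilizer_le (z : B.LimitGSpace X) :
    {g : Gᵐᵒᵖ | g • z = z}.ncard ≤ N.ncard := by
  obtain ⟨p, rfl⟩ := point_surjective z
  refine (Set.ncard_le_ncard (t := (fun s => op (p.2⁻¹ * s⁻¹ * p.2)) '' N) ?_
    (hN.finite.image _)).trans (Set.ncard_image_le hN.finite)
  intro g hg
  obtain ⟨s, hs, h⟩ := (point_eq_iff hB hN).mp (show B.point (p.1, p.2 * g.unop) = B.point p from hg) 0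
  have h' : s * (p.2 * g.unop) = p.2 := h
  refine ⟨s, hs, MulOpposite.unop_injective ?_⟩
  show p.2⁻¹ * s⁻¹ * p.2 = g.unop
  calc p.2⁻¹ * s⁻¹ * p.2 = p.2⁻¹ * s⁻¹ * (s * (p.2 * g.unop)) := by rw [h']
    _ = g.unop := by group

/-! ### Injectivity, openness and smallness of the self-similarity. -/

/-- The section `t` of `s` that arrives in front of the last, appended letter matches `p.2 · a` with
`q.2 · b`. It is also the coefficient by which the sequences without that letter differ. -/
theorem Rel.exists_section {n : ℕ} {s : G} {p q : (ℕ → X) × G} {a b : B.carrier}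
    (hB : B.IsSelfSimilar)
    (h : Rel hX (n + 1) s (append hX p a) (append hX q b)) :
    ∃ t ∈ Sec hX n s, Rel hX n s (p.1, 1) (q.1, t) ∧ t • p.2 • a = q.2 • b := by
  induction n generalizing s with
  | zero =>
    refine ⟨s, rfl, mul_one s, ?_⟩
    obtain ⟨h1, h2⟩ := h
    have h1' : letter hX (s • (letter hX (p.2 • a) : B.carrier)) = letter hX (q.2 • b) := h1
    have h2' : coef hX (s • (letter hX (p.2 • a) : B.carrier)) * coef hX (p.2 • a) =
      coef hX (q.2 • b) := h2
    obtain ⟨h3, h4⟩ := letter_smul hB hX s (p.2 • a)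
    rw [← letter_coef hX (s • p.2 • a), h3, h4, h1', h2', letter_coef]
  | succ n ih =>
    obtain ⟨h1, h2⟩ := h
    obtain ⟨t, ht, h3, h4⟩ := ih h2
    exact ⟨t, ⟨p.1 n, ht⟩, ⟨h1, h3⟩, h4⟩

/-- Each level `n` yields some `t n ∈ N` as in `Rel.exists_section`. By pigeonhole one value `c`
occurs at infinitely many levels, hence relates the two sequences at every level. The element
identifying the two tensors is `q.2⁻¹ * c * p.2`. -/
theorem limitMap_injective {ζ ζ' : B.LimitGSpace X} {b b' : B.carrier}
    (h : limitMap hB hN (Tensor.tmul ζ b) = limitMap hB hN (Tensor.tmul ζ' b')) :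
    ∃ g : G, b' = g • b ∧ ζ' <• g = ζ := by
  obtain ⟨p, rfl⟩ := point_surjective ζ
  obtain ⟨q, rfl⟩ := point_surjective ζ'
  rw [limitMap_tmul, limitMap_tmul, point_eq_iff hB hN] at h
  choose s hs h using fun n => h (n + 1)
  choose t ht h1 h2 using fun n => (h n).exists_section hB
  have htN : ∀ n, t n ∈ N := fun n => hN.sec_subset n _ (hs n) (ht n)
  have := hN.finite.to_subtype
  obtain ⟨⟨c, hc⟩, hinf⟩ := Finite.exists_infinite_fiber (fun n => (⟨t n, htN n⟩ : N))
  have hinf' : {n | t n = c}.Infinite := by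
    rw [Set.infinite_coe_iff] at hinf
    exact hinf.mono fun n hn => congrArg Subtype.val (show (⟨t n, htN n⟩ : N) = ⟨c, hc⟩ from hn)
  obtain ⟨n0, hn0⟩ := hinf'.nonempty
  have h3 : B.point (p.1, (1 : G)) = B.point (q.1, c) := by
    refine (point_eq_iff hB hN).mpr fun j => ?_
    obtain ⟨n, hn, hj⟩ := hinf'.exists_gt j
    have h4 := h1 n
    rw [show t n = c from hn] at h4
    obtain ⟨k, rfl⟩ := Nat.exists_eq_add_of_le hj.le
    obtain ⟨r, hr, h5⟩ := h4.sec
    exact ⟨r, hN.sec_subset _ _ (hs _) hr, h5⟩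
  refine ⟨q.2⁻¹ * c * p.2, ?_, ?_⟩
  · rw [mul_assoc, mul_smul, mul_smul, ← show t n0 = c from hn0, h2 n0, inv_smul_smul]
  · have h6 := congrArg (· <• p.2) h3
    simp only [point_rsmul, one_mul] at h6
    rw [point_rsmul, mul_assoc, mul_inv_cancel_left]
    exact h6.symm

theorem iter_limitMap_injective {n : ℕ} {ζ ζ' : B.LimitGSpace X} {v v' : (B.pow n).carrier}
    (h : iter (limitMap hB hN) n (Tensor.tmul ζ v) = iter (limitMap hB hN) n (Tensor.tmul ζ' v')) :
    ∃ g : G, v' = g • v ∧ ζ' <• g = ζ := by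
  induction n generalizing ζ ζ' with
  | zero =>
    change G at v v'
    have h' : ζ <• v = ζ' <• v' := h
    refine ⟨v' * v⁻¹, ?_, ?_⟩
    · show v' = v' * v⁻¹ * v
      rw [inv_mul_cancel_right]
    · rw [← rsmul_rsmul, ← h', rsmul_rsmul, mul_inv_cancel, rsmul_one]
  | succ n ih =>
    obtain ⟨x, v, rfl⟩ := Tensor.exists_tmul (T := B.carrier) (B := B.pow n) v
    obtain ⟨x', v', rfl⟩ := Tensor.exists_tmul (T := B.carrier) (B := B.pow n) v'
    obtain ⟨g, rfl, h2⟩ := ih (v := v) (v' := v') (ζ := limitMap hB hN (Tensor.tmul ζ x))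
      (ζ' := limitMap hB hN (Tensor.tmul ζ' x')) h
    rw [← map_smul] at h2
    obtain ⟨k, h3, h4⟩ := limitMap_injective hB hN (b' := x' <• g) h2.symm
    refine ⟨k, ?_, h4⟩
    show (Tensor.tmul x' (g • v) : Tensor B.carrier (B.pow n)) = Tensor.tmul (k • x) v
    rw [← h3, Tensor.tmul_smul]

/-- By injectivity, a sequence represents a point of the image exactly when its last letter with
coefficient has the form `g • b` and its tail with coefficient `g` represents a point of `O`. Both
conditions are stable under changing letters far to the left. -/
theorem isOpen_limitMap_image {O : Set (B.LimitGSpace X)} (hO : IsOpen O) (b : B.carrier) :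
    IsOpen ((fun ζ => limitMap hB hN (Tensor.tmul ζ b)) '' O) := by
  rw [← isQuotientMap_point.isOpen_preimage] at hO ⊢
  have key : ∀ p : (ℕ → X) × G,
      p ∈ B.point ⁻¹' ((fun ζ => limitMap hB hN (Tensor.tmul ζ b)) '' O) ↔
      ∃ g : G, (p.1 0 : B.carrier) <• p.2 = g • b ∧ B.point (fun i => p.1 (1 + i), g) ∈ O := by
    intro p
    have h1 := point_eq_iter hB hN 1 p
    have h2 : B.point p = limitMap hB hN (Tensor.tmul (B.point (fun i => p.1 (1 + i), 1))
        ((p.1 0 : B.carrier) <• p.2)) := by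
      rw [h1]
      show (limitMap hB hN (Tensor.tmul (B.point (fun i => p.1 (1 + i), 1)) (p.1 0 : B.carrier)))
        <• (1 * p.2) = _
      rw [one_mul, ← map_smul]
      rfl
    constructor
    · rintro ⟨ζ, hζ, e⟩
      obtain ⟨g, h3, h4⟩ := limitMap_injective hB hN (e.trans h2)
      refine ⟨g, h3, ?_⟩
      rw [point_rsmul, one_mul] at h4
      exact h4 ▸ hζ
    · rintro ⟨g, h3, h4⟩
      refine ⟨_, h4, ?_⟩
      show limitMap hB hN _ = B.point p
      rw [h2, h3, ← Tensor.tmul_smul, point_rsmul, one_mul]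
  rw [isOpen_seq_iff]
  intro p hp
  obtain ⟨g, h1, h2⟩ := (key p).mp hp
  obtain ⟨n, hn⟩ := isOpen_seq_iff.mp hO _ h2
  refine ⟨1 + n, fun q h3 h4 => (key q).mpr ⟨g, ?_, hn _ (fun i hi => ?_) rfl⟩⟩
  · rw [h3 0 (by omega), h4, h1]
  · exact h3 _ (by omega)

theorem isOpen_iter_image {n : ℕ} {O : Set (B.LimitGSpace X)} (hO : IsOpen O)
    (v : (B.pow n).carrier) :
    IsOpen ((fun ζ => iter (limitMap hB hN) n (Tensor.tmul ζ v)) '' O) := by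
  induction n generalizing O with
  | zero =>
    change G at v
    exact isOpenMap_smul (op v) O hO
  | succ n ih =>
    obtain ⟨x, v, rfl⟩ := Tensor.exists_tmul (T := B.carrier) (B := B.pow n) v
    have := ih (isOpen_limitMap_image hB hN hO x) v
    rw [Set.image_image] at this
    exact this

/-- Images of tiles at high levels are uniformly small. -/
theorem exists_level_subordinate {𝒰 : Set (Set (B.LimitGSpace X))} (hopen : ∀ U ∈ 𝒰, IsOpen U)
    (g : G) (hcov : B.tile X g ⊆ ⋃₀ 𝒰) {A : Set G} (hA : A.Finite) :
    ∃ m₀, ∀ m ≥ m₀, ∀ y : ℕ → X, ∃ U ∈ 𝒰, ∀ a ∈ A, ∀ z ∈ B.tile X a,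
      iter (limitMap hB hN) m (Tensor.tmul z (B.word y m <• g)) ∈ U := by
  obtain ⟨k, hk⟩ := hN.absorbing.of_finite hA
  have h1 : ∀ y : ℕ → X, ∃ U ∈ 𝒰, ∃ n, levelNhd hX N n (y, g) ⊆ B.point ⁻¹' U := fun y => by
    obtain ⟨U, hU, hy⟩ := hcov (point_mem_tile (y, g))
    obtain ⟨n, hn⟩ := exists_levelNhd_subset hB hN (p := (y, g))
      ((hopen U hU).preimage isQuotientMap_point.continuous)
      fun q hq => by rw [Set.mem_preimage, ← hq]; exact hy
    exact ⟨U, hU, n, hn⟩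
  choose U hU n hn using h1
  obtain ⟨t, -, ht⟩ := (isCompact_seq hB hX (Set.finite_singleton g)).elim_nhds_subcover
    (fun p => {q | (∀ i < n p.1, q.1 i = p.1 i) ∧ q.2 = p.2}) fun p _ => by
      refine IsOpen.mem_nhds (isOpen_seq_iff.mpr fun q hq => ⟨n p.1, fun r h1 h2 => ?_⟩)
        ⟨fun _ _ => rfl, rfl⟩
      exact ⟨fun i hi => (h1 i hi).trans (hq.1 i hi), h2.trans hq.2⟩
  -- The supremum handles the finite subcover of the tile by cylinders; the `k` additional levels
  -- bring the sections of elements of `A` into `N`.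
  refine ⟨t.sup (fun p => n p.1) + k, fun m hm y => ?_⟩
  obtain ⟨p, hp, hyp, hg⟩ := Set.mem_iUnion₂.mp (@ht (y, g) rfl)
  refine ⟨U p.1, hU _, ?_⟩
  rintro a ha _ ⟨⟨z, a'⟩, rfl, rfl⟩
  obtain ⟨q, hq, hrel, -⟩ := exists_iter_limitMap hB hN m a' z (y, g)
  have hle : n p.1 ≤ t.sup (fun p => n p.1) := Finset.le_sup (f := fun p => n p.1) hp
  obtain ⟨j, rfl⟩ := Nat.exists_eq_add_of_le (show n p.1 ≤ m by omega)
  obtain ⟨s, hs, hrel'⟩ := hrel.sec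
  rw [hq]
  exact hn p.1 ⟨s, hk j (by omega) a' ha hs,
    hrel'.congr hyp rfl (fun _ _ => rfl) rfl⟩

end Nucleus

end Biset

end LimitSpace

end SelfSimilar

end

noncomputable section

namespace SelfSimilar

/-! ### Covering dimension: closed subsets, sum theorems, compact images. -/

section Dimension

open Topology

variable {T : Type u} [TopologicalSpace T] {ι : Type u} {d : ℕ}

/-- Every family of open sets covering `A`, indexed by `ι`, can be shrunk to a family of open sets
covering `A` such that every point of `A` belongs to at most `d + 1` of them. -/
def DimOn (ι : Type u) (A : Set T) (d : ℕ) : Prop :=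
  ∀ V : ι → Set T, (∀ i, IsOpen (V i)) → A ⊆ ⋃ i, V i →
    ∃ W : ι → Set T, (∀ i, IsOpen (W i)) ∧ (∀ i, W i ⊆ V i) ∧ A ⊆ ⋃ i, W i ∧
      ∀ x ∈ A, {i | x ∈ W i}.encard ≤ d + 1

/-- Members of `𝒲` assigned to the same index are merged. Different merged sets containing `x`
contain different members of `𝒲` through `x`, so the order does not grow. -/
theorem exists_indexed_refinement {A : Set T} {V : ι → Set T} {𝒲 : Set (Set T)}
    (hopen : ∀ U ∈ 𝒲, IsOpen U) (hcov : A ⊆ ⋃₀ 𝒲) (hsub : ∀ U ∈ 𝒲, ∃ i, U ⊆ V i)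
    (hord : ∀ x ∈ A, {U ∈ 𝒲 | x ∈ U}.encard ≤ d + 1) :
    ∃ W : ι → Set T, (∀ i, IsOpen (W i)) ∧ (∀ i, W i ⊆ V i) ∧ A ⊆ ⋃ i, W i ∧
      ∀ x ∈ A, {i | x ∈ W i}.encard ≤ d + 1 := by
  choose i hi using hsub
  refine ⟨fun j => ⋃ (U : Set T) (hU : U ∈ 𝒲) (_ : i U hU = j), U,
    fun j => ?_, fun j => ?_, fun x hx => ?_, fun x hx => ?_⟩
  · exact isOpen_iUnion fun U => isOpen_iUnion fun hU => isOpen_iUnion fun _ => hopen U hU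
  · simp only [Set.iUnion_subset_iff]
    rintro U hU rfl
    exact hi U hU
  · obtain ⟨U, hU, hxU⟩ := hcov hx
    simp only [Set.mem_iUnion]
    exact ⟨_, U, hU, rfl, hxU⟩
  · refine le_trans ?_ (hord x hx)
    have h6 : ∀ j, (x ∈ ⋃ (U : Set T) (hU : U ∈ 𝒲) (_ : i U hU = j), U) →
        ∃ U, (∃ hU, i U hU = j) ∧ x ∈ U := by
      intro j hj
      simp only [Set.mem_iUnion] at hj
      obtain ⟨U, hU, e, hxU⟩ := hj
      exact ⟨U, ⟨hU, e⟩, hxU⟩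
    choose! U hU hxU using h6
    refine Set.encard_le_encard_of_injOn (f := U) (fun j hj => ⟨(hU j hj).1, hxU j hj⟩) ?_
    intro j hj k hk e
    obtain ⟨h7, e1⟩ := hU j hj
    obtain ⟨h9, e2⟩ := hU k hk
    rw [← e1, ← e2]
    congr

/-- The complement of `A` is added to the cover; the members of the refinement that meet `A` are
contained in sets of the original family. -/
theorem CoveringDimLE.dimOn (h : CoveringDimLE T d) {A : Set T} (hA : IsClosed A) :
    DimOn ι A d := by
  intro V hV hAV
  obtain ⟨𝒱, h1, h2, h3, h4⟩ := h (insert Aᶜ (Set.range V)) (by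
    rintro U (rfl | ⟨i, rfl⟩)
    · exact hA.isOpen_compl
    · exact hV i) (by
    refine Set.eq_univ_of_forall fun x => ?_
    by_cases hx : x ∈ A
    · obtain ⟨i, hi⟩ := Set.mem_iUnion.mp (hAV hx)
      exact ⟨V i, Or.inr ⟨i, rfl⟩, hi⟩
    · exact ⟨Aᶜ, Or.inl rfl, hx⟩)
  refine exists_indexed_refinement (𝒲 := {U ∈ 𝒱 | (U ∩ A).Nonempty}) (fun U hU => h1 U hU.1)
    (fun x hx => ?_) ?_ fun x _ =>
      (Set.encard_le_encard (t := {V ∈ 𝒱 | x ∈ V}) fun U hU => ⟨hU.1.1, hU.2⟩).trans (h4 x)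
  · obtain ⟨U, hU, hxU⟩ := h2.symm ▸ Set.mem_univ x
    exact ⟨U, ⟨hU, x, hxU, hx⟩, hxU⟩
  · rintro U ⟨hU, x, hxU, hxA⟩
    obtain ⟨U', rfl | ⟨i, rfl⟩, hUU⟩ := h3 U hU
    · exact absurd hxA (hUU hxU)
    · exact ⟨i, hUU⟩

/-- The sets are changed only inside `A`: outside they are restored to `V i`, which preserves the
union. This locality is what makes shrinkings composable. -/
theorem DimOn.exists_shrinking {A : Set T} (hA : IsClosed A) (h : DimOn ι A d) {V : ι → Set T}
    (hV : ∀ i, IsOpen (V i)) (hAV : A ⊆ ⋃ i, V i) :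
    ∃ W : ι → Set T, (∀ i, IsOpen (W i)) ∧ (∀ i, W i ⊆ V i) ∧ (∀ i, V i \ W i ⊆ A) ∧
      (⋃ i, V i) ⊆ ⋃ i, W i ∧ ∀ x ∈ A, {i | x ∈ W i}.encard ≤ d + 1 := by
  obtain ⟨W, h1, h2, h3, h4⟩ := h V hV hAV
  refine ⟨fun i => (W i ∪ Aᶜ) ∩ V i, fun i => ((h1 i).union hA.isOpen_compl).inter (hV i),
    fun i => Set.inter_subset_right, ?_, ?_, ?_⟩
  · rintro i x ⟨hx1, hx2⟩
    by_contra hxA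
    exact hx2 ⟨Or.inr hxA, hx1⟩
  · intro x hx
    obtain ⟨i, hi⟩ := Set.mem_iUnion.mp hx
    by_cases hxA : x ∈ A
    · obtain ⟨j, hj⟩ := Set.mem_iUnion.mp (h3 hxA)
      exact Set.mem_iUnion.mpr ⟨j, Or.inl hj, h2 j hj⟩
    · exact Set.mem_iUnion.mpr ⟨i, Or.inr hxA, hi⟩
  · intro x hx
    refine le_trans (Set.encard_le_encard ?_) (h4 x hx)
    rintro i ⟨hi | hi, -⟩
    · exact hi
    · exact absurd hx hi

theorem DimOn.empty : DimOn ι (∅ : Set T) d := fun _ _ _ =>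
  ⟨fun _ => ∅, fun _ => isOpen_empty, fun _ => Set.empty_subset _, Set.empty_subset _,
    fun _ h => absurd h (Set.notMem_empty _)⟩

/-- Shrinking never raises the order, so the bound obtained on `A` survives the shrinking along `C`.
-/
theorem DimOn.union {A C : Set T} (hA : IsClosed A) (hC : IsClosed C) (h : DimOn ι A d)
    (h' : DimOn ι C d) : DimOn ι (A ∪ C) d := by
  intro V hV hcov
  obtain ⟨W, h1, h2, -, h3, h4⟩ := h.exists_shrinking hA hV (Set.subset_union_left.trans hcov)
  obtain ⟨W', h5, h6, -, h7, h8⟩ :=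
    h'.exists_shrinking hC h1 ((Set.subset_union_right.trans hcov).trans h3)
  refine ⟨W', h5, fun i => (h6 i).trans (h2 i), (hcov.trans h3).trans h7, ?_⟩
  rintro x (hx | hx)
  · exact (Set.encard_le_encard fun i hi => h6 i hi).trans (h4 x hx)
  · exact h8 x hx

theorem DimOn.biUnion {κ : Type*} {A : κ → Set T} (s : Finset κ) (hA : ∀ k ∈ s, IsClosed (A k))
    (h : ∀ k ∈ s, DimOn ι (A k) d) : DimOn ι (⋃ k ∈ s, A k) d := by
  classical
  induction s using Finset.induction_on with
  | empty => simpa using DimOn.empty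
  | insert a s _ ih =>
    rw [Finset.set_biUnion_insert]
    have hA' : ∀ k ∈ s, IsClosed (A k) := fun k hk => hA k (Finset.mem_insert_of_mem hk)
    exact (h a (Finset.mem_insert_self _ _)).union (hA a (Finset.mem_insert_self _ _))
      (isClosed_biUnion_finset hA') (ih hA' fun k hk => h k (Finset.mem_insert_of_mem hk))

/-- The order of a cover is at most `d + 1` on `C` if this holds for a closed subset `A` and
for every closed set in its complement. -/
theorem DimOn.of_closed_of_disjoint [NormalSpace T] [Finite ι] {A C : Set T} (hA : IsClosed A)
    (hC : IsClosed C) (hAC : A ⊆ C) (h : DimOn ι A d)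
    (h' : ∀ D ⊆ C, IsClosed D → Disjoint D A → DimOn ι D d) : DimOn ι C d := by
  intro V hV hcov
  obtain ⟨W, h1, h2, -, h3, h4⟩ := h.exists_shrinking hA hV (hAC.trans hcov)
  obtain ⟨S, h5, h6, h7⟩ := exists_subset_iUnion_closure_subset hC h1
    (fun x _ => Set.toFinite _) (hcov.trans h3)
  -- The bad points for the closures form a closed set, since only finitely many closures are
  -- involved. It misses `A`, where the order was already bounded, so one more shrinking along it
  -- suffices.
  set D : Set T := {x ∈ C | ¬ {i | x ∈ closure (S i)}.encard ≤ d + 1}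
  have hD : IsClosed D := by
    refine hC.inter ⟨isOpen_iff_mem_nhds.mpr fun x hx => ?_⟩
    have hx' : {i | x ∈ closure (S i)}.encard ≤ d + 1 := not_not.mp hx
    have : (⋂ i : {i // x ∉ closure (S i)}, (closure (S i.1))ᶜ) ∈ 𝓝 x :=
      Filter.iInter_mem.mpr fun i => isClosed_closure.isOpen_compl.mem_nhds i.2
    refine Filter.mem_of_superset this fun y hy => ?_
    refine not_not.mpr ((Set.encard_le_encard fun i hi => ?_).trans hx')
    by_contra hxi
    exact Set.mem_iInter.mp hy ⟨i, hxi⟩ hi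
  have hDA : Disjoint D A := Set.disjoint_left.mpr fun x hx hxA =>
    hx.2 ((Set.encard_le_encard fun i hi => h7 i hi).trans (h4 x hxA))
  obtain ⟨W', h8, h9, -, h10, h11⟩ := (h' D (Set.sep_subset _ _) hD hDA).exists_shrinking hD h6
    ((Set.sep_subset _ _).trans h5)
  refine ⟨W', h8, fun i => (h9 i).trans (subset_closure.trans ((h7 i).trans (h2 i))),
    h5.trans h10, fun x hx => ?_⟩
  by_cases hxD : x ∈ D
  · exact h11 x hxD
  · have : {i | x ∈ closure (S i)}.encard ≤ d + 1 := by
      by_contra hcon; exact hxD ⟨hx, hcon⟩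
    refine (Set.encard_le_encard (t := {i | x ∈ closure (S i)}) fun i hi => ?_).trans this
    exact subset_closure (h9 i hi)

/-- On the compact set `K` the map is a homeomorphism onto its image. Removing the compact set `f ''
(K \ W i)` from `V i` gives an open set with trace `f '' (K ∩ W i)` on the image. -/
theorem DimOn.image {S : Type u} [TopologicalSpace S] [T2Space S] {f : T → S} (hf : Continuous f)
    {K : Set T} (hK : IsCompact K) (hinj : Set.InjOn f K) (h : DimOn ι K d) :
    DimOn ι (f '' K) d := by
  intro V hV hcov
  obtain ⟨W, h1, h2, h3, h4⟩ := h (fun i => f ⁻¹' V i) (fun i => (hV i).preimage hf) (by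
    rw [← Set.preimage_iUnion]; exact Set.image_subset_iff.mp hcov)
  have key : ∀ i, ∀ x ∈ K, f x ∈ V i \ f '' (K \ W i) ↔ x ∈ W i := by
    intro i x hx
    constructor
    · rintro ⟨-, h⟩
      by_contra hxW
      exact h ⟨x, ⟨hx, hxW⟩, rfl⟩
    · refine fun hxW => ⟨h2 i hxW, ?_⟩
      rintro ⟨y, ⟨hy, hyW⟩, e⟩
      rw [hinj hy hx e] at hyW
      exact hyW hxW
  refine ⟨fun i => V i \ f '' (K \ W i),
    fun i => (hV i).sdiff ((hK.diff (h1 i)).image hf).isClosed,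
    fun i => Set.sdiff_subset, ?_, ?_⟩
  · rintro _ ⟨x, hx, rfl⟩
    obtain ⟨i, hi⟩ := Set.mem_iUnion.mp (h3 hx)
    exact Set.mem_iUnion.mpr ⟨i, (key i x hx).mpr hi⟩
  · rintro _ ⟨x, hx, rfl⟩
    refine (Set.encard_le_encard fun i hi => ?_).trans (h4 x hx)
    exact (key i x hx).mp hi

/-- A partially shrunk cover: its order is at most `d + 1` on the sets `A k`, `k ∈ s`. -/
structure PartialShrinking {κ : Type u} (A : κ → Set T) (ι : Type u) (V : ι → Set T) (d : ℕ) where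
  s : Set κ
  W : ι → Set T
  isOpen : ∀ i, IsOpen (W i)
  subset : ∀ i, W i ⊆ V i
  cover : ∀ x, ∃ i, x ∈ W i
  order : ∀ k ∈ s, ∀ x ∈ A k, {i | x ∈ W i}.encard ≤ d + 1

namespace PartialShrinking

variable {κ : Type u} {A : κ → Set T} {V : ι → Set T}

/-- `b` is obtained from `a` by shrinking inside the sets `A k` with `k ∈ b.s \ a.s`. -/
def Extends (a b : PartialShrinking A ι V d) : Prop :=
  a.s ⊆ b.s ∧ (∀ i, b.W i ⊆ a.W i) ∧ ∀ i, ∀ x ∈ a.W i, x ∉ b.W i → ∃ k ∈ b.s, k ∉ a.s ∧ x ∈ A k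

theorem Extends.trans {a b c : PartialShrinking A ι V d} (h : a.Extends b) (h' : b.Extends c) :
    a.Extends c := by
  refine ⟨h.1.trans h'.1, fun i => (h'.2.1 i).trans (h.2.1 i), fun i x hx hx' => ?_⟩
  by_cases hb : x ∈ b.W i
  · obtain ⟨k, h1, h2, h3⟩ := h'.2.2 i x hb hx'
    exact ⟨k, h1, fun hk => h2 (h.1 hk), h3⟩
  · obtain ⟨k, h1, h2, h3⟩ := h.2.2 i x hx hb
    exact ⟨k, h'.1 h1, h2, h3⟩

theorem extends_refl (a : PartialShrinking A ι V d) : a.Extends a :=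
  ⟨subset_rfl, fun _ => subset_rfl, fun _ _ h h' => absurd h h'⟩

/-- An extension changes the sets only inside the newly added `A k`. Near a point finitely many of
these matter, so a chain is locally stationary, and intersecting its members keeps the sets open and
covering. -/
theorem exists_upper_bound (hlf : LocallyFinite A) {c : Set (PartialShrinking A ι V d)}
    (hc : IsChain Extends c) {a₁ : PartialShrinking A ι V d} (ha₁ : a₁ ∈ c) :
    ∃ ub : PartialShrinking A ι V d, ∀ a ∈ c, a.Extends ub := by
  have htot : ∀ a ∈ c, ∀ b ∈ c, a.Extends b ∨ b.Extends a := fun a ha b hb => by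
    by_cases hab : a = b
    · subst hab; exact Or.inl a.extends_refl
    · exact hc ha hb hab
  have hfin : ∀ F : Set κ, F.Finite → ∃ a ∈ c, ∀ b ∈ c, b.s ∩ F ⊆ a.s := by
    intro F hF
    induction F, hF using Set.Finite.induction_on with
    | empty => exact ⟨a₁, ha₁, by simp⟩
    | @insert k F _ _ ih =>
      obtain ⟨a, ha, h⟩ := ih
      by_cases hk : ∃ b ∈ c, k ∈ b.s
      · obtain ⟨b, hb, hkb⟩ := hk
        rcases htot a ha b hb with hab | hab
        · refine ⟨b, hb, ?_⟩
          rintro e he j ⟨hj, rfl | hjF⟩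
          · exact hkb
          · exact hab.1 (h e he ⟨hj, hjF⟩)
        · refine ⟨a, ha, ?_⟩
          rintro e he j ⟨hj, rfl | hjF⟩
          · exact hab.1 hkb
          · exact h e he ⟨hj, hjF⟩
      · refine ⟨a, ha, ?_⟩
        rintro e he j ⟨hj, rfl | hjF⟩
        · exact absurd ⟨e, he, hj⟩ hk
        · exact h e he ⟨hj, hjF⟩
  have hloc : ∀ x : T, ∃ O ∈ 𝓝 x, ∃ a ∈ c, (∀ b ∈ c, ∀ k ∈ b.s, x ∈ A k → k ∈ a.s) ∧
      ∀ b ∈ c, ∀ i, a.W i ∩ O ⊆ b.W i := by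
    intro x
    obtain ⟨O, hO, hF⟩ := hlf x
    obtain ⟨a, ha, h⟩ := hfin _ hF
    refine ⟨O, hO, a, ha, fun b hb k hk hx => h b hb ⟨hk, x, hx, mem_of_mem_nhds hO⟩, ?_⟩
    rintro b hb i y ⟨hy, hyO⟩
    rcases htot a ha b hb with hab | hab
    · by_contra hyb
      obtain ⟨k, h1, h2, h3⟩ := hab.2.2 i y hy hyb
      exact h2 (h b hb ⟨h1, y, h3, hyO⟩)
    · exact hab.2.1 i hy
  refine ⟨⟨⋃ a ∈ c, a.s, fun i => ⋂ a ∈ c, a.W i, fun i => ?_, fun i => ?_, fun x => ?_, ?_⟩, ?_⟩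
  · refine isOpen_iff_mem_nhds.mpr fun x hx => ?_
    obtain ⟨O, hO, a, ha, -, h⟩ := hloc x
    refine Filter.mem_of_superset
      (Filter.inter_mem ((a.isOpen i).mem_nhds (Set.mem_iInter₂.mp hx a ha)) hO) ?_
    exact fun y hy => Set.mem_iInter₂.mpr fun b hb => h b hb i hy
  · exact (Set.biInter_subset_of_mem ha₁).trans (a₁.subset i)
  · obtain ⟨O, hO, a, ha, -, h⟩ := hloc x
    obtain ⟨i, hi⟩ := a.cover x
    exact ⟨i, Set.mem_iInter₂.mpr fun b hb => h b hb i ⟨hi, mem_of_mem_nhds hO⟩⟩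
  · intro k hk x hx
    obtain ⟨b, hb, hkb⟩ := Set.mem_iUnion₂.mp hk
    obtain ⟨O, hO, a, ha, h, -⟩ := hloc x
    refine (Set.encard_le_encard (t := {i | x ∈ a.W i}) fun i hi => ?_).trans
      (a.order k (h b hb k hkb hx) x hx)
    exact Set.mem_iInter₂.mp hi a ha
  · intro a ha
    refine ⟨Set.subset_biUnion_of_mem (u := fun a : PartialShrinking A ι V d => a.s) ha,
      fun i => Set.biInter_subset_of_mem ha, fun i x hx hx' => ?_⟩
    obtain ⟨O, hO, b, hb, -, h⟩ := hloc x
    have hxb : x ∉ b.W i := fun hxb =>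
      hx' (Set.mem_iInter₂.mpr fun e he => h e he i ⟨hxb, mem_of_mem_nhds hO⟩)
    rcases htot a ha b hb with hab | hab
    · obtain ⟨k, h1, h2, h3⟩ := hab.2.2 i x hx hxb
      exact ⟨k, Set.mem_biUnion hb h1, h2, h3⟩
    · exact absurd (hab.2.1 i hx) hxb

end PartialShrinking

/-- The locally finite sum theorem. -/
theorem coveringDimLE_of_locallyFinite {κ : Type u} {A : κ → Set T} (hA : ∀ k, IsClosed (A k))
    (hlf : LocallyFinite A) (hcov : ∀ x, ∃ k, x ∈ A k) (h : ∀ (ι : Type u) k, DimOn ι (A k) d) :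
    CoveringDimLE T d := by
  intro 𝒰 hU hUcov
  have hV : ∀ x, ∃ i : 𝒰, x ∈ i.1 := fun x => by
    obtain ⟨U, hU, hx⟩ := hUcov.symm ▸ Set.mem_univ x
    exact ⟨⟨U, hU⟩, hx⟩
  let a₀ : PartialShrinking A 𝒰 (fun i => i.1) d :=
    ⟨∅, fun i => i.1, fun i => hU i.1 i.2, fun _ => subset_rfl, hV, fun k hk => absurd hk (by simp)⟩
  -- Zorn's lemma. A maximal partial shrinking has treated every `A k`, since otherwise it could be
  -- shrunk once more along a missing one.
  obtain ⟨m, hm⟩ := exists_maximal_of_chains_bounded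
    (r := PartialShrinking.Extends (A := A) (ι := 𝒰) (V := fun i => i.1) (d := d)) (fun c hc => by
      rcases c.eq_empty_or_nonempty with rfl | ⟨a, ha⟩
      · exact ⟨a₀, by simp⟩
      · exact PartialShrinking.exists_upper_bound hlf hc ha) fun h1 h2 => h1.trans h2
  have hall : ∀ k, k ∈ m.s := by
    intro k
    obtain ⟨W, h1, h2, h3, h4, h5⟩ := (h 𝒰 k).exists_shrinking (hA k) m.isOpen
      fun x _ => Set.mem_iUnion.mpr (m.cover x)
    let b : PartialShrinking A 𝒰 (fun i => i.1) d :=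
      ⟨insert k m.s, W, h1, fun i => (h2 i).trans (m.subset i), fun x =>
        Set.mem_iUnion.mp (h4 (Set.mem_iUnion.mpr (m.cover x))), by
        rintro j (rfl | hj) x hx
        · exact h5 x hx
        · exact (Set.encard_le_encard fun i hi => h2 i hi).trans (m.order j hj x hx)⟩
    by_contra hk
    refine hk ((hm b ⟨Set.subset_insert _ _, h2, fun i x hx hx' => ?_⟩).1 (Set.mem_insert _ _))
    exact ⟨k, Set.mem_insert _ _, hk, h3 i ⟨hx, hx'⟩⟩
  refine ⟨Set.range m.W, ?_, ?_, ?_, fun x => ?_⟩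
  · rintro _ ⟨i, rfl⟩; exact m.isOpen i
  · refine Set.eq_univ_of_forall fun x => ?_
    obtain ⟨i, hi⟩ := m.cover x
    exact ⟨_, ⟨i, rfl⟩, hi⟩
  · rintro _ ⟨i, rfl⟩; exact ⟨i.1, i.2, m.subset i⟩
  · obtain ⟨k, hk⟩ := hcov x
    refine le_trans ((Set.encard_le_encard ?_).trans (Set.encard_image_le m.W {i | x ∈ m.W i}))
      (m.order k (hall k) x hk)
    rintro _ ⟨⟨i, rfl⟩, hx⟩
    exact ⟨i, hx, rfl⟩

end Dimension

/-! ### Dimension of the orbit space and invariant covers. -/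

section Orbits

open Topology Pointwise

variable {T : Type u} {ι : Type u} {d : ℕ} {Γ : Type u} [Group Γ] [MulAction Γ T]

/-- The orbit of a point. -/
def orbitMk (Γ : Type u) [Group Γ] [MulAction Γ T] (x : T) :
    MulAction.orbitRel.Quotient Γ T := Quotient.mk (MulAction.orbitRel Γ T) x

theorem orbitMk_eq {x y : T} : orbitMk Γ x = orbitMk Γ y ↔ ∃ g : Γ, g • y = x :=
  Quotient.eq.trans (MulAction.orbitRel_apply.trans Iff.rfl)

theorem card_stabilizer_smul (g : Γ) (x : T) :
    Nat.card (MulAction.stabilizer Γ (g • x)) = Nat.card (MulAction.stabilizer Γ x) :=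
  Nat.card_congr (MulAction.stabilizerEquivStabilizerOfOrbitRel
    (MulAction.orbitRel_apply.mpr ⟨g, rfl⟩)).toEquiv

theorem stabilizer_le_of_mem {x y : T} {U : Set T}
    (hU : ∀ g : Γ, (g • U ∩ U).Nonempty → g • x = x) (hy : y ∈ U) :
    MulAction.stabilizer Γ y ≤ MulAction.stabilizer Γ x :=
  fun g hg => hU g ⟨y, ⟨y, hy, hg⟩, hy⟩

/-- The set of orbits of points with at least `k` elements in the stabilizer. -/
def orbitStratum (Γ T : Type u) [Group Γ] [MulAction Γ T] (k : ℕ) :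
    Set (MulAction.orbitRel.Quotient Γ T) :=
  orbitMk Γ '' {x | k ≤ Nat.card (MulAction.stabilizer Γ x)}

theorem orbitMk_mem_stratum {k : ℕ} {x : T} :
    orbitMk Γ x ∈ orbitStratum Γ T k ↔ k ≤ Nat.card (MulAction.stabilizer Γ x) := by
  refine ⟨?_, fun h => ⟨x, h, rfl⟩⟩
  rintro ⟨y, hy, e⟩
  obtain ⟨g, rfl⟩ := orbitMk_eq.mp e
  rwa [Set.mem_ofPred_eq, card_stabilizer_smul] at hy

variable [TopologicalSpace T]

theorem finite_stabilizer_subgroup [ProperlyDiscontinuousSMul Γ T] (x : T) : Finite (MulAction.stabilizer Γ x) :=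
  (ProperlyDiscontinuousSMul.finite_stabilizer (Γ := Γ) x).to_subtype

theorem isOpenQuotientMap_orbitMk [ContinuousConstSMul Γ T] : IsOpenQuotientMap (orbitMk Γ : T → _) :=
  MulAction.isOpenQuotientMap_quotientMk

variable [T2Space T] [LocallyCompactSpace T] [ContinuousConstSMul Γ T]
  [ProperlyDiscontinuousSMul Γ T]

/-- A small relatively compact neighbourhood is intersected with its translates under the stabilizer
of `x`, which is finite by properness. -/
theorem exists_invariant_nhd (x : T) : ∃ U : Set T, IsOpen U ∧ x ∈ U ∧
    (∃ K, IsCompact K ∧ U ⊆ K) ∧ (∀ g : Γ, g • x = x → g • U = U) ∧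
    ∀ g : Γ, (g • U ∩ U).Nonempty → g • x = x := by
  obtain ⟨V, hV, h⟩ := ProperlyDiscontinuousSMul.exists_nhds_image_smul_eq_self Γ x
  obtain ⟨K, hK, hKx⟩ := exists_compact_mem_nhds x
  set O := interior (V ∩ K)
  have hO : IsOpen O := isOpen_interior
  have hxO : x ∈ O := mem_interior_iff_mem_nhds.mpr (Filter.inter_mem hV hKx)
  have hOV : O ⊆ V ∩ K := interior_subset
  have hfin := ProperlyDiscontinuousSMul.finite_stabilizer' Γ x
  have hsub : (⋂ g ∈ {g : Γ | g • x = x}, g • O) ⊆ O := by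
    refine (Set.biInter_subset_of_mem (show (1 : Γ) ∈ {g : Γ | g • x = x} from one_smul _ x)).trans ?_
    rw [one_smul]
  refine ⟨⋂ g ∈ {g : Γ | g • x = x}, g • O, hfin.isOpen_biInter fun g _ => hO.smul g,
    Set.mem_iInter₂.mpr fun g hg => ⟨x, hxO, hg⟩, ⟨K, hK, hsub.trans (hOV.trans
      Set.inter_subset_right)⟩, fun g hg => ?_, fun g hg => ?_⟩
  · ext y
    rw [Set.mem_smul_set_iff_inv_smul_mem]
    simp only [Set.mem_iInter, Set.mem_ofPred_eq, Set.mem_smul_set_iff_inv_smul_mem]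
    constructor
    · intro hy k hk
      have := hy (g⁻¹ * k) (by rw [mul_smul, hk, inv_smul_eq_iff, hg])
      rwa [smul_smul, mul_inv_rev, inv_inv, mul_assoc, mul_inv_cancel, mul_one] at this
    · intro hy k hk
      have := hy (g * k) (by rw [mul_smul, hk, hg])
      rwa [mul_inv_rev, mul_smul] at this
  · obtain ⟨_, ⟨y, hy, rfl⟩, hgy⟩ := hg
    exact h g ⟨g • y, ⟨y, (hOV (hsub hy)).1, rfl⟩, (hOV (hsub hgy)).1⟩

/-- Stabilizers are upper semicontinuous: those of points near `x` are subgroups of the finite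
stabilizer of `x`. -/
theorem isClosed_orbitStratum (k : ℕ) : IsClosed (orbitStratum Γ T k) := by
  rw [← isOpenQuotientMap_orbitMk.isQuotientMap.isClosed_preimage]
  refine ⟨isOpen_iff_mem_nhds.mpr fun x hx => ?_⟩
  obtain ⟨U, hU, hxU, -, -, h⟩ := exists_invariant_nhd (Γ := Γ) x
  refine Filter.mem_of_superset (hU.mem_nhds hxU) fun y hy hy' => hx ?_
  have := finite_stabilizer_subgroup (Γ := Γ) x
  exact orbitMk_mem_stratum.mpr ((orbitMk_mem_stratum.mp hy').trans
    (Nat.card_le_card_of_injective _ (Subgroup.inclusion_injective (stabilizer_le_of_mem h hy))))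

variable [CompactSpace (MulAction.orbitRel.Quotient Γ T)]

instance : T2Space (MulAction.orbitRel.Quotient Γ T) :=
  t2Space_of_properlyDiscontinuousSMul_of_t2Space

/-- On points with stabilizer of order exactly `k` the orbit map is locally injective: if `g • b`
and `b` are both near `x y`, then `g` fixes `x y`, whose stabilizer contains that of `b` and has the
same order, so `g` fixes `b`. Thus `D` is a finite union of injective images of compact sets. -/
theorem dimOn_of_disjoint_stratum (hdim : CoveringDimLE T d) {k : ℕ}
    {D : Set (MulAction.orbitRel.Quotient Γ T)} (hD : IsClosed D) (hDk : D ⊆ orbitStratum Γ T k)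
    (hdisj : Disjoint D (orbitStratum Γ T (k + 1))) : DimOn ι D d := by
  have hπ := isOpenQuotientMap_orbitMk (Γ := Γ) (T := T)
  choose x hx using hπ.surjective
  choose U hU hxU hUK hinv hUx using fun y => exists_invariant_nhd (Γ := Γ) (x y)
  choose K hK hxK hKU using fun y => exists_compact_subset (hU y) (hxU y)
  obtain ⟨t, ht, hcov⟩ := hD.isCompact.elim_nhds_subcover (fun y => orbitMk Γ '' K y) fun y _ => by
    have := hπ.isOpenMap.image_mem_nhds (mem_interior_iff_mem_nhds.mp (hxK y))
    rwa [hx] at this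
  have hDeq : D = ⋃ y ∈ t, orbitMk Γ '' (K y ∩ orbitMk Γ ⁻¹' D) := by
    ext z
    simp only [Set.mem_iUnion]
    constructor
    · intro hz
      obtain ⟨y, hy, w, hw, rfl⟩ := Set.mem_iUnion₂.mp (hcov hz)
      exact ⟨y, hy, w, ⟨hw, hz⟩, rfl⟩
    · rintro ⟨y, -, w, ⟨-, hw⟩, rfl⟩
      exact hw
  have hcomp : ∀ y, IsCompact (K y ∩ orbitMk Γ ⁻¹' D) := fun y =>
    (hK y).inter_right (hD.preimage hπ.continuous)
  rw [hDeq]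
  refine DimOn.biUnion t (fun y _ => ((hcomp y).image hπ.continuous).isClosed) fun y hy => ?_
  refine DimOn.image hπ.continuous (hcomp y) ?_ (hdim.dimOn (hcomp y).isClosed)
  have hcard : ∀ z, orbitMk Γ z ∈ D → Nat.card (MulAction.stabilizer Γ z) = k := fun z hz =>
    le_antisymm (Nat.lt_succ_iff.mp (not_le.mp fun h =>
      Set.disjoint_left.mp hdisj hz (orbitMk_mem_stratum.mpr h)))
      (orbitMk_mem_stratum.mp (hDk hz))
  rintro a ⟨haK, haD⟩ b ⟨hbK, hbD⟩ e
  obtain ⟨g, rfl⟩ := orbitMk_eq.mp e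
  have hg : g ∈ MulAction.stabilizer Γ (x y) := hUx y g ⟨g • b, ⟨b, hKU y hbK, rfl⟩, hKU y haK⟩
  have := finite_stabilizer_subgroup (Γ := Γ) (x y)
  have hst : MulAction.stabilizer Γ b = MulAction.stabilizer Γ (x y) :=
    Subgroup.eq_of_le_of_card_ge (stabilizer_le_of_mem (hUx y) (hKU y hbK))
      (by rw [hcard b hbD, hcard (x y) (by rw [hx]; exact ht y hy)])
  rw [← hst] at hg
  exact hg

theorem dimOn_orbits [Finite ι] (hdim : CoveringDimLE T d) {M : ℕ}
    (hM : ∀ x : T, Nat.card (MulAction.stabilizer Γ x) ≤ M) :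
    DimOn ι (Set.univ : Set (MulAction.orbitRel.Quotient Γ T)) d := by
  -- Downward induction on `k`, starting above the bound `M`, where the stratum is empty.
  have key : ∀ j k : ℕ, M + 1 ≤ j + k → DimOn ι (orbitStratum Γ T k) d := by
    intro j
    induction j with
    | zero =>
      intro k hk
      have : orbitStratum Γ T k = ∅ := by
        refine Set.eq_empty_of_forall_notMem ?_
        rintro _ ⟨x, hx, rfl⟩
        have h1 : k ≤ Nat.card (MulAction.stabilizer Γ x) := hx
        have := hM x
        omega
      rw [this]
      exact DimOn.empty
    | succ j ih =>
      intro k hk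
      refine DimOn.of_closed_of_disjoint (isClosed_orbitStratum (k + 1)) (isClosed_orbitStratum k)
        ?_ (ih (k + 1) (by omega)) fun D hDk hD hdisj => dimOn_of_disjoint_stratum hdim hD hDk hdisj
      exact Set.image_mono fun x hx => (Nat.le_succ k).trans hx
  have huniv : orbitStratum Γ T 0 = Set.univ := by
    refine Set.eq_univ_of_forall fun y => ?_
    obtain ⟨x, rfl⟩ := (isOpenQuotientMap_orbitMk (Γ := Γ) (T := T)).surjective y
    exact ⟨x, Nat.zero_le _, rfl⟩
  rw [← huniv]
  exact key (M + 1) 0 le_rfl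

/-- A space of dimension at most `d` with a proper co-compact action has an invariant cover
of order at most `d + 1` by relatively compact open sets. -/
theorem exists_invariant_cover (hdim : CoveringDimLE T d) {M : ℕ}
    (hM : ∀ x : T, Nat.card (MulAction.stabilizer Γ x) ≤ M) :
    ∃ 𝒱 : Set (Set T), (∀ V ∈ 𝒱, IsOpen V ∧ V.Nonempty ∧ ∃ K, IsCompact K ∧ V ⊆ K) ∧
      ⋃₀ 𝒱 = Set.univ ∧ (∀ g : Γ, ∀ V ∈ 𝒱, g • V ∈ 𝒱) ∧
      (∃ 𝒱₀ ⊆ 𝒱, 𝒱₀.Finite ∧ ∀ V ∈ 𝒱, ∃ g : Γ, g • V ∈ 𝒱₀) ∧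
      ∀ x : T, {V ∈ 𝒱 | x ∈ V}.encard ≤ d + 1 := by
  have hπ := isOpenQuotientMap_orbitMk (Γ := Γ) (T := T)
  choose x hx using hπ.surjective
  choose U hU hxU hUK hinv hUx using fun y => exists_invariant_nhd (Γ := Γ) (x y)
  obtain ⟨t, -, hcov⟩ := isCompact_univ.elim_nhds_subcover (fun y => orbitMk Γ '' U y) fun y _ => by
    have := hπ.isOpenMap.image_mem_nhds ((hU y).mem_nhds (hxU y))
    rwa [hx] at this
  obtain ⟨W, h1, h2, h3, h4⟩ := dimOn_orbits (ι := t) (Γ := Γ) hdim hM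
    (fun y => orbitMk Γ '' U y.1) (fun y => hπ.isOpenMap _ (hU y)) fun z hz => by
      obtain ⟨y, hy, hzy⟩ := Set.mem_iUnion₂.mp (hcov hz)
      exact Set.mem_iUnion.mpr ⟨⟨y, hy⟩, hzy⟩
  have hsmul : ∀ (g k : Γ) (y : t), k • (g • U y.1 ∩ orbitMk Γ ⁻¹' W y) =
      (k * g) • U y.1 ∩ orbitMk Γ ⁻¹' W y := by
    intro g k y
    rw [Set.smul_set_inter, smul_smul]
    congr 1
    ext z
    rw [Set.mem_smul_set_iff_inv_smul_mem, Set.mem_preimage, Set.mem_preimage,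
      orbitMk_eq.mpr ⟨k⁻¹, rfl⟩]
  refine ⟨{V | V.Nonempty ∧ ∃ (y : t) (g : Γ), V = g • U y.1 ∩ orbitMk Γ ⁻¹' W y}, ?_, ?_, ?_,
    ⟨{V | V.Nonempty ∧ ∃ y : t, V = U y.1 ∩ orbitMk Γ ⁻¹' W y}, ?_, ?_, ?_⟩, ?_⟩
  · rintro _ ⟨hne, y, g, rfl⟩
    refine ⟨((hU y.1).smul g).inter ((h1 y).preimage hπ.continuous), hne, ?_⟩
    obtain ⟨K, hK, hUK⟩ := hUK y.1
    exact ⟨g • K, hK.smul g, Set.inter_subset_left.trans (Set.smul_set_mono hUK)⟩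
  · refine Set.eq_univ_of_forall fun z => ?_
    obtain ⟨y, hy⟩ := Set.mem_iUnion.mp (h3 (Set.mem_univ (orbitMk Γ z)))
    obtain ⟨w, hw, e⟩ := h2 y hy
    obtain ⟨g, rfl⟩ := orbitMk_eq.mp e.symm
    have : g • w ∈ g • U y.1 ∩ orbitMk Γ ⁻¹' W y := ⟨⟨w, hw, rfl⟩, hy⟩
    exact ⟨_, ⟨⟨_, this⟩, y, g, rfl⟩, this⟩
  · rintro k _ ⟨hne, y, g, rfl⟩
    exact ⟨hne.smul_set, y, k * g, hsmul g k y⟩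
  · rintro _ ⟨hne, y, rfl⟩
    exact ⟨hne, y, 1, by rw [one_smul]⟩
  · refine (Set.finite_range fun y : t => U y.1 ∩ orbitMk Γ ⁻¹' W y).subset ?_
    rintro _ ⟨-, y, rfl⟩
    exact ⟨y, rfl⟩
  · rintro _ ⟨hne, y, g, rfl⟩
    exact ⟨g⁻¹, hne.smul_set, y, by rw [hsmul, inv_mul_cancel, one_smul]⟩
  -- For each `y`, two translates of `U y` that share a point coincide, so at most one translate
  -- contains `z`. Therefore the order upstairs is at most the order of `W` at the orbit of `z`.
  · intro z
    choose! g hg using fun (y : t) (h : ∃ g : Γ, z ∈ g • U y.1) => h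
    refine le_trans ((Set.encard_le_encard ?_).trans (Set.encard_image_le
      (fun y => g y • U y.1 ∩ orbitMk Γ ⁻¹' W y) {y | orbitMk Γ z ∈ W y})) (h4 _ (Set.mem_univ _))
    rintro _ ⟨⟨-, y, k, rfl⟩, hzk, hzW⟩
    refine ⟨y, hzW, ?_⟩
    simp only
    congr 1
    have h5 := hg y ⟨k, hzk⟩
    have h6 : (k⁻¹ * g y) • x y.1 = x y.1 := by
      refine hUx y.1 _ ⟨k⁻¹ • z, ?_, Set.mem_smul_set_iff_inv_smul_mem.mp hzk⟩
      rw [mul_smul]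
      exact Set.smul_mem_smul_set h5
    have h7 := hinv y.1 _ h6
    rw [mul_smul, inv_smul_eq_iff] at h7
    exact h7

end Orbits

end SelfSimilar

end

noncomputable section

namespace SelfSimilar

/-! ### The `ℓ¹`-norm on barycentric coordinates. -/

section L1

variable {V : Type u}

/-- The `ℓ¹`-norm of a finitely supported function. -/
def nrm (f : V →₀ ℝ) : ℝ := f.sum fun _ a => |a|

theorem nrm_eq_sum {f : V →₀ ℝ} {s : Finset V} (h : f.support ⊆ s) :
    nrm f = ∑ v ∈ s, |f v| :=
  Finsupp.sum_of_support_subset f h _ fun _ _ => abs_zero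

theorem nrm_nonneg (f : V →₀ ℝ) : 0 ≤ nrm f := Finset.sum_nonneg fun _ _ => abs_nonneg _

theorem abs_le_nrm (f : V →₀ ℝ) (v : V) : |f v| ≤ nrm f := by
  classical
  rw [nrm_eq_sum (Finset.subset_insert v f.support)]
  exact Finset.single_le_sum (f := fun v => |f v|) (fun _ _ => abs_nonneg _)
    (Finset.mem_insert_self v _)

theorem nrm_zero : nrm (0 : V →₀ ℝ) = 0 := Finsupp.sum_zero_index

theorem nrm_eq_zero {f : V →₀ ℝ} (h : nrm f = 0) : f = 0 :=
  Finsupp.ext fun v => abs_nonpos_iff.mp ((abs_le_nrm f v).trans h.le)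

theorem nrm_add_le (f g : V →₀ ℝ) : nrm (f + g) ≤ nrm f + nrm g := by
  classical
  rw [nrm_eq_sum (Finset.subset_union_left (s₁ := f.support) (s₂ := g.support)),
    nrm_eq_sum (Finset.subset_union_right (s₁ := f.support) (s₂ := g.support)),
    nrm_eq_sum Finsupp.support_add, ← Finset.sum_add_distrib]
  exact Finset.sum_le_sum fun v _ => abs_add_le _ _

theorem nrm_smul (a : ℝ) (f : V →₀ ℝ) : nrm (a • f) = |a| * nrm f := by
  rw [nrm_eq_sum (Finsupp.support_smul (b := a) (g := f)), nrm_eq_sum subset_rfl, Finset.mul_sum]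
  exact Finset.sum_congr rfl fun v _ => by simp [abs_mul]

theorem nrm_neg (f : V →₀ ℝ) : nrm (-f) = nrm f := by
  have := nrm_smul (-1) f
  simpa using this

theorem nrm_sum_le {ι : Type*} (s : Finset ι) (g : ι → V →₀ ℝ) :
    nrm (∑ i ∈ s, g i) ≤ ∑ i ∈ s, nrm (g i) := by
  classical
  induction s using Finset.induction_on with
  | empty => simp [nrm_zero]
  | insert a s ha ih =>
    rw [Finset.sum_insert ha, Finset.sum_insert ha]
    exact (nrm_add_le _ _).trans (add_le_add_right ih _)

/-- A combination with zero total weight of vectors at mutual distances at most `2 c` has norm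
at most `c` times the norm of the weight. -/
theorem nrm_combination_le {W : Type u} {s : Finset V} {f : V → ℝ} (hf : ∑ v ∈ s, f v = 0)
    {F : V → W →₀ ℝ} {c : ℝ} (hF : ∀ u ∈ s, ∀ v ∈ s, nrm (F u - F v) ≤ 2 * c) :
    nrm (∑ v ∈ s, f v • F v) ≤ c * ∑ v ∈ s, |f v| := by
  set p : V → ℝ := fun v => max (f v) 0
  set q : V → ℝ := fun v => max (-f v) 0
  have hpq : ∀ v, p v - q v = f v := fun v => by
    simp only [p, q]
    rcases le_total 0 (f v) with h | h
    · rw [max_eq_left h, max_eq_right (by linarith)]; ring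
    · rw [max_eq_right h, max_eq_left (by linarith)]; ring
  have habs : ∀ v, p v + q v = |f v| := fun v => by
    simp only [p, q]
    rcases le_total 0 (f v) with h | h
    · rw [max_eq_left h, max_eq_right (by linarith), abs_of_nonneg h]; ring
    · rw [max_eq_right h, max_eq_left (by linarith), abs_of_nonpos h]; ring
  set t := ∑ v ∈ s, p v
  have htq : ∑ v ∈ s, q v = t := by
    have : ∑ v ∈ s, (p v - q v) = 0 := by rw [← hf]; exact Finset.sum_congr rfl fun v _ => hpq v
    rw [Finset.sum_sub_distrib] at this
    linarith
  have ht2 : ∑ v ∈ s, |f v| = 2 * t := by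
    rw [← Finset.sum_congr rfl fun v _ => habs v, Finset.sum_add_distrib, htq]; ring
  have hp0 : ∀ v, 0 ≤ p v := fun v => le_max_right _ _
  have hq0 : ∀ v, 0 ≤ q v := fun v => le_max_right _ _
  have ht0 : 0 ≤ t := Finset.sum_nonneg fun v _ => hp0 v
  -- The positive part `p` and the negative part `q` of `f` have the same total weight `t`, so `t`
  -- times the combination is a sum of differences `F u - F v` with weights `p u * q v` of total
  -- `t²`. Dividing by `t` gives the bound.
  have key : t • ∑ v ∈ s, f v • F v = ∑ u ∈ s, ∑ v ∈ s, (p u * q v) • (F u - F v) := by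
    have h1 : ∑ u ∈ s, ∑ v ∈ s, (p u * q v) • F u = t • ∑ u ∈ s, p u • F u := by
      rw [Finset.smul_sum]
      refine Finset.sum_congr rfl fun u _ => ?_
      rw [← Finset.sum_smul, ← Finset.mul_sum, htq, smul_smul, mul_comm]
    have h2 : ∑ u ∈ s, ∑ v ∈ s, (p u * q v) • F v = t • ∑ v ∈ s, q v • F v := by
      rw [Finset.sum_comm, Finset.smul_sum]
      refine Finset.sum_congr rfl fun v _ => ?_
      rw [← Finset.sum_smul, ← Finset.sum_mul, smul_smul]
    simp only [smul_sub, Finset.sum_sub_distrib]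
    rw [h1, h2, ← smul_sub, ← Finset.sum_sub_distrib]
    congr 1
    exact Finset.sum_congr rfl fun v _ => by rw [← sub_smul, hpq]
  have hle : t * nrm (∑ v ∈ s, f v • F v) ≤ t * (c * (2 * t)) := by
    rw [← abs_of_nonneg ht0, ← nrm_smul, abs_of_nonneg ht0, key]
    calc _ ≤ ∑ u ∈ s, ∑ v ∈ s, (p u * q v) * (2 * c) := by
          refine (nrm_sum_le _ _).trans (Finset.sum_le_sum fun u hu => ?_)
          refine (nrm_sum_le _ _).trans (Finset.sum_le_sum fun v hv => ?_)
          rw [nrm_smul, abs_of_nonneg (mul_nonneg (hp0 u) (hq0 v))]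
          exact mul_le_mul_of_nonneg_left (hF u hu v hv) (mul_nonneg (hp0 u) (hq0 v))
      _ = t * (c * (2 * t)) := by
          simp_rw [← Finset.sum_mul, ← Finset.mul_sum, ← Finset.sum_mul, htq]
          ring
  rw [ht2]
  rcases ht0.eq_or_lt with h | h
  · have hf0 : ∀ v ∈ s, f v = 0 := by
      intro v hv
      have := (Finset.sum_eq_zero_iff_of_nonneg fun v _ => abs_nonneg (f v)).mp
        (by rw [ht2, ← h, mul_zero]) v hv
      exact abs_eq_zero.mp this
    rw [← h, mul_zero, mul_zero, Finset.sum_eq_zero fun v hv => by rw [hf0 v hv, zero_smul],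
      nrm_zero]
  · exact le_of_mul_le_mul_left hle h

end L1

/-! ### Realizations: compactness, local finiteness and metrics. -/

namespace GComplex

variable {G : Type u} [Group G] {Γ : GComplex G}

theorem l1_eq (x y : Γ.Realization) : Γ.l1 x y = nrm (x.1 - y.1) := rfl

theorem l1_self (x : Γ.Realization) : Γ.l1 x x = 0 := by rw [l1_eq, sub_self, nrm_zero]

theorem l1_comm (x y : Γ.Realization) : Γ.l1 x y = Γ.l1 y x := by
  rw [l1_eq, l1_eq, ← nrm_neg, neg_sub]

theorem l1_triangle (x y z : Γ.Realization) : Γ.l1 x z ≤ Γ.l1 x y + Γ.l1 y z := by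
  rw [l1_eq, ← sub_add_sub_cancel x.1 y.1 z.1]
  exact nrm_add_le _ _

theorem l1_nonneg (x y : Γ.Realization) : 0 ≤ Γ.l1 x y := nrm_nonneg _

theorem eq_of_l1_eq_zero {x y : Γ.Realization} (h : Γ.l1 x y = 0) : x = y :=
  Subtype.ext (sub_eq_zero.mp (nrm_eq_zero h))

theorem nrm_point (x : Γ.Realization) : nrm x.1 = 1 := by
  exact (Finset.sum_congr rfl fun v _ => abs_of_nonneg (x.2.1 v)).trans x.2.2.1

theorem sum_eq_one {x : Γ.Realization} {s : Finset Γ.V} (h : x ∈ Γ.cell s) :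
    ∑ v ∈ s, x.1 v = 1 := by
  exact (Finsupp.sum_of_support_subset x.1 h _ fun _ _ => rfl).symm.trans x.2.2.1

theorem l1_le_two (x y : Γ.Realization) : Γ.l1 x y ≤ 2 := by
  rw [l1_eq, sub_eq_add_neg]
  refine (nrm_add_le _ _).trans ?_
  rw [nrm_neg, nrm_point, nrm_point]
  norm_num

theorem abs_sub_le_l1 (x y : Γ.Realization) (v : Γ.V) : |x.1 v - y.1 v| ≤ Γ.l1 x y :=
  abs_le_nrm (x.1 - y.1) v

/-- Points with a common coordinate bounded from below are not too far from each other. -/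
theorem l1_le_of_common {x y : Γ.Realization} {v : Γ.V} {ε : ℝ} (hx : ε ≤ x.1 v)
    (hy : ε ≤ y.1 v) : Γ.l1 x y ≤ 2 - 2 * ε := by
  classical
  set s := insert v (x.1.support ∪ y.1.support)
  have hxs : x.1.support ⊆ s := Finset.subset_union_left.trans (Finset.subset_insert _ _)
  have hys : y.1.support ⊆ s := Finset.subset_union_right.trans (Finset.subset_insert _ _)
  have hsub : (x.1 - y.1).support ⊆ s := Finsupp.support_sub.trans (Finset.subset_insert _ _)
  rw [l1_eq, nrm_eq_sum hsub]
  have h1 : ∀ u, |(x.1 - y.1) u| = x.1 u + y.1 u - 2 * min (x.1 u) (y.1 u) := fun u => by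
    rw [Finsupp.sub_apply]
    rcases le_total (x.1 u) (y.1 u) with h | h
    · rw [min_eq_left h, abs_of_nonpos (by linarith)]; ring
    · rw [min_eq_right h, abs_of_nonneg (by linarith)]; ring
  rw [Finset.sum_congr rfl fun u _ => h1 u, Finset.sum_sub_distrib, Finset.sum_add_distrib,
    sum_eq_one hxs, sum_eq_one hys, ← Finset.mul_sum]
  have h2 : min (x.1 v) (y.1 v) ≤ ∑ u ∈ s, min (x.1 u) (y.1 u) :=
    Finset.single_le_sum (f := fun u => min (x.1 u) (y.1 u))
      (fun u _ => le_min (x.2.1 u) (y.2.1 u)) (Finset.mem_insert_self _ _)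
  have h3 : ε ≤ min (x.1 v) (y.1 v) := le_min hx hy
  linarith

theorem rsmul_apply (x : Γ.Realization) (g : G) (v : Γ.V) :
    (x <• g).1 v = x.1 (v <• g⁻¹) := by
  show x.1.equivMapDomain (MulAction.toPerm (op g)) v = _
  rw [Finsupp.equivMapDomain_apply]
  rfl

theorem rsmul_apply_rsmul (x : Γ.Realization) (g : G) (v : Γ.V) :
    (x <• g).1 (v <• g) = x.1 v := by
  rw [rsmul_apply, rsmul_rsmul, mul_inv_cancel, rsmul_one]

theorem mem_support_rsmul {x : Γ.Realization} {g : G} {v : Γ.V} :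
    v ∈ (x <• g).1.support ↔ v <• g⁻¹ ∈ x.1.support := by
  rw [Finsupp.mem_support_iff, Finsupp.mem_support_iff, rsmul_apply]

theorem l1_rsmul (g : G) (x y : Γ.Realization) : Γ.l1 (x <• g) (y <• g) = Γ.l1 x y := by
  have : (x <• g).1 - (y <• g).1 =
      (x.1 - y.1).equivMapDomain (MulAction.toPerm (op g) : Equiv.Perm Γ.V) := by
    ext v
    rw [Finsupp.sub_apply, rsmul_apply, rsmul_apply, Finsupp.equivMapDomain_apply,
      Finsupp.sub_apply]
    rfl
  rw [l1_eq, l1_eq, this]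
  simp [nrm, Finsupp.sum, Finsupp.equivMapDomain]

theorem mem_faces_of_subset {σ τ : Finset Γ.V} (hσ : σ ∈ Γ.complex.faces) (h : τ ⊆ σ)
    (hne : τ.Nonempty) : τ ∈ Γ.complex.faces :=
  (Γ.complex.isRelLowerSet_faces hσ).2 h hne

theorem support_nonempty (x : Γ.Realization) : x.1.support.Nonempty :=
  (Γ.complex.isRelLowerSet_faces x.2.2.2).1

theorem pos_iff {x : Γ.Realization} {v : Γ.V} : 0 < x.1 v ↔ v ∈ x.1.support := by
  rw [Finsupp.mem_support_iff]
  exact ⟨fun h => h.ne', fun h => lt_of_le_of_ne (x.2.1 v) h.symm⟩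

/-- Vertices as points of the realization. -/
def vertex (v : Γ.V) : Γ.Realization :=
  ⟨Finsupp.single v 1, fun w => by
    classical
    rw [Finsupp.single_apply]; split_ifs <;> norm_num, by simp,
    by rw [Finsupp.support_single v (one_ne_zero (α := ℝ))]; exact Γ.complex.singleton_mem v⟩

theorem vertex_mem_cell {σ : Finset Γ.V} {v : Γ.V} (h : v ∈ σ) : vertex v ∈ Γ.cell σ := by
  show (Finsupp.single v (1 : ℝ)).support ⊆ σ
  rw [Finsupp.support_single v (one_ne_zero (α := ℝ))]
  simpa using h

theorem vertex_rsmul (v : Γ.V) (g : G) : (vertex v : Γ.Realization) <• g = vertex (v <• g) := by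
  classical
  refine Subtype.ext (Finsupp.ext fun w => ?_)
  rw [rsmul_apply]
  show Finsupp.single v (1 : ℝ) (w <• g⁻¹) = Finsupp.single (v <• g) (1 : ℝ) w
  rw [Finsupp.single_apply, Finsupp.single_apply]
  congr 1
  refine propext ⟨fun h => ?_, fun h => ?_⟩
  · rw [h, rsmul_rsmul, inv_mul_cancel, rsmul_one]
  · rw [← h, rsmul_rsmul, mul_inv_cancel, rsmul_one]

theorem isOpen_iff {U : Set Γ.Realization} : IsOpen U ↔ ∀ σ ∈ Γ.complex.faces, ∀ x ∈ Γ.cell σ,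
    x ∈ U → ∃ ε > 0, ∀ y ∈ Γ.cell σ, Γ.l1 x y < ε → y ∈ U := Iff.rfl

theorem isOpen_star (v : Γ.V) : IsOpen {x : Γ.Realization | 0 < x.1 v} := by
  refine isOpen_iff.mpr fun σ _ x _ hx => ⟨x.1 v, hx, fun y _ hxy => ?_⟩
  have := (le_abs_self _).trans_lt ((abs_sub_le_l1 x y v).trans_lt hxy)
  show 0 < y.1 v
  linarith

theorem exists_finset_star {K : Set Γ.Realization} (hK : IsCompact K) :
    ∃ F : Finset Γ.V, ∀ x ∈ K, ∃ v ∈ F, 0 < x.1 v := by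
  obtain ⟨t, ht⟩ := hK.elim_finite_subcover (fun v : Γ.V => {x : Γ.Realization | 0 < x.1 v})
    isOpen_star fun x _ => by
      obtain ⟨v, hv⟩ := support_nonempty x
      exact Set.mem_iUnion.mpr ⟨v, pos_iff.mpr hv⟩
  refine ⟨t, fun x hx => ?_⟩
  obtain ⟨v, hv, h⟩ := Set.mem_iUnion₂.mp (ht hx)
  exact ⟨v, hv, h⟩

/-- Every vertex is adjacent to finitely many vertices. -/
def IsLocallyFinite (Γ : GComplex G) : Prop :=
  ∀ v : Γ.V, {u | ∃ σ ∈ Γ.complex.faces, u ∈ σ ∧ v ∈ σ}.Finite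

/-- The point of the closed simplex `σ` with given barycentric coordinates. -/
def ofSimplex {σ : Finset Γ.V} (hσ : σ ∈ Γ.complex.faces) (t : stdSimplex ℝ σ) : Γ.Realization := by
  classical
  let f : Γ.V →₀ ℝ := Finsupp.onFinset σ (fun v => if h : v ∈ σ then t.1 ⟨v, h⟩ else 0)
    (fun v hv => by by_contra h; exact hv (dif_neg h))
  have hsub : f.support ⊆ σ := Finsupp.support_onFinset_subset
  have hsum : (f.sum fun _ a => a) = 1 := by
    rw [Finsupp.sum_of_support_subset f hsub _ fun _ _ => rfl, ← Finset.sum_coe_sort, ← t.2.2]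
    exact Finset.sum_congr rfl fun v _ => dif_pos v.2
  refine ⟨f, fun v => ?_, hsum, mem_faces_of_subset hσ hsub ?_⟩
  · show 0 ≤ (if h : v ∈ σ then t.1 ⟨v, h⟩ else 0)
    split_ifs with h
    · exact t.2.1 _
    · exact le_rfl
  · rw [Finset.nonempty_iff_ne_empty]
    intro h0
    rw [Finsupp.sum, h0] at hsum
    simp at hsum

theorem ofSimplex_apply {σ : Finset Γ.V} (hσ : σ ∈ Γ.complex.faces) (t : stdSimplex ℝ σ) (v : σ) :
    (ofSimplex hσ t).1 v = t.1 v := dif_pos v.2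

theorem ofSimplex_mem_cell {σ : Finset Γ.V} (hσ : σ ∈ Γ.complex.faces) (t : stdSimplex ℝ σ) :
    ofSimplex hσ t ∈ Γ.cell σ := fun v hv => by
  classical
  by_contra h
  exact Finsupp.mem_support_iff.mp hv (dif_neg h)

theorem l1_eq_sum_cell {σ : Finset Γ.V} {x y : Γ.Realization} (hx : x ∈ Γ.cell σ)
    (hy : y ∈ Γ.cell σ) : Γ.l1 x y = ∑ v ∈ σ, |x.1 v - y.1 v| := by
  classical
  exact nrm_eq_sum (Finsupp.support_sub.trans (Finset.union_subset hx hy))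

theorem continuous_ofSimplex {σ : Finset Γ.V} (hσ : σ ∈ Γ.complex.faces) :
    Continuous (ofSimplex hσ) := by
  refine ⟨fun U hU => isOpen_iff_mem_nhds.mpr fun t ht => ?_⟩
  obtain ⟨ε, hε, h⟩ := isOpen_iff.mp hU σ hσ _ (ofSimplex_mem_cell hσ t) ht
  have hcont : Continuous fun s : stdSimplex ℝ σ => ∑ v : σ, |t.1 v - s.1 v| := by
    refine continuous_finsetSum _ fun v _ => ((continuous_const.sub ?_)).abs
    exact (continuous_apply v).comp continuous_subtype_val
  have h0 : ∑ v : σ, |t.1 v - t.1 v| < ε := by simpa using hε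
  filter_upwards [(isOpen_lt hcont continuous_const).mem_nhds h0] with s hs
  refine h _ (ofSimplex_mem_cell hσ s) ?_
  rw [l1_eq_sum_cell (ofSimplex_mem_cell hσ t) (ofSimplex_mem_cell hσ s), ← Finset.sum_coe_sort]
  simpa only [ofSimplex_apply] using hs

theorem range_ofSimplex {σ : Finset Γ.V} (hσ : σ ∈ Γ.complex.faces) :
    Set.range (ofSimplex hσ) = Γ.cell σ := by
  refine Set.Subset.antisymm ?_ fun x hx => ?_
  · rintro _ ⟨t, rfl⟩; exact ofSimplex_mem_cell hσ t
  · refine ⟨⟨fun v => x.1 v, fun v => x.2.1 v, ?_⟩, Subtype.ext (Finsupp.ext fun v => ?_)⟩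
    · exact (Finset.sum_coe_sort σ _).trans (sum_eq_one hx)
    · by_cases hv : v ∈ σ
      · exact ofSimplex_apply hσ _ ⟨v, hv⟩
      · rw [Finsupp.notMem_support_iff.mp fun h => hv (hx h),
          Finsupp.notMem_support_iff.mp fun h => hv (ofSimplex_mem_cell hσ _ h)]

theorem isCompact_cell {σ : Finset Γ.V} (hσ : σ ∈ Γ.complex.faces) : IsCompact (Γ.cell σ) := by
  have : CompactSpace (stdSimplex ℝ σ) := isCompact_iff_compactSpace.mp (isCompact_stdSimplex ℝ σ)
  rw [← range_ofSimplex hσ]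
  exact isCompact_range (continuous_ofSimplex hσ)

theorem isPreconnected_cell {σ : Finset Γ.V} (hσ : σ ∈ Γ.complex.faces) :
    IsPreconnected (Γ.cell σ) := by
  have : PreconnectedSpace (stdSimplex ℝ σ) :=
    Subtype.preconnectedSpace (convex_stdSimplex ℝ σ).isPreconnected
  rw [← range_ofSimplex hσ]
  exact isPreconnected_range (continuous_ofSimplex hσ)

theorem support_mem_cell (x : Γ.Realization) : x ∈ Γ.cell x.1.support :=
  subset_refl x.1.support

/-- The faces containing a vertex of a given finite set. -/
theorem IsLocallyFinite.finite_faces (hlf : Γ.IsLocallyFinite) (F : Finset Γ.V) :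
    {σ ∈ Γ.complex.faces | ∃ v ∈ F, v ∈ σ}.Finite := by
  classical
  have hfin : (⋃ v ∈ F, {u | ∃ σ ∈ Γ.complex.faces, u ∈ σ ∧ v ∈ σ}).Finite :=
    F.finite_toSet.biUnion fun v _ => hlf v
  refine (Finset.finite_toSet (hfin.toFinset.powerset)).subset ?_
  rintro σ ⟨hσ, v, hv, hvσ⟩
  rw [Finset.mem_coe, Finset.mem_powerset]
  intro u hu
  rw [Set.Finite.mem_toFinset]
  exact Set.mem_biUnion hv ⟨σ, hσ, hu, hvσ⟩

theorem IsLocallyFinite.isCompact_star (hlf : Γ.IsLocallyFinite) (F : Finset Γ.V) :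
    IsCompact (⋃ σ ∈ {σ ∈ Γ.complex.faces | ∃ v ∈ F, v ∈ σ}, Γ.cell σ) :=
  (hlf.finite_faces F).isCompact_biUnion fun _ hσ => isCompact_cell hσ.1

theorem IsLocallyFinite.proper (hlf : Γ.IsLocallyFinite)
    (hst : ∀ u v : Γ.V, {g : G | u <• g = v}.Finite) :
    ProperlyDiscontinuousSMul Gᵐᵒᵖ Γ.Realization := by
  refine ⟨fun {K L} hK hL => ?_⟩
  obtain ⟨F, hF⟩ := exists_finset_star hK
  obtain ⟨F', hF'⟩ := exists_finset_star hL
  have hfin : (⋃ u ∈ F, ⋃ v ∈ F', ⋃ w ∈ {u | ∃ σ ∈ Γ.complex.faces, u ∈ σ ∧ v ∈ σ},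
      {g : G | u <• g = w}).Finite :=
    F.finite_toSet.biUnion fun u _ => F'.finite_toSet.biUnion fun v _ =>
      (hlf v).biUnion fun w _ => hst u w
  refine (hfin.image op).subset ?_
  rintro g ⟨_, ⟨x, hx, rfl⟩, hx'⟩
  obtain ⟨u, hu, hxu⟩ := hF x hx
  obtain ⟨v, hv, hxv⟩ := hF' _ hx'
  refine ⟨g.unop, ?_, rfl⟩
  simp only [Set.mem_iUnion]
  refine ⟨u, hu, v, hv, u <• g.unop, ⟨_, (g • x).2.2.2, ?_, pos_iff.mp hxv⟩, rfl⟩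
  rw [← pos_iff]
  have := rsmul_apply_rsmul x g.unop u
  exact this.symm ▸ hxu

theorem IsLocallyFinite.cocompact (hlf : Γ.IsLocallyFinite) {F : Finset Γ.V}
    (hF : ∀ v : Γ.V, ∃ g : G, v <• g ∈ F) : Γ.IsCocompact := by
  refine ⟨_, hlf.isCompact_star F, fun x => ?_⟩
  obtain ⟨v, hv⟩ := support_nonempty x
  obtain ⟨g, hg⟩ := hF v
  refine ⟨g, Set.mem_biUnion (x := (x <• g).1.support) ⟨(x <• g).2.2.2, v <• g, hg, ?_⟩
    (support_mem_cell _)⟩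
  rw [← pos_iff, rsmul_apply_rsmul, pos_iff]
  exact hv

/-- A distance that dominates `ℓ¹` and agrees with it on simplices induces the coherent topology
when the complex is locally finite. This serves both metrics constructed later. -/
theorem IsLocallyFinite.isMetric (hlf : Γ.IsLocallyFinite) {δ : Γ.Realization → Γ.Realization → ℝ}
    (hle : ∀ x y, Γ.l1 x y ≤ δ x y)
    (heq : ∀ σ ∈ Γ.complex.faces, ∀ x ∈ Γ.cell σ, ∀ y ∈ Γ.cell σ, δ x y = Γ.l1 x y)
    (hsymm : ∀ x y, δ x y = δ y x) (htri : ∀ x y z, δ x z ≤ δ x y + δ y z) : IsMetric δ where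
  symm := hsymm
  triangle := htri
  eq_zero_iff x y := by
    constructor
    · exact fun h => eq_of_l1_eq_zero (le_antisymm ((hle x y).trans h.le) (l1_nonneg _ _))
    · rintro rfl
      rw [heq _ x.2.2.2 x (support_mem_cell x) x (support_mem_cell x), l1_self]
  isOpen_iff U := by
    constructor
    · intro hU x hx
      have hfin := hlf.finite_faces x.1.support
      have h1 : ∀ σ : Finset Γ.V, ∃ ε > 0, σ ∈ Γ.complex.faces → x ∈ Γ.cell σ →
          ∀ y ∈ Γ.cell σ, Γ.l1 x y < ε → y ∈ U := fun σ => by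
        by_cases h : σ ∈ Γ.complex.faces ∧ x ∈ Γ.cell σ
        · obtain ⟨ε, hε, h'⟩ := isOpen_iff.mp hU σ h.1 x h.2 hx
          exact ⟨ε, hε, fun _ _ => h'⟩
        · exact ⟨1, one_pos, fun h1 h2 => absurd ⟨h1, h2⟩ h⟩
      choose ε hε h1 using h1
      obtain ⟨ε₁, hε₁, h2⟩ : ∃ ε₁ > 0, ∀ σ ∈ hfin.toFinset, ε₁ ≤ ε σ := by
        by_cases hne : hfin.toFinset.Nonempty
        · exact ⟨hfin.toFinset.inf' hne ε, (Finset.lt_inf'_iff hne).mpr fun σ _ => hε σ,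
            fun σ hσ => Finset.inf'_le ε hσ⟩
        · rw [Finset.not_nonempty_iff_eq_empty] at hne
          exact ⟨1, one_pos, fun σ hσ => absurd (hne ▸ hσ) (Finset.notMem_empty σ)⟩
      -- A point closer to `x` than the smallest positive coordinate of `x` has a support containing
      -- that of `x`. It lies in one of the finitely many simplices for which `ε₁` was chosen.
      refine ⟨min ε₁ (x.1.support.inf' (support_nonempty x) x.1),
        lt_min hε₁ ((Finset.lt_inf'_iff _).mpr fun v hv => pos_iff.mpr hv), fun y hy => ?_⟩
      have hxy := (hle x y).trans_lt hy
      have hsub : x.1.support ⊆ y.1.support := by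
        intro v hv
        rw [← pos_iff]
        have h3 := (hxy.trans_le (min_le_right _ _)).trans_le (Finset.inf'_le x.1 hv)
        have h4 := (le_abs_self _).trans_lt ((abs_sub_le_l1 x y v).trans_lt h3)
        linarith
      refine h1 y.1.support y.2.2.2 hsub y (support_mem_cell y)
        ((hxy.trans_le (min_le_left _ _)).trans_le (h2 _ ?_))
      rw [Set.Finite.mem_toFinset]
      obtain ⟨v, hv⟩ := support_nonempty x
      exact ⟨y.2.2.2, v, hv, hsub hv⟩
    · intro h
      refine isOpen_iff.mpr fun σ hσ x hx hxU => ?_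
      obtain ⟨ε, hε, h'⟩ := h x hxU
      exact ⟨ε, hε, fun y hy hxy => h' y (by rwa [heq σ hσ x hx y hy])⟩

/-- A compact subset meets the relative interiors of finitely many simplices. -/
theorem finite_supports_of_isCompact {K : Set Γ.Realization} (hK : IsCompact K) :
    ((fun x : Γ.Realization => x.1.support) '' K).Finite := by
  classical
  set S := (fun x : Γ.Realization => x.1.support) '' K
  have hS : ∀ σ : S, ∃ x ∈ K, x.1.support = σ.1 := fun σ => σ.2
  choose p hpK hp using hS
  -- One point is chosen over each support that occurs. Every subset of the chosen points is closed,
  -- since a closed simplex contains only finitely many of them; so a compact set can contain only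
  -- finitely many.
  have hopen : ∀ Q : Set S, IsOpen {x | ∀ τ ∈ Q, x ≠ p τ} := by
    intro Q
    refine isOpen_iff.mpr fun σ _ x _ hx => ?_
    have hfin : {τ : S | τ ∈ Q ∧ τ.1 ⊆ σ}.Finite := by
      refine Set.Finite.of_finite_image (f := Subtype.val)
        ((Finset.finite_toSet σ.powerset).subset ?_) Subtype.val_injective.injOn
      rintro _ ⟨τ, hτ, rfl⟩
      simpa using hτ.2
    obtain ⟨ε, hε, h⟩ : ∃ ε > 0, ∀ τ ∈ hfin.toFinset, ε ≤ Γ.l1 x (p τ) := by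
      by_cases hne : hfin.toFinset.Nonempty
      · refine ⟨hfin.toFinset.inf' hne fun τ => Γ.l1 x (p τ), (Finset.lt_inf'_iff hne).mpr
          fun τ hτ => lt_of_le_of_ne (l1_nonneg _ _) fun h => ?_,
            fun τ hτ => Finset.inf'_le (fun τ => Γ.l1 x (p τ)) hτ⟩
        exact hx τ (hfin.mem_toFinset.mp hτ).1 (eq_of_l1_eq_zero h.symm)
      · rw [Finset.not_nonempty_iff_eq_empty] at hne
        exact ⟨1, one_pos, fun σ hσ => absurd (hne ▸ hσ) (Finset.notMem_empty σ)⟩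
    refine ⟨ε, hε, fun y hy hxy τ hτ e => ?_⟩
    subst e
    exact absurd hxy (not_lt.mpr (h τ (hfin.mem_toFinset.mpr ⟨hτ, (hp τ) ▸ hy⟩)))
  obtain ⟨t, ht⟩ := hK.elim_finite_subcover (fun σ : S => {x | ∀ τ ∈ {τ | τ ≠ σ}, x ≠ p τ})
    (fun σ => hopen _) fun x hx => by
      refine Set.mem_iUnion.mpr ⟨⟨x.1.support, x, hx, rfl⟩, fun τ hτ e => hτ (Subtype.ext ?_)⟩
      exact (hp τ).symm.trans (congrArg (fun y : Γ.Realization => y.1.support) e.symm)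
  refine (t.finite_toSet.image Subtype.val).subset fun σ hσ => ?_
  obtain ⟨τ, hτ, h⟩ := Set.mem_iUnion₂.mp (ht (hpK ⟨σ, hσ⟩))
  refine ⟨τ, hτ, ?_⟩
  by_contra hne
  exact h ⟨σ, hσ⟩ (fun e => hne (congrArg Subtype.val e).symm) rfl

/-- A compact subset is contained in a finite subcomplex. -/
theorem exists_finset_support {K : Set Γ.Realization} (hK : IsCompact K) :
    ∃ F : Finset Γ.V, ∀ x ∈ K, x.1.support ⊆ F := by
  classical
  refine ⟨(finite_supports_of_isCompact hK).toFinset.biUnion id, fun x hx => ?_⟩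
  refine Finset.subset_biUnion_of_mem id ?_
  rw [Set.Finite.mem_toFinset]
  exact ⟨x, hx, rfl⟩

theorem IsChain.trans {x y z : Γ.Realization} {r s : ℝ} (h : Γ.IsChain x y r)
    (h' : Γ.IsChain y z s) : Γ.IsChain x z (r + s) := by
  induction h with
  | refl => rwa [zero_add]
  | step σ hσ hx hy _ ih => rw [add_assoc]; exact IsChain.step σ hσ hx hy (ih h')

theorem IsChain.single {σ : Finset Γ.V} (hσ : σ ∈ Γ.complex.faces) {x y : Γ.Realization}
    (hx : x ∈ Γ.cell σ) (hy : y ∈ Γ.cell σ) : Γ.IsChain x y (Γ.l1 x y) := by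
  have := IsChain.step σ hσ hx hy (IsChain.refl y)
  rwa [add_zero] at this

theorem IsChain.symm {x y : Γ.Realization} {r : ℝ} (h : Γ.IsChain x y r) : Γ.IsChain y x r := by
  induction h with
  | refl => exact IsChain.refl _
  | @step x y z r σ hσ hx hy _ ih =>
    rw [add_comm, l1_comm]
    exact ih.trans (IsChain.single hσ hy hx)

theorem IsChain.l1_le {x y : Γ.Realization} {r : ℝ} (h : Γ.IsChain x y r) : Γ.l1 x y ≤ r := by
  induction h with
  | refl => exact (l1_self _).le
  | @step x y z r σ hσ hx hy _ ih =>
    have := l1_triangle x y z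
    linarith

theorem IsChain.rsmul {x y : Γ.Realization} {r : ℝ} (h : Γ.IsChain x y r) (g : G) :
    Γ.IsChain (x <• g) (y <• g) r := by
  induction h with
  | refl => exact IsChain.refl _
  | @step x y z r σ hσ hx hy _ ih =>
    rw [← l1_rsmul g x y]
    have : ∀ w ∈ Γ.cell σ, w <• g ∈ Γ.cell (σ.map (MulAction.toPerm (op g)).toEmbedding) := by
      intro w hw v hv
      rw [mem_support_rsmul] at hv
      refine Finset.mem_map.mpr ⟨_, hw hv, ?_⟩
      show (v <• g⁻¹) <• g = v
      rw [rsmul_rsmul, inv_mul_cancel, rsmul_one]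
    exact IsChain.step _ (Γ.map_mem g σ hσ) (this x hx) (this y hy) ih

/-- A map which does not increase `ℓ¹`-distances inside of simplices maps chains to chains. -/
theorem IsChain.map {f : Γ.Realization → Γ.Realization} {c : ℝ}
    (hf : ∀ σ ∈ Γ.complex.faces, ∃ τ ∈ Γ.complex.faces, ∀ x ∈ Γ.cell σ, f x ∈ Γ.cell τ)
    (hc : ∀ σ ∈ Γ.complex.faces, ∀ x ∈ Γ.cell σ, ∀ y ∈ Γ.cell σ,
      Γ.l1 (f x) (f y) ≤ c * Γ.l1 x y) {x y : Γ.Realization} {r : ℝ} (h : Γ.IsChain x y r) :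
    ∃ s ≤ c * r, Γ.IsChain (f x) (f y) s := by
  induction h with
  | refl => exact ⟨0, by simp, IsChain.refl _⟩
  | @step x y z r σ hσ hx hy _ ih =>
    obtain ⟨s, hs, h⟩ := ih
    obtain ⟨τ, hτ, h'⟩ := hf σ hσ
    refine ⟨_, ?_, IsChain.step τ hτ (h' x hx) (h' y hy) h⟩
    rw [mul_add]
    exact add_le_add (hc σ hσ x hx y hy) hs

/-! ### The length distance. -/

/-- The length pseudo-distance. -/
def len (Γ : GComplex G) (x y : Γ.Realization) : ℝ := sInf {r | Γ.IsChain x y r}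

theorem bddBelow_isChain (x y : Γ.Realization) : BddBelow {r | Γ.IsChain x y r} :=
  ⟨0, fun _ h => (l1_nonneg x y).trans (IsChain.l1_le h)⟩

section Length

variable (hconn : ∀ x y : Γ.Realization, ∃ r, Γ.IsChain x y r)

include hconn

theorem isGLB_len (x y : Γ.Realization) : IsGLB {r | Γ.IsChain x y r} (Γ.len x y) :=
  isGLB_csInf (hconn x y) (bddBelow_isChain x y)

theorem l1_le_len (x y : Γ.Realization) : Γ.l1 x y ≤ Γ.len x y :=
  (isGLB_len hconn x y).2 fun _ h => IsChain.l1_le h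

theorem len_eq_l1 {σ : Finset Γ.V} (hσ : σ ∈ Γ.complex.faces) {x y : Γ.Realization}
    (hx : x ∈ Γ.cell σ) (hy : y ∈ Γ.cell σ) : Γ.len x y = Γ.l1 x y :=
  le_antisymm ((isGLB_len hconn x y).1 (IsChain.single hσ hx hy)) (l1_le_len hconn x y)

theorem len_triangle (x y z : Γ.Realization) : Γ.len x z ≤ Γ.len x y + Γ.len y z := by
  rw [← sub_le_iff_le_add']
  refine (isGLB_len hconn y z).2 fun s hs => ?_
  rw [sub_le_iff_le_add', ← sub_le_iff_le_add]
  refine (isGLB_len hconn x y).2 fun r hr => ?_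
  rw [sub_le_iff_le_add]
  exact (isGLB_len hconn x z).1 (IsChain.trans hr hs)

theorem len_map_le {f : Γ.Realization → Γ.Realization} {c : ℝ} (hc0 : 0 < c)
    (hf : ∀ σ ∈ Γ.complex.faces, ∃ τ ∈ Γ.complex.faces, ∀ x ∈ Γ.cell σ, f x ∈ Γ.cell τ)
    (hc : ∀ σ ∈ Γ.complex.faces, ∀ x ∈ Γ.cell σ, ∀ y ∈ Γ.cell σ,
      Γ.l1 (f x) (f y) ≤ c * Γ.l1 x y) (x y : Γ.Realization) :
    Γ.len (f x) (f y) ≤ c * Γ.len x y := by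
  rw [← inv_mul_le_iff₀ hc0]
  refine (isGLB_len hconn x y).2 fun r hr => ?_
  obtain ⟨s, hs, h⟩ := IsChain.map hf hc hr
  rw [inv_mul_le_iff₀ hc0]
  exact ((isGLB_len hconn _ _).1 h).trans hs

theorem connectedSpace_of_chains [Nonempty Γ.Realization] : ConnectedSpace Γ.Realization := by
  obtain ⟨x₀⟩ := ‹Nonempty Γ.Realization›
  refine connectedSpace_iff_connectedComponent.mpr ⟨x₀, Set.eq_univ_of_forall fun y => ?_⟩
  obtain ⟨r, h⟩ := hconn y x₀
  induction h with
  | refl => exact mem_connectedComponent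
  | @step x y z r σ hσ hx hy _ ih =>
    have := (isPreconnected_cell hσ).subset_connectedComponent hy hx
    rwa [← connectedComponent_eq ih] at this

end Length

theorem len_comm (x y : Γ.Realization) : Γ.len x y = Γ.len y x := by
  refine congrArg sInf (Set.ext fun r => ⟨fun h => IsChain.symm h, fun h => IsChain.symm h⟩)

theorem len_rsmul (g : G) (x y : Γ.Realization) : Γ.len (x <• g) (y <• g) = Γ.len x y := by
  refine congrArg sInf (Set.ext fun r => ⟨fun h => ?_, fun h => IsChain.rsmul h g⟩)
  have := IsChain.rsmul h g⁻¹
  rwa [rsmul_rsmul, rsmul_rsmul, mul_inv_cancel, rsmul_one, rsmul_one] at this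

/-! ### Maps that are affine on simplices. -/

/-- Vertex maps with values in the realization that extend affinely to simplices. -/
def IsVertexMap (F : Γ.V → Γ.Realization) : Prop :=
  ∀ σ ∈ Γ.complex.faces, ∃ τ ∈ Γ.complex.faces, ∀ v ∈ σ, F v ∈ Γ.cell τ

/-- The linear map extending a map defined on the vertices. -/
def linearExt (F : Γ.V → Γ.Realization) : (Γ.V →₀ ℝ) →ₗ[ℝ] (Γ.V →₀ ℝ) :=
  Finsupp.linearCombination ℝ fun v => (F v).1

theorem linearExt_apply (F : Γ.V → Γ.Realization) {f : Γ.V →₀ ℝ} {s : Finset Γ.V}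
    (h : f.support ⊆ s) : linearExt F f = ∑ v ∈ s, f v • (F v).1 :=
  Finsupp.sum_of_support_subset f h _ fun _ _ => zero_smul _ _

theorem support_linearExt {F : Γ.V → Γ.Realization} {f : Γ.V →₀ ℝ} {τ : Finset Γ.V}
    (h : ∀ v ∈ f.support, F v ∈ Γ.cell τ) : (linearExt F f).support ⊆ τ := by
  rw [linearExt_apply F subset_rfl]
  intro w hw
  by_contra hwτ
  refine Finsupp.mem_support_iff.mp hw ?_
  rw [Finsupp.finsetSum_apply]
  refine Finset.sum_eq_zero fun v hv => ?_
  rw [Finsupp.smul_apply, Finsupp.notMem_support_iff.mp fun h' => hwτ (h v hv h'), smul_zero]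

/-- The map of the realization that is affine on simplices and has given values on vertices. -/
def affineExt (F : Γ.V → Γ.Realization) (hF : Γ.IsVertexMap F) (x : Γ.Realization) :
    Γ.Realization := by
  have hsum : ((linearExt F x.1).sum fun _ a => a) = 1 := by
    classical
    rw [linearExt_apply F subset_rfl]
    rw [← Finsupp.sum_finsetSum_index (fun _ => rfl) fun _ _ _ => rfl]
    have : ∀ v ∈ x.1.support, ((x.1 v • (F v).1).sum fun _ a => a) = x.1 v := fun v _ => by
      rw [Finsupp.sum_smul_index fun _ => rfl, ← Finsupp.mul_sum, (F v).2.2.1, mul_one]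
    rw [Finset.sum_congr rfl this]
    exact x.2.2.1
  refine ⟨linearExt F x.1, fun w => ?_, hsum, ?_⟩
  · rw [linearExt_apply F subset_rfl, Finsupp.finsetSum_apply]
    exact Finset.sum_nonneg fun v _ => mul_nonneg (x.2.1 v) ((F v).2.1 w)
  · have hτ := (hF _ x.2.2.2).choose_spec
    refine mem_faces_of_subset hτ.1 (support_linearExt hτ.2) ?_
    rw [Finset.nonempty_iff_ne_empty]
    intro h0
    rw [Finsupp.sum, h0] at hsum
    simp at hsum

theorem affineExt_val {F : Γ.V → Γ.Realization} (hF : Γ.IsVertexMap F) (x : Γ.Realization) :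
    (affineExt F hF x).1 = linearExt F x.1 := rfl

theorem affineExt_mem_cell {F : Γ.V → Γ.Realization} (hF : Γ.IsVertexMap F) {x : Γ.Realization}
    {τ : Finset Γ.V} (h : ∀ v ∈ x.1.support, F v ∈ Γ.cell τ) : affineExt F hF x ∈ Γ.cell τ :=
  support_linearExt h

theorem exists_of_mem_support_affineExt {F : Γ.V → Γ.Realization} (hF : Γ.IsVertexMap F)
    {x : Γ.Realization} {w : Γ.V} (h : w ∈ (affineExt F hF x).1.support) :
    ∃ v ∈ x.1.support, w ∈ (F v).1.support := by
  classical
  have := affineExt_mem_cell hF (x := x) (τ := x.1.support.biUnion fun v => (F v).1.support)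
    (fun v hv => Finset.subset_biUnion_of_mem (fun v => (F v).1.support) hv) h
  simpa using this

/-- Distinct vertices are at distance `2`, so the hypothesis is a Lipschitz condition on vertices,
and `nrm_combination_le` extends it to the simplex. -/
theorem l1_affineExt_le {F : Γ.V → Γ.Realization} (hF : Γ.IsVertexMap F) {c : ℝ}
    {σ : Finset Γ.V} (hc : ∀ u ∈ σ, ∀ v ∈ σ, Γ.l1 (F u) (F v) ≤ 2 * c)
    {x y : Γ.Realization} (hx : x ∈ Γ.cell σ) (hy : y ∈ Γ.cell σ) :
    Γ.l1 (affineExt F hF x) (affineExt F hF y) ≤ c * Γ.l1 x y := by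
  rw [l1_eq_sum_cell hx hy, l1_eq, affineExt_val, affineExt_val, ← map_sub]
  classical
  rw [linearExt_apply F (Finsupp.support_sub.trans (Finset.union_subset hx hy))]
  refine nrm_combination_le ?_ hc
  simp only [Finsupp.sub_apply]
  rw [Finset.sum_sub_distrib, sum_eq_one hx, sum_eq_one hy, sub_self]

theorem exists_cell_affineExt {F : Γ.V → Γ.Realization} (hF : Γ.IsVertexMap F) {σ : Finset Γ.V}
    (hσ : σ ∈ Γ.complex.faces) :
    ∃ τ ∈ Γ.complex.faces, ∀ x ∈ Γ.cell σ, affineExt F hF x ∈ Γ.cell τ := by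
  obtain ⟨τ, hτ, h⟩ := hF σ hσ
  exact ⟨τ, hτ, fun x hx => affineExt_mem_cell hF fun v hv => h v (hx hv)⟩

theorem continuous_of_l1_le {f : Γ.Realization → Γ.Realization}
    (hf : ∀ σ ∈ Γ.complex.faces, ∃ τ ∈ Γ.complex.faces, ∀ x ∈ Γ.cell σ, f x ∈ Γ.cell τ)
    (hc : ∀ σ ∈ Γ.complex.faces, ∀ x ∈ Γ.cell σ, ∀ y ∈ Γ.cell σ, Γ.l1 (f x) (f y) ≤ Γ.l1 x y) :
    Continuous f := by
  refine ⟨fun U hU => isOpen_iff.mpr fun σ hσ x hx hxU => ?_⟩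
  obtain ⟨τ, hτ, h⟩ := hf σ hσ
  obtain ⟨ε, hε, h'⟩ := isOpen_iff.mp hU τ hτ _ (h x hx) hxU
  exact ⟨ε, hε, fun y hy hxy => h' _ (h y hy) ((hc σ hσ x hx y hy).trans_lt hxy)⟩

theorem isPiecewiseAffine_affineExt {F : Γ.V → Γ.Realization} (hF : Γ.IsVertexMap F) :
    Γ.IsPiecewiseAffine (affineExt F hF) := by
  classical
  intro σ _
  refine ⟨1, fun _ => σ.image fun v => Finsupp.single v 1, fun _ => (linearExt F).toAffineMap,
    fun x hx => ⟨⟨0, ?_⟩, fun _ _ => rfl⟩⟩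
  have hxs : x.1 = ∑ v ∈ σ, x.1 v • Finsupp.single v (1 : ℝ) := by
    conv_lhs => rw [← Finsupp.sum_single x.1]
    rw [Finsupp.sum_of_support_subset x.1 hx _ fun _ _ => Finsupp.single_zero _]
    exact Finset.sum_congr rfl fun v _ => by simp
  rw [hxs]
  refine (convex_convexHull ℝ _).sum_mem (fun v _ => x.2.1 v) (sum_eq_one hx) fun v hv => ?_
  exact subset_convexHull ℝ _ (Finset.mem_coe.mpr (Finset.mem_image_of_mem _ hv))

end GComplex

end SelfSimilar

end

noncomputable section

namespace SelfSimilar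

/-! ### Consequences of a proper co-compact action: local finiteness and completeness. -/

namespace GComplex

variable {G : Type u} [Group G] {Γ : GComplex G}

/-- The barycenter of a simplex. -/
def bary {σ : Finset Γ.V} (hσ : σ ∈ Γ.complex.faces) : Γ.Realization :=
  ofSimplex hσ ⟨fun _ => (σ.card : ℝ)⁻¹, fun _ => by positivity, by
    have : (σ.card : ℝ) ≠ 0 :=
      Nat.cast_ne_zero.mpr (Γ.complex.isRelLowerSet_faces hσ).1.card_ne_zero
    simp [this]⟩

theorem bary_apply {σ : Finset Γ.V} (hσ : σ ∈ Γ.complex.faces) {v : Γ.V} (hv : v ∈ σ) :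
    (bary hσ).1 v = (σ.card : ℝ)⁻¹ := ofSimplex_apply hσ _ ⟨v, hv⟩

theorem support_bary {σ : Finset Γ.V} (hσ : σ ∈ Γ.complex.faces) : (bary hσ).1.support = σ := by
  refine Finset.Subset.antisymm (ofSimplex_mem_cell hσ _) fun v hv => ?_
  rw [Finsupp.mem_support_iff, bary_apply hσ hv]
  exact inv_ne_zero (Nat.cast_ne_zero.mpr (Finset.card_ne_zero_of_mem hv))

theorem finite_vertex_transporter (h : ProperlyDiscontinuousSMul Gᵐᵒᵖ Γ.Realization)
    (u v : Γ.V) : {g : G | u <• g = v}.Finite := by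
  have := h.finite_disjoint_inter_image (isCompact_singleton (x := (vertex u : Γ.Realization)))
    (isCompact_singleton (x := vertex v))
  refine (this.image MulOpposite.unop).subset ?_
  rintro g rfl
  exact ⟨op g, ⟨_, ⟨_, rfl, rfl⟩, vertex_rsmul u g⟩, rfl⟩

/-- The barycenter of a simplex has full support, so moving it into `C` moves all vertices of the
simplex into a finite set `F`. By properness only finitely many `g` move `v` into `F`. -/
theorem IsCocompact.isLocallyFinite (hc : Γ.IsCocompact)
    (h : ProperlyDiscontinuousSMul Gᵐᵒᵖ Γ.Realization) : Γ.IsLocallyFinite := by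
  obtain ⟨C, hC, hcov⟩ := hc
  obtain ⟨F, hF⟩ := exists_finset_support hC
  intro v
  have hfin : (⋃ w ∈ F, {g : G | v <• g = w}).Finite :=
    F.finite_toSet.biUnion fun w _ => finite_vertex_transporter h v w
  refine (Set.Finite.image2 (fun (w : Γ.V) (g : G) => w <• g⁻¹) F.finite_toSet hfin).subset ?_
  rintro u ⟨σ, hσ, hu, hv⟩
  obtain ⟨g, hg⟩ := hcov (bary hσ)
  have key : ∀ w ∈ σ, w <• g ∈ F := fun w hw => by
    refine hF _ hg ?_
    rw [mem_support_rsmul, rsmul_rsmul, mul_inv_cancel, rsmul_one, support_bary]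
    exact hw
  refine ⟨u <• g, key u hu, g, Set.mem_biUnion (key v hv) rfl, ?_⟩
  show (u <• g) <• g⁻¹ = u
  rw [rsmul_rsmul, mul_inv_cancel, rsmul_one]

theorem continuous_rsmul (g : G) : Continuous fun x : Γ.Realization => x <• g := by
  refine continuous_of_l1_le (fun σ hσ => ⟨_, Γ.map_mem g σ hσ, fun x hx v hv => ?_⟩)
    fun σ _ x _ y _ => (l1_rsmul g x y).le
  rw [mem_support_rsmul] at hv
  refine Finset.mem_map.mpr ⟨_, hx hv, ?_⟩
  show (v <• g⁻¹) <• g = v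
  rw [rsmul_rsmul, inv_mul_cancel, rsmul_one]

end GComplex

/-- The metric space structure with the given distance function. -/
abbrev IsMetric.metricSpace {T : Type u} [TopologicalSpace T] {δ : T → T → ℝ} (h : IsMetric δ) :
    MetricSpace T :=
  MetricSpace.ofDistTopology δ (fun x => (h.eq_zero_iff x x).mpr rfl) h.symm h.triangle
    h.isOpen_iff fun x y => (h.eq_zero_iff x y).mp

/-- Some `ε`-neighbourhood of `C` lies in a finite union of stars, hence in a compact set. A tail of
a Cauchy sequence is moved into that set by a single isometry `g`. -/
theorem GComplex.completeSpace {G : Type u} [Group G] {Γ : GComplex G} (hc : Γ.IsCocompact)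
    (h : ProperlyDiscontinuousSMul Gᵐᵒᵖ Γ.Realization)
    {δ : Γ.Realization → Γ.Realization → ℝ} (hδ : IsMetric δ)
    (hiso : ∀ (g : G) x y, δ (x <• g) (y <• g) = δ x y) :
    letI := hδ.metricSpace
    CompleteSpace Γ.Realization := by
  let := hδ.metricSpace
  have hlf := hc.isLocallyFinite h
  obtain ⟨C, hC, hcov⟩ := hc
  obtain ⟨F, hF⟩ := exists_finset_star hC
  have hO : IsOpen (⋃ v ∈ F, {x : Γ.Realization | 0 < x.1 v}) :=
    isOpen_biUnion fun v _ => isOpen_star v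
  obtain ⟨ε, hε, hsub⟩ := hC.exists_thickening_subset_open hO fun x hx => by
    obtain ⟨v, hv, hxv⟩ := hF x hx
    exact Set.mem_biUnion hv hxv
  have hK := hlf.isCompact_star F
  refine Metric.complete_of_cauchySeq_tendsto fun u hu => ?_
  obtain ⟨n, hn⟩ := Metric.cauchySeq_iff'.mp hu ε hε
  obtain ⟨g, hg⟩ := hcov (u n)
  have hmem : ∀ k, u (k + n) <• g ∈ ⋃ σ ∈ {σ ∈ Γ.complex.faces | ∃ v ∈ F, v ∈ σ}, Γ.cell σ := by
    intro k
    have h1 : u (k + n) <• g ∈ Metric.thickening ε C := by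
      refine Metric.mem_thickening_iff.mpr ⟨_, hg, ?_⟩
      exact (hiso g _ _).trans_lt (hn (k + n) (Nat.le_add_left n k))
    obtain ⟨v, hv, hv'⟩ := Set.mem_iUnion₂.mp (hsub h1)
    exact Set.mem_biUnion (x := (u (k + n) <• g).1.support)
      ⟨(u (k + n) <• g).2.2.2, v, hv, pos_iff.mp hv'⟩ (support_mem_cell _)
  have hcau : CauchySeq fun k => u (k + n) <• g := by
    refine Metric.cauchySeq_iff'.mpr fun ε' hε' => ?_
    obtain ⟨j, hj⟩ := Metric.cauchySeq_iff.mp hu ε' hε'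
    exact ⟨j, fun i hi => (hiso g _ _).trans_lt (hj _ (by omega) _ (by omega))⟩
  obtain ⟨a, -, ha⟩ := cauchySeq_tendsto_of_isComplete hK.isComplete hmem hcau
  refine ⟨a <• g⁻¹, (Filter.tendsto_add_atTop_iff_nat n).mp ?_⟩
  have := ((continuous_rsmul (Γ := Γ) g⁻¹).tendsto a).comp ha
  refine this.congr fun k => ?_
  show (u (k + n) <• g) <• g⁻¹ = u (k + n)
  rw [rsmul_rsmul, mul_inv_cancel, rsmul_one]

/-! ### From an affine model to a bound on dimension. -/

section ModelToDim

open Biset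

variable {G : Type u} [Group G] {B : Biset G} {X : Set B.carrier}
variable (hB : B.IsSelfSimilar) {hX : B.IsBasis X} {N : Set G} (hN : IsNucleus hX N)

/-- The operator on maps `X^{-ω} → Γ` whose fixed points represent semiconjugacies. -/
def transfer {T : Type u} [MulAction Gᵐᵒᵖ T] {m : ℕ} (I : Tensor T (B.pow m) →[Gᵐᵒᵖ] T)
    (f : (ℕ → X) → T) (y : ℕ → X) : T :=
  I (Tensor.tmul (f fun i => y (m + i)) (B.word y m))

include hB hN in
-- Two representatives of one point of the limit space are traced back in parallel. Injectivity of
-- the iterates of `limitMap` keeps their tails equivalent and gives both the same `v`, so the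
-- contraction of `iter I n` can compare them.
theorem exists_transfer_iterate {T : Type u} [MulAction Gᵐᵒᵖ T] {m : ℕ}
    (I : Tensor T (B.pow m) →[Gᵐᵒᵖ] T) (n : ℕ) {p q : (ℕ → X) × G}
    (hpq : B.point p = B.point q) :
    ∃ (y z : ℕ → X) (s : G) (v : ((B.pow m).pow n).carrier),
      B.point (y, (1 : G)) = B.point (z, s) ∧ ∀ f : (ℕ → X) → T,
        ((transfer I)^[n] f) p.1 <• p.2 = iter I n (Tensor.tmul (f y) v) ∧
        ((transfer I)^[n] f) q.1 <• q.2 = iter I n (Tensor.tmul (f z <• s) v) := by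
  induction n with
  | zero =>
    refine ⟨p.1, q.1, q.2 * p.2⁻¹, p.2, ?_, fun f => ⟨rfl, ?_⟩⟩
    · have := congrArg (· <• p.2⁻¹) hpq
      simp only [point_rsmul, mul_inv_cancel] at this
      exact this
    · show f q.1 <• q.2 = (f q.1 <• (q.2 * p.2⁻¹)) <• p.2
      rw [rsmul_rsmul, inv_mul_cancel_right]
  | succ n ih =>
    obtain ⟨y, z, s, v, h1, h2⟩ := ih
    have h3 := (point_eq_iter hB hN m (y, (1 : G))).symm.trans
      (h1.trans (point_eq_iter hB hN m (z, s)))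
    obtain ⟨g, h4, h5⟩ := iter_limitMap_injective hB hN h3
    rw [rsmul_one] at h4
    refine ⟨fun i => y (m + i), fun i => z (m + i), g, Tensor.tmul (B.word y m) v, ?_, fun f => ?_⟩
    · rw [point_rsmul, one_mul] at h5
      exact h5.symm
    · rw [Function.iterate_succ_apply, (h2 _).1, (h2 _).2]
      refine ⟨rfl, ?_⟩
      have h6 : (transfer I f z) <• s = I (Tensor.tmul (f (fun i => z (m + i)) <• g)
          (B.word y m)) := by
        rw [transfer, ← map_smul, Tensor.tmul_smul, ← h4]
        rfl
      rw [h6]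
      rfl

theorem continuous_word [TopologicalSpace X] [DiscreteTopology X] (m : ℕ) :
    letI : TopologicalSpace (B.pow m).carrier := ⊥
    Continuous fun y : ℕ → X => B.word y m := by
  induction m with
  | zero =>
    let : TopologicalSpace (B.pow 0).carrier := ⊥
    exact continuous_const
  | succ m ih =>
    let : TopologicalSpace (B.pow m).carrier := ⊥
    have : DiscreteTopology (B.pow m).carrier := ⟨rfl⟩
    let F : X × (B.pow m).carrier → (B.pow (m + 1)).carrier := fun p =>
      Tensor.tmul (p.1 : B.carrier) p.2
    let : TopologicalSpace (B.pow (m + 1)).carrier := ⊥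
    have hF : Continuous F := continuous_of_discreteTopology
    exact hF.comp ((continuous_apply m).prodMk ih)

theorem continuous_transfer [TopologicalSpace X] [DiscreteTopology X] {T : Type u}
    [TopologicalSpace T] [MulAction Gᵐᵒᵖ T] {m : ℕ} {I : Tensor T (B.pow m) →[Gᵐᵒᵖ] T}
    (hI : Continuous I) {f : (ℕ → X) → T} (hf : Continuous f) : Continuous (transfer I f) := by
  let : TopologicalSpace (B.pow m).carrier := ⊥
  have h1 : Continuous fun p : T × (B.pow m).carrier =>
      (Tensor.tmul p.1 p.2 : Tensor T (B.pow m)) := continuous_coinduced_rng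
  refine hI.comp (h1.comp ((hf.comp ?_).prodMk (continuous_word m)))
  exact continuous_pi fun i => continuous_apply (m + i)

include hB hN in
/-- The limit `G`-space of a self-similar group with a contracting affine model
maps equivariantly to the model. -/
theorem AffineModel.exists_map {d : ℕ} (M : AffineModel B d) :
    ∃ φ : B.LimitGSpace X → M.Γ.Realization, Continuous φ ∧
      ∀ z (g : G), φ (z <• g) = φ z <• g := by
  let : TopologicalSpace X := ⊥
  have : DiscreteTopology X := ⟨rfl⟩
  have := finite_basis hB hX
  let := M.isMetric.metricSpace
  have hcomplete : CompleteSpace M.Γ.Realization :=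
    GComplex.completeSpace M.cocompact M.proper M.isMetric M.isometric
  have hne : Nonempty M.Γ.Realization := by
    obtain ⟨σ, hσ, -⟩ := M.hasDim.1
    exact ⟨GComplex.bary hσ⟩
  obtain ⟨L, hL, n, -, hcontr⟩ := M.contracting
  have hL0 : 0 ≤ L⁻¹ := inv_nonneg.mpr (by linarith)
  have hL1 : L⁻¹ < 1 := inv_lt_one_of_one_lt₀ hL
  let Θ : C(ℕ → X, M.Γ.Realization) → C(ℕ → X, M.Γ.Realization) := fun f =>
    ⟨transfer M.I f, continuous_transfer M.continuous f.continuous⟩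
  have hΘ : ∀ (k : ℕ) (f : C(ℕ → X, M.Γ.Realization)), ⇑(Θ^[k] f) = (transfer M.I)^[k] f := by
    intro k
    induction k with
    | zero => exact fun f => rfl
    | succ k ih => exact fun f => by rw [Function.iterate_succ_apply, ih]; rfl
  -- Contraction holds pointwise, because evaluating the `n`-th iterate at `y` applies `ξ ↦ iter M.I
  -- n (ξ ⊗ v)` to one value of the function.
  have hcon : ContractingWith (⟨L⁻¹, hL0⟩ : NNReal) (Θ^[n]) := by
    refine ⟨hL1, LipschitzWith.of_dist_le_mul fun f f' => ?_⟩
    refine (ContinuousMap.dist_le (mul_nonneg hL0 (dist_nonneg (x := f) (y := f')))).mpr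
      fun y => ?_
    obtain ⟨y', z, s, v, -, h⟩ := exists_transfer_iterate hB hN M.I n
      (p := (y, (1 : G))) (q := (y, (1 : G))) rfl
    have h1 : ∀ f : C(ℕ → X, M.Γ.Realization), (Θ^[n] f) y =
        iter M.I n (Tensor.tmul (f y') v) := fun f => by
      rw [← (h f).1, hΘ, rsmul_one]
    rw [h1, h1]
    refine (hcontr v _ _).trans (mul_le_mul_of_nonneg_left ?_ hL0)
    exact ContinuousMap.dist_apply_le_dist (f := f) (g := f') y'
  obtain ⟨ξ₀⟩ := hne
  have hneC : Nonempty C(ℕ → X, M.Γ.Realization) := ⟨ContinuousMap.const _ ξ₀⟩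
  let f : C(ℕ → X, M.Γ.Realization) := hcon.fixedPoint
  have hfix : (transfer M.I)^[n] f = f := by
    rw [← hΘ]
    exact congrArg (fun f : C(ℕ → X, M.Γ.Realization) => (f : (ℕ → X) → _))
      (hcon.fixedPoint_isFixedPt)
  obtain ⟨R', hR'⟩ := (hN.finite.image fun s : G => M.δ ξ₀ (ξ₀ <• s)).bddAbove
  let R := dist f (ContinuousMap.const _ ξ₀)
  have hR : ∀ y, M.δ (f y) ξ₀ ≤ R := fun y =>
    ContinuousMap.dist_apply_le_dist (f := f) (g := ContinuousMap.const _ ξ₀) y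
  -- The fixed point has bounded image, and coefficients of equivalent representatives differ by
  -- elements of the finite set `N`. This gives an a priori bound on the discrepancy.
  have hbound : ∀ p q : (ℕ → X) × G, B.point p = B.point q →
      M.δ (f p.1 <• p.2) (f q.1 <• q.2) ≤ R + R' + R := by
    intro p q hpq
    obtain ⟨s, hs, h⟩ := (point_eq_iff hB hN).mp hpq.symm 0
    have h' : s * q.2 = p.2 := h
    rw [← h', ← rsmul_rsmul, M.isometric]
    obtain ⟨s', hs', h⟩ := (point_eq_iff hB hN).mp hpq 0
    have h'' : s' * p.2 = q.2 := h
    have h3 : s' = s⁻¹ := by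
      rw [eq_inv_iff_mul_eq_one]
      have : s' * s * q.2 = 1 * q.2 := by rw [mul_assoc, h', h'', one_mul]
      exact mul_right_cancel this
    have h4 := hR' ⟨s', hs', rfl⟩
    have h5 : M.δ (f p.1 <• s) (ξ₀ <• s) ≤ R := by rw [M.isometric]; exact hR _
    have h6 : M.δ (ξ₀ <• s) ξ₀ ≤ R' := by
      rw [← M.isometric s⁻¹, rsmul_rsmul, mul_inv_cancel, rsmul_one, ← h3]
      exact h4
    have h7 : M.δ ξ₀ (f q.1) ≤ R := by rw [M.isMetric.symm]; exact hR _
    have h8 := M.isMetric.triangle (f p.1 <• s) (ξ₀ <• s) (f q.1)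
    have h9 := M.isMetric.triangle (ξ₀ <• s) ξ₀ (f q.1)
    linarith
  -- Each pass through the fixed-point equation contracts the discrepancy by `L⁻¹`, so it vanishes
  -- and the fixed point descends to the limit space.
  have hdecay : ∀ k : ℕ, ∀ p q : (ℕ → X) × G, B.point p = B.point q →
      M.δ (f p.1 <• p.2) (f q.1 <• q.2) ≤ L⁻¹ ^ k * (R + R' + R) := by
    intro k
    induction k with
    | zero => intro p q hpq; rw [pow_zero, one_mul]; exact hbound p q hpq
    | succ k ih =>
      intro p q hpq
      obtain ⟨y, z, s, v, h1, h2⟩ := exists_transfer_iterate hB hN M.I n hpq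
      have h3 := h2 f
      rw [hfix] at h3
      rw [h3.1, h3.2, pow_succ', mul_assoc]
      refine (hcontr v _ _).trans (mul_le_mul_of_nonneg_left ?_ hL0)
      have := ih (y, 1) (z, s) h1
      rwa [rsmul_one] at this
  have hwd : ∀ p q : (ℕ → X) × G, B.point p = B.point q → f p.1 <• p.2 = f q.1 <• q.2 := by
    intro p q hpq
    refine (M.isMetric.eq_zero_iff _ _).mp (le_antisymm ?_ (dist_nonneg (α := M.Γ.Realization)))
    have hlim : Filter.Tendsto (fun k : ℕ => L⁻¹ ^ k * (R + R' + R)) Filter.atTop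
        (nhds (0 * (R + R' + R))) :=
      (tendsto_pow_atTop_nhds_zero_of_lt_one hL0 hL1).mul_const _
    rw [zero_mul] at hlim
    exact ge_of_tendsto' hlim fun k => hdecay k p q hpq
  refine ⟨Quotient.lift (s := B.asymptoticSetoid X) (fun p => f p.1 <• p.2)
    fun p q h => hwd p q (Quotient.sound h), ?_, ?_⟩
  · refine isQuotientMap_point.continuous_iff.mpr ⟨fun U hU => isOpen_seq_iff.mpr fun p hp => ?_⟩
    have h1 : IsOpen {q : (ℕ → X) × G | f q.1 <• p.2 ∈ U} := by
      let : TopologicalSpace G := ⊥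
      exact hU.preimage ((GComplex.continuous_rsmul p.2).comp (f.continuous.comp continuous_fst))
    obtain ⟨j, hj⟩ := isOpen_seq_iff.mp h1 p hp
    refine ⟨j, fun q h2 h3 => ?_⟩
    have := hj q h2 h3
    show f q.1 <• q.2 ∈ U
    rw [h3]
    exact this
  · intro z g
    obtain ⟨p, rfl⟩ := point_surjective z
    show f p.1 <• (p.2 * g) = (f p.1 <• p.2) <• g
    rw [rsmul_rsmul]

include hB hN in
theorem locallyFinite_tile : LocallyFinite (B.tile X) := by
  intro z
  obtain ⟨U, hU, hz, A, hA, h⟩ := exists_isOpen_subset_tiles hB hN z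
  refine ⟨U, hU.mem_nhds hz, (Set.Finite.image2 (fun s a => s * a) hN.finite hA).subset ?_⟩
  rintro g ⟨w, hw, hwU⟩
  obtain ⟨a, ha, hwa⟩ := Set.mem_iUnion₂.mp (h hwU)
  obtain ⟨s, hs, e⟩ := exists_mul_of_mem_tile hB hN hwa hw
  exact ⟨s, hs, a, ha, e⟩

include hB hN in
/-- The existence of an equivariant map to a `d`-dimensional complex with a proper action bounds
the covering dimension of the limit `G`-space. -/
theorem coveringDimLE_of_map {Γ : GComplex G} {d : ℕ}
    (hd : ∀ σ ∈ Γ.complex.faces, σ.card ≤ d + 1)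
    (hproper : ProperlyDiscontinuousSMul Gᵐᵒᵖ Γ.Realization)
    {φ : B.LimitGSpace X → Γ.Realization} (hφ : Continuous φ)
    (hequiv : ∀ z (g : G), φ (z <• g) = φ z <• g) : CoveringDimLE (B.LimitGSpace X) d := by
  have := t2Space_limit hB hN
  have hcomp := fun g : G => isCompact_tile hB (hX := hX) g
  refine coveringDimLE_of_locallyFinite (A := B.tile X) (fun g => (hcomp g).isClosed)
    (locallyFinite_tile hB hN) exists_mem_tile fun ι g V hV hcov => ?_
  obtain ⟨F, hF⟩ := GComplex.exists_finset_support ((hcomp 1).image hφ)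
  -- If `φ z` has a positive coordinate at `v ∈ F` and `z = z' · a` with `z'` in the tile of `1`,
  -- then `v · a⁻¹ ∈ F`. So the preimage of the star of `v` is covered by the tiles of this finite
  -- set.
  have hA : (⋃ u ∈ F, ⋃ v ∈ F, {a : G | u <• a = v}).Finite :=
    F.finite_toSet.biUnion fun u _ => F.finite_toSet.biUnion fun v _ =>
      GComplex.finite_vertex_transporter hproper u v
  obtain ⟨m, hm⟩ := exists_level_subordinate hB hN (𝒰 := Set.range V)
    (by rintro _ ⟨i, rfl⟩; exact hV i) g (by rwa [Set.sUnion_range]) hA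
  set J := iter (limitMap hB hN) m
  -- Preimages of open stars, transported to level `m`. Finitely many tiles become small there, so
  -- these sets refine the given cover.
  let W : Γ.V → (B.pow m).carrier → Set (B.LimitGSpace X) := fun v b =>
    (fun z => J (Tensor.tmul z b)) '' {z | 0 < (φ z).1 v}
  have hW : ∀ (v : Γ.V) (b : (B.pow m).carrier) (k : G), W v b = W (v <• k⁻¹) (k • b) := by
    intro v b k
    ext w
    constructor
    · rintro ⟨z, hz, rfl⟩
      refine ⟨z <• k⁻¹, ?_, ?_⟩
      · show 0 < (φ (z <• k⁻¹)).1 (v <• k⁻¹)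
        rw [hequiv, GComplex.rsmul_apply_rsmul]
        exact hz
      · show J (Tensor.tmul (z <• k⁻¹) (k • b)) = _
        rw [← Tensor.tmul_smul, rsmul_rsmul, inv_mul_cancel, rsmul_one]
    · rintro ⟨z, hz, rfl⟩
      refine ⟨z <• k, ?_, ?_⟩
      · show 0 < (φ (z <• k)).1 v
        rw [hequiv, GComplex.rsmul_apply]
        exact hz
      · show J (Tensor.tmul (z <• k) b) = J (Tensor.tmul z (k • b))
        rw [Tensor.tmul_smul]
  have htile : ∀ z, ∃ a z', z' ∈ B.tile X (1 : G) ∧ z' <• a = z ∧ z ∈ B.tile X a := fun z => by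
    obtain ⟨a, p, rfl, rfl⟩ := exists_mem_tile z
    exact ⟨p.2, B.point (p.1, 1), ⟨_, rfl, rfl⟩, by rw [point_rsmul, one_mul], _, rfl, rfl⟩
  refine exists_indexed_refinement
    (𝒲 := {U | ∃ v ∈ F, ∃ y : ℕ → X, U = W v (B.word y m <• g)}) ?_ ?_ ?_ ?_
  · rintro _ ⟨v, -, y, rfl⟩
    exact isOpen_iter_image hB hN ((GComplex.isOpen_star v).preimage hφ) _
  · rintro _ ⟨p, rfl, rfl⟩
    obtain ⟨v, hv⟩ := GComplex.support_nonempty (φ (B.point (fun i => p.1 (m + i), (1 : G))))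
    refine ⟨_, ⟨v, hF _ ⟨_, point_mem_tile (fun i => p.1 (m + i), (1 : G)), rfl⟩ hv, p.1, rfl⟩,
      B.point (fun i => p.1 (m + i), (1 : G)), GComplex.pos_iff.mpr hv, ?_⟩
    exact (point_eq_iter hB hN m p).symm
  · rintro _ ⟨v, hv, y, rfl⟩
    obtain ⟨_, ⟨i, rfl⟩, hi⟩ := hm m le_rfl y
    refine ⟨i, ?_⟩
    rintro _ ⟨z, hz, rfl⟩
    obtain ⟨a, z', hz', rfl, hza⟩ := htile z
    refine hi a ?_ _ hza
    have h1 : v ∈ (φ z' <• a).1.support := by rw [← hequiv]; exact GComplex.pos_iff.mp hz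
    rw [GComplex.mem_support_rsmul] at h1
    refine Set.mem_biUnion (hF _ ⟨z', hz', rfl⟩ h1) (Set.mem_biUnion hv ?_)
    show (v <• a⁻¹) <• a = v
    rw [rsmul_rsmul, inv_mul_cancel, rsmul_one]
  · rintro _ ⟨p, rfl, rfl⟩
    have hp := point_eq_iter hB hN m p
    set ζ := B.point (fun i => p.1 (m + i), (1 : G))
    set b := B.word p.1 m <• p.2
    -- By injectivity every `W`-set through the point equals `W v b` for some `v` in the support of
    -- `φ ζ`, and this support has at most `d + 1` elements.
    have hle : ((fun v => W v b) '' ((φ ζ).1.support : Set Γ.V)).encard ≤ d + 1 := by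
      refine (Set.encard_image_le _ _).trans ?_
      rw [Set.encard_coe_eq_coe_finsetCard]
      exact_mod_cast hd _ (φ ζ).2.2.2
    refine (Set.encard_le_encard ?_).trans hle
    rintro _ ⟨⟨v, hv, y, rfl⟩, z, hz, e⟩
    obtain ⟨k, h1, h2⟩ := iter_limitMap_injective hB hN (e.trans hp)
    refine ⟨v <• k⁻¹, ?_, ?_⟩
    · rw [Finset.mem_coe, ← GComplex.mem_support_rsmul, ← hequiv, h2]
      exact GComplex.pos_iff.mp hz
    · show W (v <• k⁻¹) b = _
      rw [h1, ← hW]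

include hB hN in
theorem AffineModel.coveringDimLE {d : ℕ} (M : AffineModel B d) :
    CoveringDimLE (B.LimitGSpace X) d := by
  obtain ⟨φ, hφ, hequiv⟩ := M.exists_map hB hN
  exact coveringDimLE_of_map hB hN M.hasDim.2 M.proper hφ hequiv

end ModelToDim

end SelfSimilar

end

noncomputable section

namespace SelfSimilar

open scoped Pointwise

/-! ### Iterates of equivariant maps, and images at high levels. -/

section Iterations

variable {G : Type u} [Group G] {B : Biset G} {T : Type u} [MulAction Gᵐᵒᵖ T]
variable (I : Tensor T B →[Gᵐᵒᵖ] T)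

theorem iter_rsmul (n : ℕ) (t : Tensor T (B.pow n)) (g : G) :
    iter I n (t <• g) = iter I n t <• g := by
  induction n with
  | zero =>
    obtain ⟨ξ, b, rfl⟩ := t.exists_tmul
    change G at b
    exact (rsmul_rsmul ξ b g).symm
  | succ n ih =>
    obtain ⟨ξ, b, rfl⟩ := t.exists_tmul
    obtain ⟨b, v, rfl⟩ := Tensor.exists_tmul (B := B.pow n) b
    exact ih (Tensor.tmul (I (Tensor.tmul ξ b)) v)

/-- The iteration as an equivariant map. -/
def iterHom (m : ℕ) : Tensor T (B.pow m) →[Gᵐᵒᵖ] T where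
  toFun := iter I m
  map_smul' g t := iter_rsmul I m t g.unop

theorem exists_iter_concat {k : ℕ} (v : (B.pow k).carrier) {m M : ℕ} (hM : m + k = M)
    (b : (B.pow m).carrier) : ∃ w : (B.pow M).carrier, ∀ z,
      iter I k (Tensor.tmul (iter I m (Tensor.tmul z b)) v) = iter I M (Tensor.tmul z w) := by
  induction m generalizing M with
  | zero =>
    obtain rfl : k = M := (Nat.zero_add k).symm.trans hM
    change G at b
    exact ⟨b • v, fun z => congrArg (iter I k) (Tensor.tmul_smul z b v)⟩
  | succ m ih =>
    obtain rfl : (m + k) + 1 = M := by omega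
    obtain ⟨x, b, rfl⟩ := Tensor.exists_tmul (B := B.pow m) b
    obtain ⟨w, hw⟩ := ih rfl b
    exact ⟨Tensor.tmul x w, fun z => hw (I (Tensor.tmul z x))⟩

theorem exists_iter_split {m k M : ℕ} (hM : m + k = M) (w : (B.pow M).carrier) :
    ∃ (b : (B.pow m).carrier) (v : (B.pow k).carrier), ∀ z,
      iter I M (Tensor.tmul z w) = iter I k (Tensor.tmul (iter I m (Tensor.tmul z b)) v) := by
  induction m generalizing M with
  | zero =>
    obtain rfl : k = M := (Nat.zero_add k).symm.trans hM
    exact ⟨(1 : G), w, fun z => congrArg (fun z => iter I k (Tensor.tmul z w)) (rsmul_one z).symm⟩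
  | succ m ih =>
    obtain rfl : (m + k) + 1 = M := by omega
    obtain ⟨x, w, rfl⟩ := Tensor.exists_tmul (B := B.pow (m + k)) w
    obtain ⟨b, v, h⟩ := ih rfl w
    exact ⟨Tensor.tmul x b, v, fun z => h (I (Tensor.tmul z x))⟩

theorem exists_iter_iterHom (m n : ℕ) (v : ((B.pow m).pow n).carrier) :
    ∃ w : (B.pow (m * n)).carrier, ∀ z,
      iter (iterHom I m) n (Tensor.tmul z v) = iter I (m * n) (Tensor.tmul z w) := by
  induction n with
  | zero => exact ⟨v, fun z => rfl⟩
  | succ n ih =>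
    obtain ⟨b, v, rfl⟩ := Tensor.exists_tmul (B := (B.pow m).pow n) v
    obtain ⟨w, hw⟩ := ih v
    obtain ⟨w', hw'⟩ := exists_iter_concat I w (show m + m * n = m * (n + 1) by ring) b
    exact ⟨w', fun z => (hw _).trans (hw' z)⟩

end Iterations

section Level

open Biset

variable {G : Type u} [Group G] {B : Biset G} {X : Set B.carrier}

theorem word_congr {x y : ℕ → X} {n : ℕ} (h : ∀ i < n, x i = y i) : B.word x n = B.word y n := by
  induction n with
  | zero => rfl
  | succ n ih =>
    show Tensor.tmul (x n : B.carrier) (B.word x n) = Tensor.tmul (y n : B.carrier) (B.word y n)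
    rw [ih fun i hi => h i (by omega), h n n.lt_succ_self]

theorem exists_word (hX : B.IsBasis X) {m : ℕ} (hm : 1 ≤ m) (b : (B.pow m).carrier) :
    ∃ (y : ℕ → X) (k : G), b = B.word y m <• k := by
  have key : ∀ (n : ℕ) (_ : ℕ → X) (b : (B.pow n).carrier),
      ∃ (y : ℕ → X) (k : G), b = B.word y n <• k := by
    intro n
    induction n with
    | zero => exact fun y b => ⟨y, b, (one_mul (M := G) b).symm⟩
    | succ n ih =>
      intro y₀ b
      obtain ⟨x, v, rfl⟩ := Tensor.exists_tmul (B := B.pow n) b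
      obtain ⟨y, k, h⟩ := ih y₀ (coef hX x • v)
      refine ⟨Function.update y n (letter hX x), k, ?_⟩
      show _ = Tensor.tmul (Function.update y n (letter hX x) n : B.carrier)
        (B.word (Function.update y n (letter hX x)) n <• k)
      rw [Function.update_self, word_congr (y := y) fun i hi => Function.update_of_ne hi.ne _ _,
        ← h, ← Tensor.tmul_smul, letter_coef]
  -- Since `m` is positive, `b` contains a letter, which provides the initial infinite sequence;
  -- none exists if the basis is empty.
  obtain ⟨n, rfl⟩ : ∃ n, m = n + 1 := ⟨m - 1, by omega⟩
  obtain ⟨x, v, -⟩ := Tensor.exists_tmul (B := B.pow n) b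
  exact key (n + 1) (fun _ => letter hX x) b

variable (hB : B.IsSelfSimilar) {hX : B.IsBasis X} {N : Set G} (hN : IsNucleus hX N)

/-- Equivariant form of `exists_level_subordinate`: writing `h • b` as a word times `k` reduces
everything to the tile of `1`, and invariance of the cover absorbs `k`. Hence one `m₀` serves all
`b` and `h`. -/
theorem exists_level {𝒰 : Set (Set (B.LimitGSpace X))} (hopen : ∀ U ∈ 𝒰, IsOpen U)
    (hcov : ⋃₀ 𝒰 = Set.univ) (hinv : ∀ g : G, ∀ U ∈ 𝒰, op g • U ∈ 𝒰) {A : Set G}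
    (hA : A.Finite) : ∃ m₀ ≥ 1, ∀ m ≥ m₀, ∀ (b : (B.pow m).carrier) (h : G), ∃ U ∈ 𝒰, ∀ a ∈ A,
      ∀ z ∈ B.tile X (a * h), iter (limitMap hB hN) m (Tensor.tmul z b) ∈ U := by
  obtain ⟨m₀, hm₀⟩ := exists_level_subordinate hB hN hopen 1
    (by rw [hcov]; exact Set.subset_univ _) hA
  refine ⟨max m₀ 1, le_max_right _ _, fun m hm b h => ?_⟩
  obtain ⟨y, k, hk⟩ := exists_word hX ((le_max_right _ _).trans hm) (h • b)
  obtain ⟨U, hU, h1⟩ := hm₀ m ((le_max_left _ _).trans hm) y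
  refine ⟨op k • U, hinv k U hU, fun a ha z hz => ?_⟩
  have h2 : z <• h⁻¹ ∈ B.tile X a := by
    have := rsmul_mem_tile hz h⁻¹
    rwa [mul_inv_cancel_right] at this
  have h3 : iter (limitMap hB hN) m (Tensor.tmul z b) =
      iter (limitMap hB hN) m (Tensor.tmul (z <• h⁻¹) (B.word y m <• (1 : G))) <• k := by
    rw [← iter_rsmul, rsmul_one]
    show _ = iter (limitMap hB hN) m (Tensor.tmul (z <• h⁻¹) (B.word y m <• k))
    rw [← hk, ← Tensor.tmul_smul, rsmul_rsmul, inv_mul_cancel, rsmul_one]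
  rw [h3]
  exact Set.smul_mem_smul_set (h1 a ha _ h2)

end Level

/-! ### Contracting maps defined by equivariant selections of simplices. -/

namespace GComplex

variable {G : Type u} [Group G] {Γ : GComplex G}

theorem bary_rsmul {σ τ : Finset Γ.V} (hσ : σ ∈ Γ.complex.faces) (hτ : τ ∈ Γ.complex.faces)
    {g : G} (h : τ = σ.map (MulAction.toPerm (op g)).toEmbedding) :
    bary hτ = bary hσ <• g := by
  subst h
  refine Subtype.ext (Finsupp.ext fun v => ?_)
  rw [rsmul_apply]
  have hv : v ∈ σ.map (MulAction.toPerm (op g)).toEmbedding ↔ v <• g⁻¹ ∈ σ := by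
    rw [Finset.mem_map_equiv]
    rfl
  by_cases h : v <• g⁻¹ ∈ σ
  · rw [bary_apply hτ (hv.mpr h), bary_apply hσ h, Finset.card_map]
  · rw [← support_bary hσ, Finsupp.notMem_support_iff] at h
    rw [h, ← Finsupp.notMem_support_iff, support_bary, hv, ← support_bary hσ,
      Finsupp.notMem_support_iff, h]

theorem affineExt_apply {F : Γ.V → Γ.Realization} (hF : Γ.IsVertexMap F) (x : Γ.Realization)
    {s : Finset Γ.V} (hs : x.1.support ⊆ s) (w : Γ.V) :
    (affineExt F hF x).1 w = ∑ v ∈ s, x.1 v * (F v).1 w := by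
  rw [affineExt_val, linearExt_apply F hs, Finsupp.finsetSum_apply]
  rfl

theorem affineExt_apply_rsmul {F F' : Γ.V → Γ.Realization} (hF : Γ.IsVertexMap F)
    (hF' : Γ.IsVertexMap F') {g : G} (h : ∀ v, F (v <• g) = F' v) (x : Γ.Realization) :
    affineExt F hF (x <• g) = affineExt F' hF' x := by
  refine Subtype.ext (Finsupp.ext fun w => ?_)
  have h1 : (x <• g).1.support ⊆ x.1.support.map (MulAction.toPerm (op g)).toEmbedding := by
    intro v hv
    rw [Finset.mem_map_equiv]
    exact mem_support_rsmul.mp hv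
  rw [affineExt_apply hF _ h1, affineExt_apply hF' _ subset_rfl, Finset.sum_map]
  refine Finset.sum_congr rfl fun v _ => ?_
  show (x <• g).1 (v <• g) * (F (v <• g)).1 w = _
  rw [rsmul_apply_rsmul, h]

theorem affineExt_rsmul {F F' : Γ.V → Γ.Realization} (hF : Γ.IsVertexMap F)
    (hF' : Γ.IsVertexMap F') {g : G} (h : ∀ v, F' v = F v <• g) (x : Γ.Realization) :
    affineExt F' hF' x = affineExt F hF x <• g := by
  refine Subtype.ext (Finsupp.ext fun w => ?_)
  rw [rsmul_apply, affineExt_apply hF _ subset_rfl, affineExt_apply hF' _ subset_rfl]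
  refine Finset.sum_congr rfl fun v _ => ?_
  rw [h, rsmul_apply]

/-- An equivariant choice of a simplex `sel v b` for every vertex `v` and every `b`,
such that the simplices chosen for the vertices of a simplex have a common vertex
and belong to a common simplex. -/
structure Selection (Γ : GComplex G) (C : Biset G) where
  sel : Γ.V → C.carrier → Finset Γ.V
  sel_smul : ∀ v (g : G) b, sel (v <• g) b = sel v (g • b)
  sel_rsmul : ∀ v (g : G) b, sel v (b <• g) = (sel v b).map (MulAction.toPerm (op g)).toEmbedding
  exists_common : ∀ σ ∈ Γ.complex.faces, ∀ b, ∃ w, ∀ v ∈ σ, w ∈ sel v b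
  exists_face : ∀ σ ∈ Γ.complex.faces, ∀ b, ∃ τ ∈ Γ.complex.faces, ∀ v ∈ σ, sel v b ⊆ τ

namespace Selection

variable {C : Biset G} (S : Γ.Selection C)

theorem sel_mem (v : Γ.V) (b : C.carrier) : S.sel v b ∈ Γ.complex.faces := by
  obtain ⟨w, hw⟩ := S.exists_common _ (Γ.complex.singleton_mem v) b
  obtain ⟨τ, hτ, h⟩ := S.exists_face _ (Γ.complex.singleton_mem v) b
  exact mem_faces_of_subset hτ (h v (Finset.mem_singleton_self v))
    ⟨w, hw v (Finset.mem_singleton_self v)⟩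

/-- The barycenters of the selected simplices. -/
def vertexMap (b : C.carrier) (v : Γ.V) : Γ.Realization := bary (S.sel_mem v b)

theorem isVertexMap (b : C.carrier) : Γ.IsVertexMap (S.vertexMap b) := fun σ hσ => by
  obtain ⟨τ, hτ, h⟩ := S.exists_face σ hσ b
  refine ⟨τ, hτ, fun v hv => ?_⟩
  show (bary _).1.support ⊆ τ
  rw [support_bary]
  exact h v hv

/-- The map that is affine on simplices and maps vertices to barycenters of selected simplices. -/
def map : Tensor Γ.Realization C →[Gᵐᵒᵖ] Γ.Realization where
  toFun := Tensor.lift (fun ξ b => affineExt (S.vertexMap b) (S.isVertexMap b) ξ) fun ξ g b =>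
    affineExt_apply_rsmul _ _ (fun v => by
      have := S.sel_smul v g b
      show bary _ = bary _
      congr 1) ξ
  map_smul' g := Tensor.ind fun ξ b =>
    affineExt_rsmul (S.isVertexMap b) (S.isVertexMap (g • b)) (g := g.unop)
      (fun v => bary_rsmul _ _ (S.sel_rsmul v g.unop b)) ξ

theorem exists_cell (b : C.carrier) {σ : Finset Γ.V} (hσ : σ ∈ Γ.complex.faces) :
    ∃ τ ∈ Γ.complex.faces, ∀ x ∈ Γ.cell σ, S.map (Tensor.tmul x b) ∈ Γ.cell τ :=
  exists_cell_affineExt (S.isVertexMap b) hσ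

theorem exists_of_mem_support_map {x : Γ.Realization} {b : C.carrier} {w : Γ.V}
    (h : w ∈ (S.map (Tensor.tmul x b)).1.support) : ∃ v ∈ x.1.support, w ∈ S.sel v b := by
  obtain ⟨v, hv, hw⟩ := exists_of_mem_support_affineExt (S.isVertexMap b) h
  refine ⟨v, hv, ?_⟩
  rwa [vertexMap, support_bary] at hw

/-- The contraction coefficient of piecewise affine maps in dimension `d`. -/
def coeff (d : ℕ) : ℝ := (d + 1) / (d + 2)

theorem coeff_pos (d : ℕ) : 0 < coeff d := by unfold coeff; positivity

theorem coeff_lt_one (d : ℕ) : coeff d < 1 := by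
  unfold coeff
  rw [div_lt_one (by positivity)]
  linarith

/-- All barycenters chosen for the vertices of `σ` have coordinate at least `1 / (d + 1)` at a
common vertex, so they are at mutual distance at most `2 - 2 / (d + 1)`. -/
theorem l1_map_le {d : ℕ} (hd : ∀ σ ∈ Γ.complex.faces, σ.card ≤ d + 1) (b : C.carrier)
    {σ : Finset Γ.V} (hσ : σ ∈ Γ.complex.faces) {x y : Γ.Realization} (hx : x ∈ Γ.cell σ)
    (hy : y ∈ Γ.cell σ) :
    Γ.l1 (S.map (Tensor.tmul x b)) (S.map (Tensor.tmul y b)) ≤ coeff d * Γ.l1 x y := by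
  refine l1_affineExt_le (S.isVertexMap b) (fun u hu v hv => ?_) hx hy
  obtain ⟨w, hw⟩ := S.exists_common σ hσ b
  have key : ∀ v ∈ σ, ((d : ℝ) + 1)⁻¹ ≤ (S.vertexMap b v).1 w := fun v hv => by
    rw [vertexMap, bary_apply _ (hw v hv)]
    have h1 : 0 < (S.sel v b).card := Finset.card_pos.mpr ⟨w, hw v hv⟩
    exact inv_anti₀ (Nat.cast_pos.mpr h1) (by exact_mod_cast hd _ (S.sel_mem v b))
  refine (l1_le_of_common (key u hu) (key v hv)).trans ?_
  have h1 : (0 : ℝ) < d + 1 := by positivity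
  have h2 : (0 : ℝ) < d + 2 := by positivity
  -- The natural factor `d / (d + 1)` vanishes for `d = 0`. The slightly larger `coeff d` is
  -- positive, so its inverse can be used for rescaling.
  have h3 : ((d : ℝ) + 2)⁻¹ ≤ ((d : ℝ) + 1)⁻¹ := inv_anti₀ h1 (by linarith)
  have h4 : coeff d = 1 - ((d : ℝ) + 2)⁻¹ := by
    unfold coeff
    field_simp
    ring
  linarith

theorem continuous_map {d : ℕ} (hd : ∀ σ ∈ Γ.complex.faces, σ.card ≤ d + 1) :
    Continuous S.map := by
  let : TopologicalSpace C.carrier := ⊥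
  have : DiscreteTopology C.carrier := ⟨rfl⟩
  refine continuous_coinduced_dom.mpr (continuous_prod_of_discrete_right.mpr fun b => ?_)
  refine continuous_of_l1_le (fun σ hσ => S.exists_cell b hσ) fun σ hσ x hx y hy => ?_
  exact (S.l1_map_le hd b hσ hx hy).trans
    (mul_le_of_le_one_left (l1_nonneg x y) (coeff_lt_one d).le)

theorem isPiecewiseAffine_map (b : C.carrier) :
    Γ.IsPiecewiseAffine fun ξ => S.map (Tensor.tmul ξ b) :=
  isPiecewiseAffine_affineExt (S.isVertexMap b)

end Selection

end GComplex

end SelfSimilar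

end

noncomputable section

namespace SelfSimilar

open scoped Pointwise

namespace GComplex

variable {G : Type u} [Group G] {Γ : GComplex G} {C : Biset G}

theorem exists_cell_rsmul (g : G) {σ : Finset Γ.V} (hσ : σ ∈ Γ.complex.faces) :
    ∃ τ ∈ Γ.complex.faces, ∀ x ∈ Γ.cell σ, x <• g ∈ Γ.cell τ :=
  ⟨_, Γ.map_mem g σ hσ, fun x hx v hv => by
    rw [Finset.mem_map_equiv]
    exact hx (mem_support_rsmul.mp hv)⟩

/-! ### A contracted metric on a possibly disconnected complex. -/

section Stretch

variable (I : Tensor Γ.Realization C →[Gᵐᵒᵖ] Γ.Realization) {c : ℝ}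

/-- The scaled distance between the images under an iteration of a map. -/
def stretch (c : ℝ) (x y : Γ.Realization) (p : Σ n, (C.pow n).carrier) : ℝ :=
  c⁻¹ ^ p.1 * Γ.l1 (iter I p.1 (Tensor.tmul x p.2)) (iter I p.1 (Tensor.tmul y p.2))

/-- The supremum of scaled distances between the images under the iterations of a map. -/
def stretchDist (c : ℝ) (x y : Γ.Realization) : ℝ := ⨆ p, stretch I c x y p

variable {I} (hc : 0 < c)
  (hcell : ∀ b, ∀ σ ∈ Γ.complex.faces, ∃ τ ∈ Γ.complex.faces, ∀ x ∈ Γ.cell σ,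
    I (Tensor.tmul x b) ∈ Γ.cell τ)
  (hl1 : ∀ b, ∀ σ ∈ Γ.complex.faces, ∀ x ∈ Γ.cell σ, ∀ y ∈ Γ.cell σ,
    Γ.l1 (I (Tensor.tmul x b)) (I (Tensor.tmul y b)) ≤ c * Γ.l1 x y)

include hcell in
theorem exists_cell_iter (n : ℕ) (v : (C.pow n).carrier) {σ : Finset Γ.V}
    (hσ : σ ∈ Γ.complex.faces) :
    ∃ τ ∈ Γ.complex.faces, ∀ x ∈ Γ.cell σ, iter I n (Tensor.tmul x v) ∈ Γ.cell τ := by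
  induction n generalizing σ with
  | zero =>
    change G at v
    exact exists_cell_rsmul v hσ
  | succ n ih =>
    obtain ⟨b, v, rfl⟩ := Tensor.exists_tmul (B := C.pow n) v
    obtain ⟨τ, hτ, h⟩ := hcell b σ hσ
    obtain ⟨τ', hτ', h'⟩ := ih v hτ
    exact ⟨τ', hτ', fun x hx => h' _ (h x hx)⟩

include hc hcell hl1 in
theorem l1_iter_le (n : ℕ) (v : (C.pow n).carrier) {σ : Finset Γ.V} (hσ : σ ∈ Γ.complex.faces)
    {x y : Γ.Realization} (hx : x ∈ Γ.cell σ) (hy : y ∈ Γ.cell σ) :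
    Γ.l1 (iter I n (Tensor.tmul x v)) (iter I n (Tensor.tmul y v)) ≤ c ^ n * Γ.l1 x y := by
  induction n generalizing σ x y with
  | zero =>
    change G at v
    rw [pow_zero, one_mul]
    exact (l1_rsmul v x y).le
  | succ n ih =>
    obtain ⟨b, v, rfl⟩ := Tensor.exists_tmul (B := C.pow n) v
    obtain ⟨τ, hτ, h⟩ := hcell b σ hσ
    refine (ih v hτ (h x hx) (h y hy)).trans ?_
    rw [pow_succ, mul_assoc]
    exact mul_le_mul_of_nonneg_left (hl1 b σ hσ x hx y hy) (pow_nonneg hc.le _)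

include hc hcell hl1 in
-- Once the images are joined by a chain of length at most `R` at level `n₀`, later chains shrink by
-- `c` per step, exactly compensating the factor `c⁻¹`. At earlier levels the `ℓ¹`-distance is at
-- most `2`.
theorem bddAbove_stretch (hc1 : c < 1) {n₀ : ℕ} {R : ℝ} {x y : Γ.Realization}
    (h : ∀ v : (C.pow n₀).carrier, ∃ r ≤ R,
      Γ.IsChain (iter I n₀ (Tensor.tmul x v)) (iter I n₀ (Tensor.tmul y v)) r) :
    BddAbove (Set.range (stretch I c x y)) := by
  have hchain : ∀ n, n₀ ≤ n → ∀ v : (C.pow n).carrier, ∃ r ≤ c ^ (n - n₀) * R,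
      Γ.IsChain (iter I n (Tensor.tmul x v)) (iter I n (Tensor.tmul y v)) r := by
    intro n hn v
    obtain ⟨k, rfl⟩ := Nat.exists_eq_add_of_le hn
    obtain ⟨v₁, v₂, hv⟩ := exists_iter_split I rfl v
    obtain ⟨r, hr, hr'⟩ := h v₁
    obtain ⟨s, hs, hs'⟩ := IsChain.map
      (f := fun z => iter I k (Tensor.tmul z v₂)) (c := c ^ k)
      (fun σ hσ => exists_cell_iter hcell k v₂ hσ)
      (fun σ hσ x hx y hy => l1_iter_le hc hcell hl1 k v₂ hσ hx hy) hr'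
    rw [hv, hv, Nat.add_sub_cancel_left]
    exact ⟨s, hs.trans (mul_le_mul_of_nonneg_left hr (pow_nonneg hc.le k)), hs'⟩
  have hc' : 1 ≤ c⁻¹ := (one_le_inv₀ hc).mpr hc1.le
  refine ⟨c⁻¹ ^ n₀ * max R 2, ?_⟩
  rintro _ ⟨⟨n, v⟩, rfl⟩
  rcases le_total n₀ n with hn | hn
  · obtain ⟨r, hr, hr'⟩ := hchain n hn v
    refine (mul_le_mul_of_nonneg_left (hr'.l1_le.trans hr) (pow_nonneg (by positivity) n)).trans ?_
    rw [← mul_assoc]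
    have : c⁻¹ ^ n * c ^ (n - n₀) = c⁻¹ ^ n₀ := by
      obtain ⟨k, rfl⟩ := Nat.exists_eq_add_of_le hn
      rw [Nat.add_sub_cancel_left, pow_add, mul_assoc, ← mul_pow, inv_mul_cancel₀ hc.ne', one_pow,
        mul_one]
    show c⁻¹ ^ n * c ^ (n - n₀) * R ≤ _
    rw [this]
    exact mul_le_mul_of_nonneg_left (le_max_left _ _) (by positivity)
  · refine mul_le_mul (pow_le_pow_right₀ hc' hn) ((l1_le_two _ _).trans (le_max_right _ _))
      (l1_nonneg _ _) (by positivity)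

variable (hbdd : ∀ x y, BddAbove (Set.range (stretch I c x y)))

include hbdd

theorem stretch_le (x y : Γ.Realization) (p : Σ n, (C.pow n).carrier) :
    stretch I c x y p ≤ stretchDist I c x y := le_ciSup (hbdd x y) p

theorem l1_le_stretchDist (x y : Γ.Realization) : Γ.l1 x y ≤ stretchDist I c x y := by
  have := stretch_le hbdd x y ⟨0, (1 : G)⟩
  rw [stretch, pow_zero, one_mul] at this
  refine le_trans (le_of_eq ?_) this
  show _ = Γ.l1 (x <• (1 : G)) (y <• (1 : G))
  rw [rsmul_one, rsmul_one]

omit hbdd in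
theorem stretchDist_le {x y : Γ.Realization} {r : ℝ} (h : ∀ p, stretch I c x y p ≤ r) :
    stretchDist I c x y ≤ r :=
  have : Nonempty (Σ n, (C.pow n).carrier) := ⟨⟨0, (1 : G)⟩⟩
  ciSup_le h

omit hbdd in
theorem stretchDist_comm (x y : Γ.Realization) : stretchDist I c x y = stretchDist I c y x :=
  iSup_congr fun p => by rw [stretch, stretch, l1_comm]

include hc in
theorem stretchDist_triangle (x y z : Γ.Realization) :
    stretchDist I c x z ≤ stretchDist I c x y + stretchDist I c y z :=
  stretchDist_le fun p => by
    refine le_trans ?_ (add_le_add (stretch_le hbdd x y p) (stretch_le hbdd y z p))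
    rw [stretch, stretch, stretch, ← mul_add]
    exact mul_le_mul_of_nonneg_left (l1_triangle _ _ _) (by positivity)

include hc hcell hl1 in
-- Inside a simplex the `n`-th image contracts by `c ^ n`, so no term of the supremum exceeds the
-- one with `n = 0`.
theorem stretchDist_eq_l1 {σ : Finset Γ.V} (hσ : σ ∈ Γ.complex.faces) {x y : Γ.Realization}
    (hx : x ∈ Γ.cell σ) (hy : y ∈ Γ.cell σ) : stretchDist I c x y = Γ.l1 x y := by
  refine le_antisymm (stretchDist_le fun p => ?_) (l1_le_stretchDist hbdd x y)
  refine (mul_le_mul_of_nonneg_left (l1_iter_le hc hcell hl1 p.1 p.2 hσ hx hy)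
    (by positivity)).trans ?_
  rw [← mul_assoc, ← mul_pow, inv_mul_cancel₀ hc.ne', one_pow, one_mul]

theorem stretchDist_rsmul (x y : Γ.Realization) (g : G) :
    stretchDist I c (x <• g) (y <• g) = stretchDist I c x y := by
  have key : ∀ (g : G) (x y : Γ.Realization),
      stretchDist I c (x <• g) (y <• g) ≤ stretchDist I c x y := fun g x y =>
    stretchDist_le fun p => by
      rw [stretch, Tensor.tmul_smul, Tensor.tmul_smul]
      exact stretch_le hbdd x y ⟨p.1, g • p.2⟩
  refine le_antisymm (key g x y) ?_
  have := key g⁻¹ (x <• g) (y <• g)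
  rwa [rsmul_rsmul, rsmul_rsmul, mul_inv_cancel, rsmul_one, rsmul_one] at this

include hc in
-- Applying the map first shifts the index of the supremum by one, which costs one factor `c`.
theorem stretchDist_map_le (b : C.carrier) (x y : Γ.Realization) :
    stretchDist I c (I (Tensor.tmul x b)) (I (Tensor.tmul y b)) ≤ c * stretchDist I c x y :=
  stretchDist_le fun p => by
    have := stretch_le hbdd x y ⟨p.1 + 1, Tensor.tmul b p.2⟩
    refine le_trans (le_of_eq ?_) (mul_le_mul_of_nonneg_left this hc.le)
    show _ = c * (c⁻¹ ^ (p.1 + 1) * _)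
    rw [pow_succ', ← mul_assoc, ← mul_assoc, mul_inv_cancel₀ hc.ne', one_mul]
    rfl

end Stretch

theorem isContractingMap_of_le {δ : Γ.Realization → Γ.Realization → ℝ}
    (hiso : ∀ (g : G) x y, δ (x <• g) (y <• g) = δ x y)
    {I : Tensor Γ.Realization C →[Gᵐᵒᵖ] Γ.Realization} {c : ℝ} (hc : 0 < c) (hc1 : c < 1)
    (h : ∀ b x y, δ (I (Tensor.tmul x b)) (I (Tensor.tmul y b)) ≤ c * δ x y) :
    IsContractingMap δ I := by
  refine ⟨c⁻¹, (one_lt_inv₀ hc).mpr hc1, 1, le_rfl, fun v x y => ?_⟩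
  obtain ⟨b, g, rfl⟩ := Tensor.exists_tmul (B := C.pow 0) v
  change G at g
  rw [inv_inv]
  exact (hiso g (I (Tensor.tmul x b)) (I (Tensor.tmul y b))).trans_le (h b x y)

end GComplex

/-! ### Complexes extending the nerve of a cover. -/

section Model

open Biset GComplex

variable {G : Type u} [Group G] {B : Biset G} {X : Set B.carrier} {d : ℕ}

/-- A complex with a proper co-compact action, containing the nerve of a cover of the limit
`G`-space. The set `nbr v` records the tiles near to the vertex `v`. -/
structure NerveExtension (𝒱 : SubMulAction Gᵐᵒᵖ (Set (B.LimitGSpace X))) (d : ℕ) where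
  Γ : GComplex G
  hasDim : Γ.HasDim d
  nbr : Γ.V → Set G
  finite_nbr : ∀ v, (nbr v).Finite
  mul_mem_nbr : ∀ v (g h : G), h ∈ nbr v → h * g ∈ nbr (v <• g)
  exists_mem_nbr : ∀ σ ∈ Γ.complex.faces, ∃ h, ∀ v ∈ σ, h ∈ nbr v
  reps : Finset Γ.V
  exists_mem_reps : ∀ v, ∃ g : G, v <• g ∈ reps
  emb : 𝒱 →[Gᵐᵒᵖ] Γ.V
  exists_tile : ∀ U : 𝒱, ∀ z ∈ U.1, ∃ h ∈ nbr (emb U), z ∈ B.tile X h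
  nerve : ∀ z, ∀ σ : Finset Γ.V, σ.Nonempty → (∀ v ∈ σ, ∃ U : 𝒱, z ∈ U.1 ∧ v = emb U) →
    σ ∈ Γ.complex.faces

namespace NerveExtension

variable {𝒱 : SubMulAction Gᵐᵒᵖ (Set (B.LimitGSpace X))} (E : NerveExtension 𝒱 d)

theorem mul_mem_nbr_iff {v : E.Γ.V} {g h : G} : h * g ∈ E.nbr (v <• g) ↔ h ∈ E.nbr v := by
  refine ⟨fun hh => ?_, E.mul_mem_nbr v g h⟩
  have := E.mul_mem_nbr _ g⁻¹ _ hh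
  rwa [mul_inv_cancel_right, rsmul_rsmul, mul_inv_cancel, rsmul_one] at this

theorem nbr_nonempty (v : E.Γ.V) : (E.nbr v).Nonempty := by
  obtain ⟨h, hh⟩ := E.exists_mem_nbr _ (E.Γ.complex.singleton_mem v)
  exact ⟨h, hh v (Finset.mem_singleton_self v)⟩

/-- Adjacent vertices share an element of `nbr`. Once `u` is moved to a representative, the two
finite sets leave finitely many possibilities for it. Properness follows in the same way. -/
theorem isLocallyFinite : E.Γ.IsLocallyFinite := by
  intro v
  have hfin : (⋃ u ∈ E.reps, Set.image2 (fun h k : G => u <• (h⁻¹ * k)) (E.nbr u)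
      (E.nbr v)).Finite :=
    E.reps.finite_toSet.biUnion fun u _ => (E.finite_nbr u).image2 _ (E.finite_nbr v)
  refine hfin.subset ?_
  rintro u ⟨σ, hσ, hu, hv⟩
  obtain ⟨h, hh⟩ := E.exists_mem_nbr σ hσ
  obtain ⟨g, hg⟩ := E.exists_mem_reps u
  refine Set.mem_biUnion hg ⟨h * g, E.mul_mem_nbr_iff.mpr (hh u hu), h, hh v hv, ?_⟩
  show (u <• g) <• ((h * g)⁻¹ * h) = u
  rw [rsmul_rsmul, mul_inv_rev, mul_assoc, inv_mul_cancel, mul_one, mul_inv_cancel, rsmul_one]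

theorem finite_transporter (u v : E.Γ.V) : {g : G | u <• g = v}.Finite := by
  obtain ⟨h, hh⟩ := E.nbr_nonempty u
  refine ((E.finite_nbr v).image fun k => h⁻¹ * k).subset ?_
  rintro g rfl
  exact ⟨h * g, E.mul_mem_nbr_iff.mpr hh, inv_mul_cancel_left h g⟩

theorem proper : ProperlyDiscontinuousSMul Gᵐᵒᵖ E.Γ.Realization :=
  E.isLocallyFinite.proper E.finite_transporter

theorem isCocompact : E.Γ.IsCocompact := E.isLocallyFinite.cocompact E.exists_mem_reps

theorem exists_finite_nbr :
    ∃ A : Set G, A.Finite ∧ ∀ (v : E.Γ.V), ∀ h ∈ E.nbr v, ∀ k ∈ E.nbr v, ∃ a ∈ A, k = a * h := by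
  refine ⟨⋃ u ∈ E.reps, Set.image2 (fun k h : G => k * h⁻¹) (E.nbr u) (E.nbr u),
    E.reps.finite_toSet.biUnion fun u _ => (E.finite_nbr u).image2 _ (E.finite_nbr u), ?_⟩
  intro v h hh k hk
  obtain ⟨g, hg⟩ := E.exists_mem_reps v
  refine ⟨k * h⁻¹, Set.mem_biUnion hg ⟨k * g, E.mul_mem_nbr_iff.mpr hk, h * g,
    E.mul_mem_nbr_iff.mpr hh, ?_⟩, (inv_mul_cancel_right k h).symm⟩
  show k * g * (h * g)⁻¹ = _
  rw [mul_inv_rev, mul_assoc, mul_inv_cancel_left]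

/-- The union of the tiles near to a vertex. -/
def zone (v : E.Γ.V) : Set (B.LimitGSpace X) := ⋃ h ∈ E.nbr v, B.tile X h

theorem mem_zone_emb {U : 𝒱} {z : B.LimitGSpace X} (hz : z ∈ U.1) : z ∈ E.zone (E.emb U) := by
  obtain ⟨h, hh, hzh⟩ := E.exists_tile U z hz
  exact Set.mem_biUnion hh hzh

theorem rsmul_mem_zone {v : E.Γ.V} {z : B.LimitGSpace X} (hz : z ∈ E.zone v) (g : G) :
    z <• g ∈ E.zone (v <• g) := by
  obtain ⟨h, hh, hzh⟩ := Set.mem_iUnion₂.mp hz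
  exact Set.mem_biUnion (E.mul_mem_nbr v g h hh) (rsmul_mem_tile hzh g)

end NerveExtension

end Model

end SelfSimilar

end

noncomputable section

namespace SelfSimilar

open scoped Pointwise

section Model

open Biset GComplex

variable {G : Type u} [Group G] {B : Biset G} {X : Set B.carrier} {d : ℕ}

/-! ### The affine model attached to a cover. -/

namespace NerveExtension

variable {𝒱 : SubMulAction Gᵐᵒᵖ (Set (B.LimitGSpace X))} (E : NerveExtension 𝒱 d)
variable (hB : B.IsSelfSimilar) {hX : B.IsBasis X} {N : Set G} (hN : IsNucleus hX N)

/-- The elements of the cover that contain the image of the zone of a vertex. -/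
def target (m : ℕ) (v : E.Γ.V) (b : (B.pow m).carrier) : Set 𝒱 :=
  {U | ∀ z ∈ E.zone v, iter (limitMap hB hN) m (Tensor.tmul z b) ∈ U.1}

theorem target_smul (m : ℕ) (v : E.Γ.V) (g : G) (b : (B.pow m).carrier) :
    E.target hB hN m (v <• g) b = E.target hB hN m v (g • b) := by
  ext U
  constructor
  · intro h z hz
    rw [← Tensor.tmul_smul]
    exact h _ (E.rsmul_mem_zone hz g)
  · intro h z hz
    have h1 := E.rsmul_mem_zone hz g⁻¹
    rw [rsmul_rsmul, mul_inv_cancel, rsmul_one] at h1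
    have := h _ h1
    rwa [← Tensor.tmul_smul, rsmul_rsmul, inv_mul_cancel, rsmul_one] at this

theorem rsmul_mem_target {m : ℕ} {v : E.Γ.V} {b : (B.pow m).carrier} {U : 𝒱}
    (h : U ∈ E.target hB hN m v b) (g : G) : U <• g ∈ E.target hB hN m v (b <• g) := by
  intro z hz
  have : iter (limitMap hB hN) m (Tensor.tmul z (b <• g)) =
      iter (limitMap hB hN) m (Tensor.tmul z b) <• g := (iter_rsmul _ m (Tensor.tmul z b) g)
  rw [this]
  exact Set.smul_mem_smul_set (h z hz)

theorem exists_mem_tile_of_word {m : ℕ} (hX : B.IsBasis X) (hm : 1 ≤ m) (b : (B.pow m).carrier)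
    (h : G) : ∃ z, z ∈ B.tile X h := by
  obtain ⟨y, -, -⟩ := exists_word hX hm b
  exact ⟨_, point_mem_tile (y, h)⟩

theorem finite_target (hfin : ∀ z, {V | V ∈ 𝒱 ∧ z ∈ V}.Finite) {m : ℕ} (hm : 1 ≤ m) (v : E.Γ.V)
    (b : (B.pow m).carrier) : (E.target hB hN m v b).Finite := by
  obtain ⟨h, hh⟩ := E.nbr_nonempty v
  obtain ⟨z, hz⟩ := exists_mem_tile_of_word hX hm b h
  refine ((hfin (iter (limitMap hB hN) m (Tensor.tmul z b))).preimage
    Subtype.val_injective.injOn).subset fun U hU => ?_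
  exact ⟨U.2, hU z (Set.mem_biUnion hh hz)⟩

variable (hopen : ∀ V ∈ 𝒱, IsOpen V) (hcov : ⋃₀ (𝒱 : Set (Set (B.LimitGSpace X))) = Set.univ)
  (hfin : ∀ z, {V | V ∈ 𝒱 ∧ z ∈ V}.Finite)

include hopen hcov hfin in
-- A vertex selects all cover elements containing the image of its zone. Vertices of a simplex have
-- zones inside the tiles `a * h`, `a ∈ A`, for a common `h`, and these are mapped into one `U`, a
-- common choice. All selected elements contain the image of a point of the tile `h`, so they span a
-- simplex of the nerve.
theorem exists_selection : ∃ m ≥ 1, ∃ S : E.Γ.Selection (B.pow m), ∀ v b, ∀ w ∈ S.sel v b,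
    ∃ U : 𝒱, w = E.emb U ∧
      ∀ z ∈ E.zone v, iter (limitMap hB hN) m (Tensor.tmul z b) ∈ U.1 := by
  obtain ⟨A, hA, hAE⟩ := E.exists_finite_nbr
  obtain ⟨m, hm, hlevel⟩ := exists_level hB hN hopen hcov (fun g U hU => 𝒱.smul_mem (op g) hU) hA
  have hcommon : ∀ σ ∈ E.Γ.complex.faces, ∀ b : (B.pow m).carrier, ∃ U : 𝒱, ∀ v ∈ σ,
      U ∈ E.target hB hN m v b := by
    intro σ hσ b
    obtain ⟨h, hh⟩ := E.exists_mem_nbr σ hσ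
    obtain ⟨U, hU, hUA⟩ := hlevel m le_rfl b h
    refine ⟨⟨U, hU⟩, fun v hv z hz => ?_⟩
    obtain ⟨k, hk, hzk⟩ := Set.mem_iUnion₂.mp hz
    obtain ⟨a, ha, rfl⟩ := hAE v h (hh v hv) k hk
    exact hUA a ha z hzk
  have hfinite := fun v b => (E.finite_target hB hN hfin hm v b).image E.emb
  have hmem : ∀ {v b w}, w ∈ (hfinite v b).toFinset ↔ ∃ U ∈ E.target hB hN m v b, E.emb U = w :=
    fun {v b w} => (hfinite v b).mem_toFinset
  refine ⟨m, hm, {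
    sel := fun v b => (hfinite v b).toFinset
    sel_smul := fun v g b => by
      simp only [E.target_smul]
    sel_rsmul := fun v g b => ?_
    exists_common := fun σ hσ b => ?_
    exists_face := fun σ hσ b => ?_ }, fun v b w hw => ?_⟩
  · ext w
    rw [Finset.mem_map, hmem]
    constructor
    · rintro ⟨U, hU, rfl⟩
      have h1 := E.rsmul_mem_target hB hN hU g⁻¹
      rw [rsmul_rsmul, mul_inv_cancel, rsmul_one] at h1
      refine ⟨E.emb (U <• g⁻¹), hmem.mpr ⟨_, h1, rfl⟩, ?_⟩
      show E.emb (U <• g⁻¹) <• g = _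
      rw [← map_smul, rsmul_rsmul, inv_mul_cancel, rsmul_one]
    · rintro ⟨w, hw, rfl⟩
      obtain ⟨U, hU, rfl⟩ := hmem.mp hw
      exact ⟨_, E.rsmul_mem_target hB hN hU g, map_smul _ _ _⟩
  · obtain ⟨U, hU⟩ := hcommon σ hσ b
    exact ⟨E.emb U, fun v hv => hmem.mpr ⟨U, hU v hv, rfl⟩⟩
  · classical
    obtain ⟨U, hU⟩ := hcommon σ hσ b
    obtain ⟨h, hh⟩ := E.exists_mem_nbr σ hσ
    obtain ⟨z, hz⟩ := exists_mem_tile_of_word hX hm b h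
    obtain ⟨v₀, hv₀⟩ := (E.Γ.complex.isRelLowerSet_faces hσ).1
    refine ⟨σ.biUnion fun v => (hfinite v b).toFinset,
      E.nerve (iter (limitMap hB hN) m (Tensor.tmul z b)) _
        ⟨E.emb U, Finset.mem_biUnion.mpr ⟨v₀, hv₀, hmem.mpr ⟨U, hU v₀ hv₀, rfl⟩⟩⟩
        fun w hw => ?_, fun v hv =>
          Finset.subset_biUnion_of_mem (fun v => (hfinite v b).toFinset) hv⟩
    obtain ⟨v, hv, hw⟩ := Finset.mem_biUnion.mp hw
    obtain ⟨U', hU', rfl⟩ := hmem.mp hw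
    exact ⟨U', hU' z (Set.mem_biUnion (hh v hv) hz), rfl⟩
  · obtain ⟨U, hU, rfl⟩ := hmem.mp hw
    exact ⟨U, rfl, hU⟩

/-- The affine model defined by a metric for which a selection map is contracting. -/
def toModel {m : ℕ} (hm : 1 ≤ m) (S : E.Γ.Selection (B.pow m))
    {δ : E.Γ.Realization → E.Γ.Realization → ℝ} (hle : ∀ x y, E.Γ.l1 x y ≤ δ x y)
    (heq : ∀ σ ∈ E.Γ.complex.faces, ∀ x ∈ E.Γ.cell σ, ∀ y ∈ E.Γ.cell σ, δ x y = E.Γ.l1 x y)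
    (hsymm : ∀ x y, δ x y = δ y x) (htri : ∀ x y z, δ x z ≤ δ x y + δ y z)
    (hiso : ∀ (g : G) x y, δ (x <• g) (y <• g) = δ x y)
    (hcon : ∀ b x y, δ (S.map (Tensor.tmul x b)) (S.map (Tensor.tmul y b)) ≤
      Selection.coeff d * δ x y) : AffineModel B d where
  m := m
  one_le_m := hm
  Γ := E.Γ
  hasDim := E.hasDim
  proper := E.proper
  cocompact := E.isCocompact
  δ := δ
  isMetric := E.isLocallyFinite.isMetric hle heq hsymm htri
  isometric := hiso
  I := S.map
  continuous := S.continuous_map E.hasDim.2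
  piecewiseAffine := S.isPiecewiseAffine_map
  contracting := isContractingMap_of_le hiso (Selection.coeff_pos d) (Selection.coeff_lt_one d) hcon

include hB hN hopen hcov hfin in
theorem exists_length_model (hconn : ∀ x y : E.Γ.Realization, ∃ r, E.Γ.IsChain x y r) :
    ∃ M : AffineModel B d, ConnectedSpace M.Γ.Realization ∧ M.IsL1Length := by
  obtain ⟨m, hm, S, -⟩ := E.exists_selection hB hN hopen hcov hfin
  have hne : Nonempty E.Γ.Realization := by
    obtain ⟨σ, hσ, -⟩ := E.hasDim.1
    exact ⟨bary hσ⟩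
  exact ⟨E.toModel hm S (l1_le_len hconn) (fun σ hσ x hx y hy => len_eq_l1 hconn hσ hx hy)
    len_comm (len_triangle hconn) len_rsmul fun b =>
      len_map_le hconn (Selection.coeff_pos d) (fun σ hσ => S.exists_cell b hσ)
        fun σ hσ x hx y hy => S.l1_map_le E.hasDim.2 b hσ hx hy,
    connectedSpace_of_chains (Γ := E.Γ) hconn, isGLB_len hconn⟩

include E hB hN hopen hcov hfin in
-- Without connectedness the length distance may be infinite, so `stretchDist` is used. Finiteness
-- comes from comparing the map on `Γ` with the self-similarity of the limit space: orbits of points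
-- `z` in the zones follow the orbits of points of `Γ`.
theorem exists_l1_model : ∃ M : AffineModel B d, M.IsPiecewiseL1 := by
  obtain ⟨m, hm, S, hS⟩ := E.exists_selection hB hN hopen hcov hfin
  have hcell := fun b σ hσ => S.exists_cell (σ := σ) b hσ
  have hl1 := fun b σ hσ x hx y hy =>
    S.l1_map_le E.hasDim.2 (d := d) b (σ := σ) hσ (x := x) (y := y) hx hy
  set J := iterHom (limitMap hB hN) m with hJ
  have hstep : ∀ (b : (B.pow m).carrier) (x : E.Γ.Realization) (z : B.LimitGSpace X),
      (∀ u ∈ x.1.support, z ∈ E.zone u) → ∀ u ∈ (S.map (Tensor.tmul x b)).1.support,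
        ∃ U : 𝒱, J (Tensor.tmul z b) ∈ U.1 ∧ u = E.emb U := by
    intro b x z h u hu
    obtain ⟨w, hw, hu⟩ := S.exists_of_mem_support_map hu
    obtain ⟨U, rfl, hU⟩ := hS w b u hu
    exact ⟨U, hU z (h w hw), rfl⟩
  -- The statement starts after one application because only then are all vertices of the support
  -- elements of the cover, all containing the image of `z`.
  have hnerve : ∀ (n : ℕ) (v : ((B.pow m).pow (n + 1)).carrier) (x : E.Γ.Realization)
      (z : B.LimitGSpace X), (∀ u ∈ x.1.support, z ∈ E.zone u) →
      ∀ u ∈ (iter S.map (n + 1) (Tensor.tmul x v)).1.support,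
        ∃ U : 𝒱, iter J (n + 1) (Tensor.tmul z v) ∈ U.1 ∧ u = E.emb U := by
    intro n
    induction n with
    | zero =>
      intro v x z h u hu
      obtain ⟨b, g, rfl⟩ := Tensor.exists_tmul (B := (B.pow m).pow 0) v
      change G at g
      obtain ⟨U, hU, e⟩ := hstep b x z h _ (mem_support_rsmul.mp hu)
      refine ⟨U <• g, Set.smul_mem_smul_set hU, ?_⟩
      rw [map_smul, ← e, rsmul_rsmul, inv_mul_cancel, rsmul_one]
    | succ n ih =>
      intro v x z h
      obtain ⟨b, v, rfl⟩ := Tensor.exists_tmul (B := (B.pow m).pow (n + 1)) v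
      refine ih v (S.map (Tensor.tmul x b)) (J (Tensor.tmul z b)) fun u hu => ?_
      obtain ⟨U, hU, rfl⟩ := hstep b x z h u hu
      exact E.mem_zone_emb hU
  -- At a high level the points following `x` and `y` lie in a single `U` of the cover. Each image
  -- then shares a simplex with the vertex of `U`, and two steps of length at most `2` give `4`.
  have hbdd : ∀ x y, BddAbove (Set.range (stretch S.map (Selection.coeff d) x y)) := by
    intro x y
    obtain ⟨h, hh⟩ := E.exists_mem_nbr _ x.2.2.2
    obtain ⟨k, hk⟩ := E.exists_mem_nbr _ y.2.2.2
    obtain ⟨n₀, hn₀, hlevel⟩ := exists_level hB hN hopen hcov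
      (fun g U hU => 𝒱.smul_mem (op g) hU) (A := {h, k}) (Set.toFinite _)
    refine bddAbove_stretch (Selection.coeff_pos d) hcell hl1 (Selection.coeff_lt_one d)
      (n₀ := n₀ + 1) (R := 4) fun v => ?_
    obtain ⟨w, hw⟩ := exists_iter_iterHom (limitMap hB hN) m (n₀ + 1) v
    have hle : n₀ ≤ m * (n₀ + 1) :=
      n₀.le_succ.trans (Nat.le_mul_of_pos_left (n₀ + 1) hm)
    obtain ⟨U, hU, hUA⟩ := hlevel _ hle w 1
    obtain ⟨z, hz⟩ := exists_mem_tile_of_word hX (by omega) w h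
    obtain ⟨z', hz'⟩ := exists_mem_tile_of_word hX (by omega) w k
    have hx := hnerve n₀ v x z fun u hu => Set.mem_biUnion (hh u hu) hz
    have hy := hnerve n₀ v y z' fun u hu => Set.mem_biUnion (hk u hu) hz'
    have hzU : iter J (n₀ + 1) (Tensor.tmul z v) ∈ U := by
      rw [hJ, hw]
      exact hUA h (Or.inl rfl) z (by rwa [mul_one])
    have hzU' : iter J (n₀ + 1) (Tensor.tmul z' v) ∈ U := by
      rw [hJ, hw]
      exact hUA k (Or.inr rfl) z' (by rwa [mul_one])
    classical
    have key : ∀ (ξ : E.Γ.Realization) (ζ : B.LimitGSpace X), ζ ∈ U →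
        (∀ u ∈ ξ.1.support, ∃ U : 𝒱, ζ ∈ U.1 ∧ u = E.emb U) →
        E.Γ.IsChain ξ (vertex (E.emb ⟨U, hU⟩)) (E.Γ.l1 ξ (vertex (E.emb ⟨U, hU⟩))) := by
      intro ξ ζ hζ h
      have hσ := E.nerve ζ (insert (E.emb ⟨U, hU⟩) ξ.1.support) (Finset.insert_nonempty _ _)
        fun u hu => by
          obtain rfl | hu := Finset.mem_insert.mp hu
          · exact ⟨⟨U, hU⟩, hζ, rfl⟩
          · exact h u hu
      exact IsChain.single hσ (Finset.subset_insert _ _)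
        (vertex_mem_cell (Finset.mem_insert_self _ _))
    refine ⟨_, ?_, (key _ _ hzU hx).trans (key _ _ hzU' hy).symm⟩
    linarith [l1_le_two (iter S.map (n₀ + 1) (Tensor.tmul x v)) (vertex (E.emb ⟨U, hU⟩)),
      l1_le_two (iter S.map (n₀ + 1) (Tensor.tmul y v)) (vertex (E.emb ⟨U, hU⟩))]
  have heq := fun σ hσ x hx y hy =>
    stretchDist_eq_l1 (Selection.coeff_pos d) hcell hl1 hbdd (σ := σ) hσ (x := x) (y := y) hx hy
  exact ⟨E.toModel hm S (l1_le_stretchDist hbdd) heq stretchDist_comm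
    (stretchDist_triangle (Selection.coeff_pos d) hbdd) (fun g x y => stretchDist_rsmul hbdd x y g)
    (stretchDist_map_le (Selection.coeff_pos d) hbdd), heq⟩

end NerveExtension

end Model

end SelfSimilar

end

noncomputable section

namespace SelfSimilar

/-! ### Construction of the extended nerve. -/

open scoped Pointwise

namespace GComplex

variable {G : Type u} [Group G]

/-- The complex of nonempty finite subsets of the members of an invariant family of sets. -/
def ofSets {V : Type u} [MulAction Gᵐᵒᵖ V] (𝓜 : Set (Set V)) (hcov : ∀ v, ∃ M ∈ 𝓜, v ∈ M)
    (hinv : ∀ g : G, ∀ M ∈ 𝓜, ∃ M' ∈ 𝓜, ∀ v ∈ M, v <• g ∈ M') : GComplex G where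
  V := V
  complex :=
    { faces := {σ | σ.Nonempty ∧ ∃ M ∈ 𝓜, ∀ v ∈ σ, v ∈ M}
      isRelLowerSet_faces := fun _ ⟨hσ, M, hM, h⟩ =>
        ⟨hσ, fun _ hτ hne => ⟨hne, M, hM, fun v hv => h v (hτ hv)⟩⟩
      singleton_mem := fun v => by
        obtain ⟨M, hM, hv⟩ := hcov v
        exact ⟨Finset.singleton_nonempty v, M, hM, fun u hu => by
          rwa [Finset.mem_singleton.mp hu]⟩ }
  map_mem := by
    rintro g σ ⟨hσ, M, hM, h⟩
    obtain ⟨M', hM', h'⟩ := hinv g M hM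
    refine ⟨hσ.map, M', hM', fun v hv => ?_⟩
    obtain ⟨u, hu, rfl⟩ := Finset.mem_map.mp hv
    exact h' u (h u hu)

theorem exists_chain_of_adjacent {Γ : GComplex G} {u v : Γ.V}
    (h : ∀ σ : Finset Γ.V, σ.Nonempty → (∀ w ∈ σ, w = u ∨ w = v) → σ ∈ Γ.complex.faces) :
    ∃ r, Γ.IsChain (vertex u) (vertex v) r := by
  classical
  exact ⟨_, IsChain.single (σ := {u, v}) (h _ (Finset.insert_nonempty _ _) (by simp))
    (vertex_mem_cell (by simp)) (vertex_mem_cell (by simp))⟩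

theorem exists_chain_of_vertices {Γ : GComplex G} {v₀ : Γ.V}
    (h : ∀ v : Γ.V, ∃ r, Γ.IsChain (vertex v) (vertex v₀) r) (x y : Γ.Realization) :
    ∃ r, Γ.IsChain x y r := by
  have key : ∀ x : Γ.Realization, ∃ r, Γ.IsChain x (vertex v₀) r := by
    intro x
    obtain ⟨v, hv⟩ := support_nonempty x
    obtain ⟨r, hr⟩ := h v
    exact ⟨_, (IsChain.single x.2.2.2 (support_mem_cell x) (vertex_mem_cell hv)).trans hr⟩
  obtain ⟨r, hr⟩ := key x
  obtain ⟨s, hs⟩ := key y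
  exact ⟨_, hr.trans hs.symm⟩

end GComplex

section Nerve

open Biset GComplex

variable {G : Type u} [Group G] {B : Biset G} {X : Set B.carrier} (d : ℕ)
  (𝒱 : SubMulAction Gᵐᵒᵖ (Set (B.LimitGSpace X))) (S : Set G) (𝒱₁ : Set 𝒱)

/-- The vertices of the nerve of a cover, and those of the simplices `{g} × Δ`, `g ∈ G`. -/
abbrev NerveVertex : Type u := 𝒱 ⊕ (Σ _ : Fin (d + 1), G)

/-- The maximal simplices: those of the nerve, the simplices `{g} × Δ`, and edges which connect
these simplices along `S`, and with the nerve along `𝒱₁`. -/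
inductive IsNerveSimplex : Set (NerveVertex d 𝒱) → Prop
  | nerve (z : B.LimitGSpace X) : IsNerveSimplex {v | ∃ U : 𝒱, z ∈ U.1 ∧ v = Sum.inl U}
  | simplex (g : G) : IsNerveSimplex {v | ∃ i, v = Sum.inr ⟨i, g⟩}
  | edge (g s : G) (hs : s ∈ S) : IsNerveSimplex {Sum.inr ⟨0, g⟩, Sum.inr ⟨0, s * g⟩}
  | link (g : G) (U : 𝒱) (hU : U ∈ 𝒱₁) : IsNerveSimplex {Sum.inr ⟨0, g⟩, Sum.inl (U <• g)}

variable {d 𝒱 S 𝒱₁}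

theorem IsNerveSimplex.rsmul {M : Set (NerveVertex d 𝒱)} (hM : IsNerveSimplex d 𝒱 S 𝒱₁ M)
    (h : G) : ∃ M', IsNerveSimplex d 𝒱 S 𝒱₁ M' ∧ ∀ v ∈ M, v <• h ∈ M' := by
  cases hM with
  | nerve z =>
    refine ⟨_, .nerve (z <• h), ?_⟩
    rintro _ ⟨U, hz, rfl⟩
    exact ⟨U <• h, Set.smul_mem_smul_set hz, rfl⟩
  | simplex g =>
    refine ⟨_, .simplex (g * h), ?_⟩
    rintro _ ⟨i, rfl⟩
    exact ⟨i, rfl⟩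
  | edge g s hs =>
    refine ⟨_, .edge (g * h) s hs, ?_⟩
    rintro _ (rfl | rfl)
    · exact Or.inl rfl
    · refine Or.inr ?_
      rw [← mul_assoc]
      rfl
  | link g U hU =>
    refine ⟨_, .link (g * h) U hU, ?_⟩
    rintro _ (rfl | rfl)
    · exact Or.inl rfl
    · refine Or.inr ?_
      rw [← rsmul_rsmul]
      rfl

theorem IsNerveSimplex.encard_le {M : Set (NerveVertex d 𝒱)} (hM : IsNerveSimplex d 𝒱 S 𝒱₁ M)
    (horder : ∀ z, {V | V ∈ 𝒱 ∧ z ∈ V}.encard ≤ d + 1) (hS : S.Nonempty → 1 ≤ d)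
    (h𝒱₁ : 𝒱₁.Nonempty → 1 ≤ d) : M.encard ≤ d + 1 := by
  have hpair : ∀ u v : NerveVertex d 𝒱, 1 ≤ d → ({u, v} : Set (NerveVertex d 𝒱)).encard ≤ d + 1 :=
    fun u v hd => (Set.encard_insert_le _ _).trans <| by
      rw [Set.encard_singleton]
      exact add_le_add_left (by exact_mod_cast hd) 1
  cases hM with
  | nerve z =>
    refine le_trans ?_ (horder z)
    refine (Set.encard_le_encard ?_).trans (Set.encard_image_le
      (fun U : 𝒱 => (Sum.inl U : NerveVertex d 𝒱)) {U : 𝒱 | z ∈ U.1}) |>.trans ?_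
    · rintro _ ⟨U, hz, rfl⟩
      exact ⟨U, hz, rfl⟩
    · exact Set.encard_le_encard_of_injOn (f := Subtype.val) (fun U hU => ⟨U.2, hU⟩)
        Subtype.val_injective.injOn
  | simplex g =>
    have : {v : NerveVertex d 𝒱 | ∃ i, v = Sum.inr ⟨i, g⟩} =
        (fun i : Fin (d + 1) => (Sum.inr ⟨i, g⟩ : NerveVertex d 𝒱)) '' Set.univ := by
      ext v
      constructor
      · rintro ⟨i, rfl⟩
        exact ⟨i, trivial, rfl⟩
      · rintro ⟨i, -, rfl⟩
        exact ⟨i, rfl⟩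
    rw [this]
    refine (Set.encard_image_le _ _).trans ?_
    simp
  | edge g s hs => exact hpair _ _ (hS ⟨s, hs⟩)
  | link g U hU => exact hpair _ _ (h𝒱₁ ⟨U, hU⟩)

/-- The complex with the given maximal simplices. -/
def nerveComplex (hcov : ∀ U : 𝒱, U.1.Nonempty) : GComplex G :=
  ofSets (V := NerveVertex d 𝒱) {M | IsNerveSimplex d 𝒱 S 𝒱₁ M} (by
    rintro (U | ⟨i, g⟩)
    · obtain ⟨z, hz⟩ := hcov U
      exact ⟨_, .nerve z, U, hz, rfl⟩
    · exact ⟨_, .simplex g, i, rfl⟩) fun g _ hM => IsNerveSimplex.rsmul hM g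

variable (S 𝒱₁) in
/-- The elements of `G` near to a vertex. -/
def nerveNbr : NerveVertex d 𝒱 → Set G
  | Sum.inl U => {h | ∃ z ∈ U.1, z ∈ B.tile X h} ∪ {g | ∃ U' ∈ 𝒱₁, U' <• g = U}
  | Sum.inr v => {h | h = v.2 ∨ ∃ s ∈ S, s * h = v.2}

variable (hB : B.IsSelfSimilar) {hX : B.IsBasis X} {N : Set G} (hN : IsNucleus hX N)

include hB hN in
theorem finite_nerveNbr (hS : S.Finite) (h𝒱₁ : 𝒱₁.Finite) (hne : ∀ U : 𝒱, U.1.Nonempty)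
    (hK : ∀ U : 𝒱, ∃ K, IsCompact K ∧ U.1 ⊆ K) (v : NerveVertex d 𝒱) :
    (nerveNbr S 𝒱₁ v).Finite := by
  have htiles : ∀ U : 𝒱, ∃ A : Set G, A.Finite ∧ U.1 ⊆ ⋃ a ∈ A, B.tile X a := fun U => by
    obtain ⟨K, hK, hUK⟩ := hK U
    obtain ⟨A, hA, hKA⟩ := exists_tiles_of_isCompact hB hN hK
    exact ⟨A, hA, hUK.trans hKA⟩
  obtain U | ⟨i, g⟩ := v
  · obtain ⟨A, hA, hUA⟩ := htiles U
    refine Set.Finite.union ?_ ?_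
    · refine (hN.finite.image2 (fun s a => s * a) hA).subset ?_
      rintro h ⟨z, hz, hzh⟩
      obtain ⟨a, ha, hza⟩ := Set.mem_iUnion₂.mp (hUA hz)
      obtain ⟨s, hs, e⟩ := exists_mul_of_mem_tile hB hN hza hzh
      exact ⟨s, hs, a, ha, e⟩
    · choose A' hA' hUA' using htiles
      refine (h𝒱₁.biUnion fun U' _ => finite_rsmul_tiles hB hN (hA' U') hA).subset ?_
      rintro g ⟨U', hU', e⟩
      obtain ⟨z, hz⟩ := hne U'
      refine Set.mem_biUnion hU' ⟨z, hUA' U' hz, hUA ?_⟩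
      rw [← e]
      exact Set.smul_mem_smul_set hz
  · refine ((Set.finite_singleton g).union (hS.image fun s => s⁻¹ * g)).subset ?_
    rintro h (rfl | ⟨s, hs, e⟩)
    · exact Or.inl rfl
    · refine Or.inr ⟨s, hs, ?_⟩
      show s⁻¹ * g = h
      rw [← show s * h = g from e, inv_mul_cancel_left]

theorem mul_mem_nerveNbr (v : NerveVertex d 𝒱) (g h : G) (hh : h ∈ nerveNbr S 𝒱₁ v) :
    h * g ∈ nerveNbr S 𝒱₁ (v <• g) := by
  obtain U | ⟨i, k⟩ := v
  · obtain ⟨z, hz, hzh⟩ | ⟨U', hU', rfl⟩ := hh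
    · exact Or.inl ⟨z <• g, Set.smul_mem_smul_set hz, rsmul_mem_tile hzh g⟩
    · exact Or.inr ⟨U', hU', (rsmul_rsmul U' h g).symm⟩
  · obtain rfl | ⟨s, hs, rfl⟩ := hh
    · exact Or.inl rfl
    · exact Or.inr ⟨s, hs, (mul_assoc s h g).symm⟩

/-- The second alternatives in `nerveNbr` are there for this: the two ends of an edge or a link
share the element `g`. -/
theorem IsNerveSimplex.exists_mem_nbr {M : Set (NerveVertex d 𝒱)}
    (hM : IsNerveSimplex d 𝒱 S 𝒱₁ M) : ∃ h, ∀ v ∈ M, h ∈ nerveNbr S 𝒱₁ v := by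
  cases hM with
  | nerve z =>
    obtain ⟨h, hh⟩ := exists_mem_tile z
    refine ⟨h, ?_⟩
    rintro _ ⟨U, hz, rfl⟩
    exact Or.inl ⟨z, hz, hh⟩
  | simplex g =>
    refine ⟨g, ?_⟩
    rintro _ ⟨i, rfl⟩
    exact Or.inl rfl
  | edge g s hs =>
    refine ⟨g, ?_⟩
    rintro _ (rfl | rfl)
    · exact Or.inl rfl
    · exact Or.inr ⟨s, hs, rfl⟩
  | link g U hU =>
    refine ⟨g, ?_⟩
    rintro _ (rfl | rfl)
    · exact Or.inl rfl
    · exact Or.inr ⟨U, hU, rfl⟩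

/-- The extension of the nerve of a cover by simplices and edges. -/
def nerveExtension (hS : S.Finite) (h𝒱₁ : 𝒱₁.Finite) (hne : ∀ U : 𝒱, U.1.Nonempty)
    (hK : ∀ U : 𝒱, ∃ K, IsCompact K ∧ U.1 ⊆ K)
    (horder : ∀ z, {V | V ∈ 𝒱 ∧ z ∈ V}.encard ≤ d + 1) (hSd : S.Nonempty → 1 ≤ d)
    (h𝒱d : 𝒱₁.Nonempty → 1 ≤ d) {𝒱₀ : Set 𝒱} (h𝒱₀ : 𝒱₀.Finite)
    (hreps : ∀ U : 𝒱, ∃ g : G, U <• g ∈ 𝒱₀) : NerveExtension 𝒱 d where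
  Γ := nerveComplex (d := d) (S := S) (𝒱₁ := 𝒱₁) hne
  hasDim := by
    -- The nerve may have smaller dimension; the simplices `{g} × Δ` make it exactly `d`.
    refine ⟨⟨Finset.univ.map ⟨fun i : Fin (d + 1) => (Sum.inr ⟨i, (1 : G)⟩ : NerveVertex d 𝒱),
      fun i j e => (Sigma.mk.inj (Sum.inr_injective e)).1⟩,
      ⟨Finset.univ_nonempty.map, _, IsNerveSimplex.simplex 1, fun v hv => ?_⟩, ?_⟩, ?_⟩
    · obtain ⟨i, -, rfl⟩ := Finset.mem_map.mp hv
      exact ⟨i, rfl⟩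
    · rw [Finset.card_map, Finset.card_univ, Fintype.card_fin]
    · rintro (σ : Finset (NerveVertex d 𝒱)) ⟨-, M, hM, h⟩
      have h1 := (Set.encard_le_encard (s := (σ : Set (NerveVertex d 𝒱))) h).trans
        (IsNerveSimplex.encard_le hM horder hSd h𝒱d)
      rw [Set.encard_coe_eq_coe_finsetCard] at h1
      exact_mod_cast h1
  nbr := nerveNbr S 𝒱₁
  finite_nbr := finite_nerveNbr hB hN hS h𝒱₁ hne hK
  mul_mem_nbr := mul_mem_nerveNbr
  exists_mem_nbr := by
    rintro σ ⟨-, M, hM, h⟩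
    obtain ⟨k, hk⟩ := IsNerveSimplex.exists_mem_nbr hM
    exact ⟨k, fun v hv => hk v (h v hv)⟩
  reps := ((h𝒱₀.image fun U => (Sum.inl U : NerveVertex d 𝒱)).union
    (Set.finite_range fun i => Sum.inr ⟨i, 1⟩)).toFinset
  exists_mem_reps := by
    rintro (U | ⟨i, g⟩)
    · obtain ⟨g, hg⟩ := hreps U
      exact ⟨g, (Set.Finite.mem_toFinset _).mpr (Or.inl ⟨_, hg, rfl⟩)⟩
    · refine ⟨g⁻¹, (Set.Finite.mem_toFinset _).mpr (Or.inr ⟨i, ?_⟩)⟩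
      show (Sum.inr ⟨i, 1⟩ : NerveVertex d 𝒱) = Sum.inr ⟨i, g * g⁻¹⟩
      rw [mul_inv_cancel]
  emb := { toFun := Sum.inl, map_smul' := fun _ _ => rfl }
  exists_tile := fun U z hz => by
    obtain ⟨h, hh⟩ := exists_mem_tile z
    exact ⟨h, Or.inl ⟨z, hz, hh⟩, hh⟩
  nerve := fun z σ hσ h => ⟨hσ, _, IsNerveSimplex.nerve z, h⟩

/-- The edges along `S` form a Cayley graph on the vertices `(0, g)`, connected because `S`
generates `G`. Each other vertex is joined to it through its simplex or a link. -/
theorem exists_chain_nerveComplex (hne : ∀ U : 𝒱, U.1.Nonempty) (hS : Subgroup.closure S = ⊤)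
    (h𝒱₁ : ∀ U : 𝒱, ∃ g : G, U <• g ∈ 𝒱₁)
    (x y : (nerveComplex (d := d) (S := S) (𝒱₁ := 𝒱₁) hne).Realization) :
    ∃ r, (nerveComplex (d := d) (S := S) (𝒱₁ := 𝒱₁) hne).IsChain x y r := by
  let Γ : GComplex G := nerveComplex (d := d) (S := S) (𝒱₁ := 𝒱₁) hne
  have hadj : ∀ {M : Set (NerveVertex d 𝒱)}, IsNerveSimplex d 𝒱 S 𝒱₁ M → ∀ u ∈ M, ∀ v ∈ M,
      ∃ r, Γ.IsChain (vertex (u : Γ.V)) (vertex (v : Γ.V)) r := by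
    intro M hM (u : Γ.V) hu (v : Γ.V) hv
    refine exists_chain_of_adjacent fun σ hσ h => ⟨hσ, M, hM, fun w hw => ?_⟩
    obtain rfl | rfl := h w hw
    · exact hu
    · exact hv
  have htrans : ∀ {u v w : Γ.V}, (∃ r, Γ.IsChain (vertex u) (vertex v) r) →
      (∃ r, Γ.IsChain (vertex v) (vertex w) r) → ∃ r, Γ.IsChain (vertex u) (vertex w) r :=
    fun ⟨_, h⟩ ⟨_, h'⟩ => ⟨_, h.trans h'⟩
  have hG : ∀ g : G, ∃ r, Γ.IsChain (vertex (Sum.inr ⟨0, g⟩ : NerveVertex d 𝒱))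
      (vertex (Sum.inr ⟨0, 1⟩ : NerveVertex d 𝒱)) r := by
    intro g
    have hg : g ∈ Subgroup.closure S := hS ▸ Subgroup.mem_top g
    induction hg using Subgroup.closure_induction_left with
    | one => exact ⟨_, IsChain.refl _⟩
    | mul_left s hs g _ ih =>
      exact htrans (hadj (.edge g s hs) _ (Or.inr rfl) _ (Or.inl rfl)) ih
    | inv_mul_cancel s hs g _ ih =>
      refine htrans (hadj (.edge (s⁻¹ * g) s hs) _ (Or.inl rfl) _ (Or.inr ?_)) ih
      show Sum.inr _ = Sum.inr _
      rw [mul_inv_cancel_left]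
  refine exists_chain_of_vertices (v₀ := (Sum.inr ⟨0, 1⟩ : NerveVertex d 𝒱)) ?_ x y
  rintro (U | ⟨i, g⟩)
  · obtain ⟨g, hg⟩ := h𝒱₁ U
    refine htrans (hadj (.link g⁻¹ _ hg) _ (Or.inr ?_) _ (Or.inl rfl)) (hG g⁻¹)
    show Sum.inl _ = Sum.inl _
    rw [rsmul_rsmul, mul_inv_cancel, rsmul_one]
  · exact htrans (hadj (.simplex g) _ ⟨i, rfl⟩ _ ⟨0, rfl⟩) (hG g)

end Nerve

/-! ### Assembly of the theorem. -/

section Main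

open Biset GComplex

variable {G : Type u} [Group G] {B : Biset G} {X : Set B.carrier} {d : ℕ}
variable (hB : B.IsSelfSimilar) {hX : B.IsBasis X} {N : Set G} (hN : IsNucleus hX N)

include hB hN in
/-- The limit `G`-space of dimension at most `d` has an invariant cover of order at most `d + 1`
by relatively compact sets. -/
theorem exists_good_cover (hdim : CoveringDimLE (B.LimitGSpace X) d) :
    ∃ 𝒱 : SubMulAction Gᵐᵒᵖ (Set (B.LimitGSpace X)), (∀ V ∈ 𝒱, IsOpen V) ∧
      (∀ U : 𝒱, U.1.Nonempty) ∧ (∀ U : 𝒱, ∃ K, IsCompact K ∧ U.1 ⊆ K) ∧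
      ⋃₀ (𝒱 : Set (Set (B.LimitGSpace X))) = Set.univ ∧
      (∃ 𝒱₀ : Set 𝒱, 𝒱₀.Finite ∧ ∀ U : 𝒱, ∃ g : G, U <• g ∈ 𝒱₀) ∧
      ∀ z, {V | V ∈ 𝒱 ∧ z ∈ V}.encard ≤ d + 1 := by
  have := t2Space_limit hB hN
  have := weaklyLocallyCompactSpace_limit hB hN
  have := properlyDiscontinuous_limit hB hN
  -- The compact tile of `1` meets every orbit.
  have : CompactSpace (MulAction.orbitRel.Quotient Gᵐᵒᵖ (B.LimitGSpace X)) := by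
    refine ⟨?_⟩
    have h1 : IsCompact ((Quotient.mk (MulAction.orbitRel Gᵐᵒᵖ (B.LimitGSpace X))) ''
        B.tile X (1 : G)) := (isCompact_tile hB (hX := hX) 1).image continuous_quotient_mk'
    convert h1
    refine (Set.eq_univ_of_forall fun y => ?_).symm
    induction y using Quotient.inductionOn with
    | h z =>
      obtain ⟨g, hg⟩ := exists_mem_tile z
      refine ⟨z <• g⁻¹, ?_, Quotient.sound ⟨op g⁻¹, rfl⟩⟩
      have := rsmul_mem_tile hg g⁻¹
      rwa [mul_inv_cancel] at this
  obtain ⟨𝒱, h1, h2, h3, ⟨𝒱₀, h4, h5, h6⟩, h7⟩ := exists_invariant_cover (Γ := Gᵐᵒᵖ) hdim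
    (M := N.ncard) fun z => ncard_stabilizer_le hB hN z
  refine ⟨⟨𝒱, fun g {V} hV => h3 g V hV⟩, fun V hV => (h1 V hV).1, fun U => (h1 U.1 U.2).2.1,
    fun U => (h1 U.1 U.2).2.2, h2, ⟨Subtype.val ⁻¹' 𝒱₀,
      h5.preimage Subtype.val_injective.injOn, fun U => ?_⟩, h7⟩
  obtain ⟨g, hg⟩ := h6 U.1 U.2
  exact ⟨g.unop, hg⟩

include hB hN in
theorem exists_model_of_coveringDimLE (hdim : CoveringDimLE (B.LimitGSpace X) d) :
    ∃ M : AffineModel B d, M.IsPiecewiseL1 := by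
  obtain ⟨𝒱, h1, h2, h3, h4, ⟨𝒱₀, h5, h6⟩, h7⟩ := exists_good_cover hB hN hdim
  -- No edges or links are added here, so that `d = 0` is allowed.
  exact (nerveExtension hB hN (S := ∅) (𝒱₁ := ∅) Set.finite_empty Set.finite_empty h2 h3 h7
    (fun h => absurd h Set.not_nonempty_empty) (fun h => absurd h Set.not_nonempty_empty) h5
    h6).exists_l1_model hB hN h1 h4 fun z => Set.finite_of_encard_le_coe (k := d + 1) (h7 z)

include hB hN in
theorem exists_connected_model_of_coveringDimLE (hG : Group.FG G) (hd : 1 ≤ d)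
    (hdim : CoveringDimLE (B.LimitGSpace X) d) :
    ∃ M : AffineModel B d, ConnectedSpace M.Γ.Realization ∧ M.IsL1Length := by
  obtain ⟨𝒱, h1, h2, h3, h4, ⟨𝒱₀, h5, h6⟩, h7⟩ := exists_good_cover hB hN hdim
  obtain ⟨S, hS⟩ := hG.out
  -- The finite set of orbit representatives also serves as the set of links; the added edges
  -- respect the dimension because `1 ≤ d`.
  exact (nerveExtension hB hN (S := S) (𝒱₁ := 𝒱₀) S.finite_toSet h5 h2 h3 h7
    (fun _ => hd) (fun _ => hd) h5 h6).exists_length_model hB hN h1 h4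
    (fun z => Set.finite_of_encard_le_coe (k := d + 1) (h7 z))
    (exists_chain_nerveComplex h2 hS h6)

end Main

end SelfSimilar

end

theorem mainTheorem1 {G : Type u} [Group G] (B : SelfSimilar.Biset G)
    (hB : B.IsSelfSimilar) (hcontr : B.IsContracting)
    (X : Set B.carrier) (hX : B.IsBasis X) :
    (∀ d : ℕ, SelfSimilar.CoveringDimLE (B.LimitGSpace X) d ↔
      Nonempty (SelfSimilar.AffineModel B d)) ∧
    (∀ d : ℕ, SelfSimilar.CoveringDimLE (B.LimitGSpace X) d →
      ∃ M : SelfSimilar.AffineModel B d, M.IsPiecewiseL1) ∧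
    (SelfSimilar.coveringDim (B.LimitGSpace X) =
      ⨅ (d : ℕ) (_ : Nonempty (SelfSimilar.AffineModel B d)), (d : ℕ∞)) ∧
    (Group.FG G → ∀ d : ℕ, 1 ≤ d → SelfSimilar.CoveringDimLE (B.LimitGSpace X) d →
      ∃ M : SelfSimilar.AffineModel B d,
        ConnectedSpace M.Γ.Realization ∧ M.IsL1Length) := by
  obtain ⟨N, hN⟩ := SelfSimilar.Biset.IsContracting.exists_nucleus hB hcontr hX
  have h : ∀ d : ℕ, SelfSimilar.CoveringDimLE (B.LimitGSpace X) d ↔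
      Nonempty (SelfSimilar.AffineModel B d) := fun d =>
    ⟨fun hd => ⟨(SelfSimilar.exists_model_of_coveringDimLE hB hN hd).choose⟩,
      fun ⟨M⟩ => M.coveringDimLE hB hN⟩
  refine ⟨h, fun d => SelfSimilar.exists_model_of_coveringDimLE hB hN, ?_,
    fun hG d hd => SelfSimilar.exists_connected_model_of_coveringDimLE hB hN hG hd⟩
  simp only [SelfSimilar.coveringDim, h]
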